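/- Let $\mathbb S^1=\mathbb R/\mathbb Z$. For a real-valued $\phi\in L^2(\mathbb S^1)$ put $\hat\phi_k=\int_0^1\phi(x)e^{-2\pi ikx}\,dx$ and, for $n\in\mathbb N$, $\|\phi\|_n^2=\sum_{k\in\mathbb Z\setminus\{0\}}(2\pi|k|)^{2n}|\hat\phi_k|^2$; let $H^n$ be the space of all real-valued $\phi\in L^2(\mathbb S^1)$ with $\int_0^1\phi\,dx=0$ and $\|\phi\|_n<\infty$. For $T>0$ let $\mathcal D([0,T];H^n)$ be the space of càdlàg functions $u:[0,T]\to H^n$ (right-continuous with left limits, with respect to $\|\cdot\|_n$), with the norm $\|u\|_{\mathcal D^n_T}=\sup_{t\in[0,T]}\|u(t)\|_n$. **Theorem.** Let $n\ge 1$ be an integer. There is a function $C_n:\mathbb R^3\to(0,\infty)$ such that for all $T>0$, $\nu>0$ and $v\in\mathcal D([0,T];H^n)$ the following holds. The perturbed Burgers equation $$\partial_tw=\nu\,\partial_{xx}w-\tfrac12\,\partial_x(w+v)^2,\qquad w(0)=0,$$ has a unique solution $w\in\mathcal D([0,T];H^n)$, where being a solution means that $w(0)=0$ and that $w(t)=\int_0^t\big(\nu\,\partial_{xx}w-\tfrac12\partial_x(w+v)^2\big)\,ds$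 for every $t\in[0,T]$ in the sense of distributions on $\mathbb S^1$, i.e. $$\int_0^1 w(t)\varphi\,dx=\int_0^t\Big(\nu\int_0^1 w(s)\varphi''\,dx+\tfrac12\int_0^1 (w(s)+v(s))^2\varphi'\,dx\Big)ds\qquad\text{for all }\varphi\in C^\infty(\mathbb S^1),\ t\in[0,T].$$ Moreover, this solution satisfies $$\|w\|_{\mathcal D^n_T}^2+\int_0^T\|w(t)\|_{n+1}^2\,dt\le C_n\big(T,\nu,\|v\|_{\mathcal D^n_T}\big)$$ (in particular $w(t)\in H^{n+1}$ for almost every $t\in[0,T]$). -/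

import Mathlib

open Set Filter Topology MeasureTheory
open scoped ENNReal

namespace Burgers

/-- The real Hilbert space `L²(𝕊¹)`, where `𝕊¹ = ℝ/ℤ` is the circle of length one. -/
abbrev L2 : Type := Lp ℝ 2 (volume : Measure UnitAddCircle)

/-- The homogeneous Sobolev norm of order `n`, with values in `[0, ∞]`:
`‖φ‖ₙ² = ∑_{k ∈ ℤ} (2π|k|)^{2n} |φ̂ₖ|²`, where `φ̂ₖ = ∫ φ(x) e^{-2πikx} dx`.
(Only the mean-zero functions are considered below, so that the mode `k = 0`,
which has weight `1` when `n = 0`, never contributes.) -/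
noncomputable def sobolevNorm (n : ℕ) (φ : L2) : ℝ≥0∞ :=
  (∑' k : ℤ, ENNReal.ofReal ((2 * Real.pi * |(k : ℝ)|) ^ (2 * n) *
    ‖fourierCoeff (fun x : UnitAddCircle => ((φ x : ℝ) : ℂ)) k‖ ^ 2)) ^ (1 / 2 : ℝ)

/-- The Sobolev space `Hⁿ` of mean-zero functions on the circle with `‖φ‖ₙ < ∞`. -/
def H (n : ℕ) : Set L2 :=
  {φ | (∫ x : UnitAddCircle, φ x) = 0 ∧ sobolevNorm n φ < ∞}

/-- `u ∈ 𝒟([0,T]; Hⁿ)`: on `[0,T]` the curve `u` takes values in `Hⁿ`, and with respect to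
the norm of `Hⁿ` it is right-continuous and has left limits in `Hⁿ`.
The values of `u` outside `[0,T]` are irrelevant. -/
structure IsCadlag (n : ℕ) (T : ℝ) (u : ℝ → L2) : Prop where
  mem : ∀ t ∈ Icc 0 T, u t ∈ H n
  right_cont : ∀ t ∈ Ico 0 T, Tendsto (fun s => sobolevNorm n (u s - u t)) (𝓝[>] t) (𝓝 0)
  left_lim : ∀ t ∈ Ioc 0 T, ∃ l ∈ H n,
    Tendsto (fun s => sobolevNorm n (u s - l)) (𝓝[<] t) (𝓝 0)

/-- The uniform norm `sup_{t ∈ [0,T]} ‖u(t)‖ₙ` on `𝒟([0,T]; Hⁿ)`. -/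
noncomputable def supNorm (n : ℕ) (T : ℝ) (u : ℝ → L2) : ℝ≥0∞ :=
  ⨆ t ∈ Icc 0 T, sobolevNorm n (u t)

/-- `w ∈ 𝒟([0,T]; Hⁿ)` solves `∂ₜw = ν ∂ₓₓw - ½ ∂ₓ(w+v)²`, `w(0) = 0` on `[0,T]`.
The equation is the integrated one, `w(t) = ∫₀ᵗ (ν ∂ₓₓw - ½ ∂ₓ(w+v)²) ds` for every
`t ∈ [0,T]`, in the sense of distributions on the circle; test functions on the circle are
the smooth functions on `ℝ` of period one. For càdlàg `v`, `w` with values in `Hⁿ`, `n ≥ 1`,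
the integrand of the time integral is a càdlàg function of `s`, hence integrable. -/
structure IsSolution (n : ℕ) (T ν : ℝ) (v w : ℝ → L2) : Prop where
  cadlag : IsCadlag n T w
  initial : w 0 = 0
  equation : ∀ φ : ℝ → ℝ, ContDiff ℝ (⊤ : ℕ∞) φ → Function.Periodic φ 1 → ∀ t ∈ Icc 0 T,
    ∫ x in (0 : ℝ)..1, w t x * φ x =
      ∫ s in (0 : ℝ)..t,
        (ν * (∫ x in (0 : ℝ)..1, w s x * iteratedDeriv 2 φ x) +
          1 / 2 * ∫ x in (0 : ℝ)..1, (w s x + v s x) ^ 2 * deriv φ x)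

end Burgers

/-! ### Fourier coefficients of real square integrable functions. -/

namespace Burgers

open AddCircle ComplexConjugate

/-! Put n = m + 1. The multiplier `J n`, with symbol (2π|k|)⁻ⁿ, maps mean-zero L² isometrically onto
Hⁿ, with inverse `D n`. Writing w = `J n` x and v = `J n` V turns the problem into one in L². On the
Fourier side it reads x_k' = -ν(2πk)² x_k - πik F_k, where F = `B m (x + V) (x + V)` is the square
(w + v)² in the new coordinates.

Linear theory. Duhamel's formula solves each mode. The energy identity and Young's inequality absorb
the derivative in front of F into the viscosity, so that ‖x(t)‖² ≤ (4ν)⁻¹ ∫₀ᵗ ‖F‖² (`mode_energy`,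
`norm_sol_sq_le`). Only right-continuity and boundedness of the forcing in time are needed, and x is
continuous even where v jumps.

Existence. Since Hⁿ is an algebra (`norm_B_le`), the square is locally Lipschitz. Composing it with
a radial retraction onto a ball of radius R makes the fixed point problem globally Lipschitz of
Volterra type, and Picard iteration solves it on all of [0,T] (`exists_truncated_solution`). It
remains to bound x independently of R.

A priori bounds. In the L² energy of w the cubic term vanishes because ∫ w² ∂ₓw = 0
(`hasSum_mul_cv_self`), also with the truncation factor, which depends on time only. The remaining
terms are affine in w, so Gronwall bounds ∫‖w‖₁² (`exists_integral_bound`). The product estimate is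
tame: ‖F‖² ≤ C (‖w‖₁² + N²)(‖x‖² + N²), with N a bound for V. A second Gronwall argument, whose
weight is integrable by the first one, bounds ‖x‖ and the dissipation (`exists_apriori_bound`).
Taking R above this bound removes the truncation.

Uniqueness and the weak form. Testing with cosines and sines shows that a weak solution satisfies
Duhamel's formula (`IsSolution.D_eq_sol`). Two mild solutions differ by a function dominated by its
own primitive, hence agree. Conversely, expanding a test function in its Fourier series shows that
the mild solution is a weak one (`integral_mul_eq_integral_weakRhs`). -/

theorem volume_eq_haarAddCircle :
    (volume : Measure UnitAddCircle) = haarAddCircle := by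
  rw [AddCircle.volume_eq_smul_haarAddCircle]; simp

theorem ae_volume_of_ae_haar {p : UnitAddCircle → Prop} (h : ∀ᵐ x ∂haarAddCircle, p x) :
    ∀ᵐ x : UnitAddCircle, p x := by
  rwa [volume_eq_haarAddCircle]

/-- The Fourier coefficients of a real square integrable function on the circle. -/
noncomputable def coef (φ : L2) (k : ℤ) : ℂ :=
  fourierCoeff (fun x : UnitAddCircle => ((φ x : ℝ) : ℂ)) k

theorem memLp_ofReal (φ : L2) :
    MemLp (fun x : UnitAddCircle => ((φ x : ℝ) : ℂ)) 2 haarAddCircle :=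
  (Lp.memLp φ).ofReal.haarAddCircle

theorem integrable_ofReal (φ : L2) :
    Integrable (fun x : UnitAddCircle => ((φ x : ℝ) : ℂ)) haarAddCircle :=
  (memLp_ofReal φ).integrable (by norm_num)

/-- The complexification of a real square integrable function. -/
noncomputable def toC (φ : L2) : Lp ℂ 2 (haarAddCircle : Measure UnitAddCircle) :=
  (memLp_ofReal φ).toLp

theorem coeFn_toC (φ : L2) :
    toC φ =ᵐ[haarAddCircle] fun x : UnitAddCircle => ((φ x : ℝ) : ℂ) :=
  (memLp_ofReal φ).coeFn_toLp

theorem fourierCoeff_toC (φ : L2) (k : ℤ) : fourierCoeff (toC φ) k = coef φ k := by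
  rw [coef, fourierCoeff_congr_ae (coeFn_toC φ)]

theorem hasSum_sq_coef (φ : L2) : HasSum (fun k => ‖coef φ k‖ ^ 2) (‖φ‖ ^ 2) := by
  have h := hasSum_sq_fourierCoeff (toC φ)
  simp_rw [fourierCoeff_toC] at h
  convert h using 1
  rw [← real_inner_self_eq_norm_sq, L2.inner_def, integral_haarAddCircle, inv_one, one_smul]
  refine integral_congr_ae ?_
  filter_upwards [ae_volume_of_ae_haar (coeFn_toC φ)] with x hx
  rw [hx]
  simp

theorem norm_coef_le (φ : L2) (k : ℤ) : ‖coef φ k‖ ≤ ‖φ‖ := by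
  have h := le_hasSum (hasSum_sq_coef φ) k (fun _ _ => by positivity)
  exact (pow_le_pow_iff_left₀ (norm_nonneg _) (norm_nonneg _) two_ne_zero).1 h

theorem coef_congr_ae {φ : L2} {f : UnitAddCircle → ℝ} (h : φ =ᵐ[volume] f) (k : ℤ) :
    coef φ k = fourierCoeff (fun x : UnitAddCircle => ((f x : ℝ) : ℂ)) k := by
  rw [coef, fourierCoeff_congr_ae]
  rw [← volume_eq_haarAddCircle]
  filter_upwards [h] with x hx
  rw [hx]

theorem coef_add (φ ψ : L2) (k : ℤ) : coef (φ + ψ) k = coef φ k + coef ψ k := by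
  rw [coef_congr_ae (Lp.coeFn_add φ ψ), coef, coef, ← Pi.add_apply,
    ← fourierCoeff.add (integrable_ofReal φ) (integrable_ofReal ψ)]
  congr 1
  ext x
  simp

theorem coef_smul (c : ℝ) (φ : L2) (k : ℤ) : coef (c • φ) k = c * coef φ k := by
  rw [coef_congr_ae (Lp.coeFn_smul c φ), coef, ← fourierCoeff.const_mul]
  congr 1
  ext x
  simp

theorem coef_neg (φ : L2) (k : ℤ) : coef (-φ) k = -coef φ k := by
  rw [← neg_one_smul ℝ φ, coef_smul]; simp

theorem coef_sub (φ ψ : L2) (k : ℤ) : coef (φ - ψ) k = coef φ k - coef ψ k := by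
  rw [sub_eq_add_neg, coef_add, coef_neg, sub_eq_add_neg]

@[simp]
theorem coef_zero (k : ℤ) : coef 0 k = 0 := by
  simpa using coef_smul 0 0 k

theorem fourierCoeff_neg_index (f : UnitAddCircle → ℝ) (k : ℤ) :
    fourierCoeff (fun x : UnitAddCircle => ((f x : ℝ) : ℂ)) (-k) =
      conj (fourierCoeff (fun x : UnitAddCircle => ((f x : ℝ) : ℂ)) k) := by
  rw [fourierCoeff, fourierCoeff, ← integral_conj]
  refine integral_congr_ae (.of_forall fun x => ?_)
  simp only [smul_eq_mul, map_mul, Complex.conj_ofReal, fourier_neg, Complex.conj_conj]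

theorem coef_neg_index (φ : L2) (k : ℤ) : coef φ (-k) = conj (coef φ k) :=
  fourierCoeff_neg_index _ k

theorem L2_ext {φ ψ : L2} (h : ∀ k, coef φ k = coef ψ k) : φ = ψ := by
  have := hasSum_sq_coef (φ - ψ)
  simp_rw [coef_sub, h, sub_self, norm_zero, zero_pow two_ne_zero] at this
  have h0 := this.unique hasSum_zero
  exact sub_eq_zero.1 (norm_eq_zero.1 (by simpa using h0))

theorem continuous_coef (k : ℤ) : Continuous fun φ => coef φ k := by
  refine (LipschitzWith.of_dist_le_mul (K := 1) fun φ ψ => ?_).continuous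
  rw [dist_eq_norm, dist_eq_norm, ← coef_sub]
  simpa using norm_coef_le (φ - ψ) k

/-- Riesz–Fischer for real functions. The symmetry of c gives the complex function g and its
conjugate the same coefficients, so Re g has them too. -/
theorem exists_coef_eq {c : ℤ → ℂ} (hc : Summable fun k => ‖c k‖ ^ 2)
    (hsymm : ∀ k, c (-k) = conj (c k)) : ∃ φ : L2, ∀ k, coef φ k = c k := by
  have hmem : Memℓp c 2 := memℓp_gen (by simpa using hc)
  let g : Lp ℂ 2 (haarAddCircle : Measure UnitAddCircle) :=
    (fourierBasis (T := 1)).repr.symm ⟨c, hmem⟩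
  have hg : ∀ k, fourierCoeff g k = c k := fun k => by
    rw [← fourierBasis_repr]; simp [g]
  have hgL : MemLp g 2 haarAddCircle := Lp.memLp g
  have hgi : Integrable g haarAddCircle := hgL.integrable (by norm_num)
  have hre : MemLp (fun x => (g x).re) 2 (volume : Measure UnitAddCircle) := by
    rw [volume_eq_haarAddCircle]; exact hgL.re
  refine ⟨hre.toLp, fun k => ?_⟩
  rw [coef_congr_ae hre.coeFn_toLp]
  have hconj : fourierCoeff (fun x => conj (g x)) k = c k := by
    have h1 : fourierCoeff (fun x => conj (g x)) k = conj (fourierCoeff g (-k)) := by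
      rw [fourierCoeff, fourierCoeff, ← integral_conj]
      refine integral_congr_ae (.of_forall fun x => ?_)
      simp only [smul_eq_mul, map_mul, fourier_neg, neg_neg]
    rw [h1, hg, hsymm, Complex.conj_conj]
  have hsum : (fun x : UnitAddCircle => (((g x).re : ℝ) : ℂ)) =
      fun x => (1 / 2 : ℂ) * ((g : UnitAddCircle → ℂ) + fun x => conj (g x)) x := by
    ext x
    rw [Complex.re_eq_add_conj]; simp; ring
  have hci : Integrable (fun x => conj (g x)) (haarAddCircle : Measure UnitAddCircle) := by
    refine hgi.congr' ?_ (.of_forall fun x => by simp)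
    exact Complex.continuous_conj.comp_aestronglyMeasurable hgi.aestronglyMeasurable
  rw [hsum, fourierCoeff.const_mul, fourierCoeff.add hgi hci, Pi.add_apply, hg, hconj]
  ring

/-- The Fourier coefficients of a product are the convolution of the Fourier coefficients. -/
theorem hasSum_coef_mul (φ ψ : L2) (k : ℤ) :
    HasSum (fun j => coef φ j * coef ψ (k - j))
      (fourierCoeff (fun x : UnitAddCircle => ((φ x * ψ x : ℝ) : ℂ)) k) := by
  -- Parseval for the pair φ and e_k ψ: their inner product is ∫ φ ψ e_{-k}, and the j-th
  -- coefficient of e_k ψ is the conjugate of ψ̂_{k-j}.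
  have hmem : MemLp (fun x : UnitAddCircle => fourier k x * ((ψ x : ℝ) : ℂ)) 2 haarAddCircle := by
    refine (memLp_ofReal ψ).of_le
      ((fourier k).continuous.aestronglyMeasurable.mul (memLp_ofReal ψ).1)
      (.of_forall fun x => ?_)
    rw [norm_mul, fourier_apply, Circle.norm_coe, one_mul]
  have h := (fourierBasis (T := 1)).hasSum_inner_mul_inner hmem.toLp (toC φ)
  have h1 : ∀ j, inner ℂ (fourierBasis (T := 1) j) (toC φ) = coef φ j := fun j => by
    rw [← HilbertBasis.repr_apply_apply, fourierBasis_repr, fourierCoeff_toC]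
  have h2 : ∀ j, inner ℂ hmem.toLp (fourierBasis (T := 1) j) = coef ψ (k - j) := fun j => by
    rw [← inner_conj_symm, ← HilbertBasis.repr_apply_apply, fourierBasis_repr,
      fourierCoeff_congr_ae hmem.coeFn_toLp, ← neg_sub j k, coef_neg_index, coef,
      fourierCoeff, fourierCoeff]
    congr 1
    refine integral_congr_ae (.of_forall fun x => ?_)
    simp only [smul_eq_mul, ← mul_assoc]
    rw [← fourier_add]
    congr 3; ring
  simp_rw [h1, h2, mul_comm (coef ψ _)] at h
  suffices hin : inner ℂ hmem.toLp (toC φ) =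
      fourierCoeff (fun x : UnitAddCircle => ((φ x * ψ x : ℝ) : ℂ)) k by
    rw [hin] at h; exact h
  rw [L2.inner_def, fourierCoeff]
  refine integral_congr_ae ?_
  filter_upwards [coeFn_toC φ, hmem.coeFn_toLp] with x hx hx'
  rw [hx, hx', RCLike.inner_apply]
  simp only [smul_eq_mul, map_mul, Complex.conj_ofReal, Complex.ofReal_mul, fourier_neg]
  ring

end Burgers

/-! ### Fourier multipliers and convolution inequalities. -/

namespace Burgers

open AddCircle ComplexConjugate

/-- The absolute value of the wave number `2πk`. -/
noncomputable def kap (k : ℤ) : ℝ := 2 * Real.pi * |(k : ℝ)|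

theorem kap_nonneg (k : ℤ) : 0 ≤ kap k := by unfold kap; positivity

@[simp] theorem kap_zero : kap 0 = 0 := by simp [kap]

@[simp] theorem kap_neg (k : ℤ) : kap (-k) = kap k := by simp [kap]

theorem kap_pos {k : ℤ} (hk : k ≠ 0) : 0 < kap k := by
  have : (k : ℝ) ≠ 0 := by exact_mod_cast hk
  unfold kap; positivity

theorem one_le_kap {k : ℤ} (hk : k ≠ 0) : 1 ≤ kap k := by
  have h1 : (1 : ℝ) ≤ |(k : ℝ)| := by
    exact_mod_cast Int.one_le_abs hk
  have h2 := Real.pi_gt_three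
  unfold kap
  nlinarith

theorem kap_le_add (k j : ℤ) : kap k ≤ kap j + kap (k - j) := by
  unfold kap
  rw [← mul_add]
  refine mul_le_mul_of_nonneg_left ?_ (by positivity)
  have := abs_add_le (j : ℝ) ((k - j : ℤ) : ℝ)
  push_cast at this ⊢
  simpa using this

theorem inv_kap_le_one (k : ℤ) : (kap k)⁻¹ ≤ 1 := by
  rcases eq_or_ne k 0 with rfl | hk
  · simp
  · exact inv_le_one_of_one_le₀ (one_le_kap hk)

theorem summable_inv_kap_sq : Summable fun k : ℤ => ((kap k)⁻¹) ^ 2 := by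
  have h : Summable fun k : ℤ => 1 / (k : ℝ) ^ 2 :=
    Real.summable_one_div_int_pow.2 one_lt_two
  refine (h.mul_left ((2 * Real.pi)⁻¹ ^ 2)).congr fun k => ?_
  simp only [kap, inv_pow, mul_pow, sq_abs, one_div, mul_inv]

theorem norm_le_of_coef_le {φ ψ : L2} (h : ∀ k, ‖coef φ k‖ ≤ ‖coef ψ k‖) : ‖φ‖ ≤ ‖ψ‖ := by
  refine (pow_le_pow_iff_left₀ (norm_nonneg _) (norm_nonneg _) two_ne_zero).1 ?_
  exact hasSum_le (fun k => pow_le_pow_left₀ (norm_nonneg _) (h k) 2)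
    (hasSum_sq_coef φ) (hasSum_sq_coef ψ)

/-- Nonzero wave numbers are at least 1, so the symbol is at most 1. As `kap 0 = 0` and 0⁻¹ = 0, the
mean is removed when m ≥ 1 and kept when m = 0, where the multiplier is the identity. -/
theorem exists_J (m : ℕ) (φ : L2) :
    ∃ ψ : L2, ∀ k, coef ψ k = (((kap k)⁻¹ ^ m : ℝ) : ℂ) * coef φ k := by
  refine exists_coef_eq ?_ fun k => ?_
  · refine (hasSum_sq_coef φ).summable.of_nonneg_of_le (fun _ => by positivity) fun k => ?_
    have h0 : 0 ≤ (kap k)⁻¹ := inv_nonneg.2 (kap_nonneg k)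
    refine pow_le_pow_left₀ (norm_nonneg _) ?_ 2
    rw [norm_mul, Complex.norm_real, Real.norm_of_nonneg (by positivity)]
    exact mul_le_of_le_one_left (norm_nonneg _) (pow_le_one₀ h0 (inv_kap_le_one k))
  · rw [kap_neg, coef_neg_index, map_mul, Complex.conj_ofReal]

/-- The Fourier multiplier `(2π|k|)⁻ᵐ`, which integrates `m` times. -/
noncomputable def J (m : ℕ) (φ : L2) : L2 := (exists_J m φ).choose

theorem coef_J (m : ℕ) (φ : L2) (k : ℤ) :
    coef (J m φ) k = (((kap k)⁻¹ ^ m : ℝ) : ℂ) * coef φ k :=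
  (exists_J m φ).choose_spec k

theorem norm_coef_J (m : ℕ) (φ : L2) (k : ℤ) :
    ‖coef (J m φ) k‖ = (kap k)⁻¹ ^ m * ‖coef φ k‖ := by
  have h0 : 0 ≤ (kap k)⁻¹ := inv_nonneg.2 (kap_nonneg k)
  rw [coef_J, norm_mul, Complex.norm_real, Real.norm_of_nonneg (by positivity)]

theorem norm_J_le (m : ℕ) (φ : L2) : ‖J m φ‖ ≤ ‖φ‖ := by
  refine norm_le_of_coef_le fun k => ?_
  have h0 : 0 ≤ (kap k)⁻¹ := inv_nonneg.2 (kap_nonneg k)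
  rw [norm_coef_J]
  exact mul_le_of_le_one_left (norm_nonneg _) (pow_le_one₀ h0 (inv_kap_le_one k))

theorem J_add (m : ℕ) (φ ψ : L2) : J m (φ + ψ) = J m φ + J m ψ := by
  refine L2_ext fun k => ?_
  simp only [coef_J, coef_add]
  ring

theorem J_sub (m : ℕ) (φ ψ : L2) : J m (φ - ψ) = J m φ - J m ψ := by
  refine L2_ext fun k => ?_
  simp only [coef_J, coef_sub]
  ring

theorem J_smul (m : ℕ) (c : ℝ) (φ : L2) : J m (c • φ) = c • J m φ := by
  refine L2_ext fun k => ?_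
  simp only [coef_J, coef_smul]
  ring

@[simp]
theorem J_zero (m : ℕ) : J m 0 = 0 := by
  simpa using J_smul m 0 0

theorem continuous_J (m : ℕ) : Continuous (J m) := by
  refine (LipschitzWith.of_dist_le_mul (K := 1) fun φ ψ => ?_).continuous
  rw [dist_eq_norm, dist_eq_norm, ← J_sub]
  simpa using norm_J_le m (φ - ψ)

theorem tsum_enorm_coef_sq (φ : L2) : ∑' k, ‖coef φ k‖ₑ ^ 2 = ‖φ‖ₑ ^ 2 := by
  have h := hasSum_sq_coef φ
  have h1 : ∀ k, ‖coef φ k‖ₑ ^ 2 = ENNReal.ofReal (‖coef φ k‖ ^ 2) := fun k => by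
    rw [ENNReal.ofReal_pow (norm_nonneg _), ofReal_norm]
  simp_rw [h1]
  rw [← ENNReal.ofReal_tsum_of_nonneg (fun _ => by positivity) h.summable, h.tsum_eq,
    ENNReal.ofReal_pow (norm_nonneg _), ofReal_norm]

theorem ENNReal_two_mul_le_add_sq (a b : ℝ≥0∞) : 2 * (a * b) ≤ a ^ 2 + b ^ 2 := by
  rcases eq_or_ne a ∞ with rfl | ha
  · simp
  rcases eq_or_ne b ∞ with rfl | hb
  · simp
  lift a to NNReal using ha
  lift b to NNReal using hb
  norm_cast
  rw [← mul_assoc]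
  exact two_mul_le_add_sq a b

theorem ENNReal_add_sq_le (a b : ℝ≥0∞) : (a + b) ^ 2 ≤ 2 * (a ^ 2 + b ^ 2) := by
  calc (a + b) ^ 2 = a ^ 2 + b ^ 2 + 2 * (a * b) := by ring
    _ ≤ a ^ 2 + b ^ 2 + (a ^ 2 + b ^ 2) := by gcongr; exact ENNReal_two_mul_le_add_sq a b
    _ = _ := by ring

/-- The Cauchy-Schwarz inequality for series in `[0, ∞]`. -/
theorem ENNReal_tsum_mul_sq_le {ι : Type*} (f g : ι → ℝ≥0∞) :
    (∑' i, f i * g i) ^ 2 ≤ (∑' i, f i ^ 2) * ∑' i, g i ^ 2 := by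
  -- Square the series and pair the factors crosswise, (f i g j)(f j g i). In [0, ∞] no summability
  -- has to be checked.
  have h : 2 * (∑' i, f i * g i) ^ 2 ≤ 2 * ((∑' i, f i ^ 2) * ∑' i, g i ^ 2) := by
    calc 2 * (∑' i, f i * g i) ^ 2
        = ∑' i, ∑' j, 2 * ((f i * g j) * (f j * g i)) := by
          rw [pow_two, ← ENNReal.tsum_mul_right, ← ENNReal.tsum_mul_left]
          congr 1; ext i
          rw [← ENNReal.tsum_mul_left, ← ENNReal.tsum_mul_left]
          congr 1; ext j; ring
      _ ≤ ∑' i, ∑' j, ((f i * g j) ^ 2 + (f j * g i) ^ 2) :=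
          ENNReal.tsum_le_tsum fun i => ENNReal.tsum_le_tsum fun j =>
            ENNReal_two_mul_le_add_sq _ _
      _ = 2 * ((∑' i, f i ^ 2) * ∑' i, g i ^ 2) := by
          simp_rw [ENNReal.tsum_add, mul_pow, ENNReal.tsum_mul_left, ENNReal.tsum_mul_right,
            ENNReal.tsum_mul_left]
          ring
  exact (ENNReal.mul_le_mul_iff_right two_ne_zero (by norm_num)).1 h

/-- Young's inequality `‖a * b‖₂ ≤ ‖a‖₁ ‖b‖₂` for convolutions on `ℤ`. -/
theorem tsum_conv_sq_le (a b : ℤ → ℝ≥0∞) :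
    ∑' k, (∑' j, a j * b (k - j)) ^ 2 ≤ (∑' j, a j) ^ 2 * ∑' j, b j ^ 2 := by
  have hs : ∀ c : ℝ≥0∞, (c ^ (1 / 2 : ℝ)) ^ 2 = c := fun c => by
    rw [← ENNReal.rpow_natCast, ← ENNReal.rpow_mul]; norm_num
  -- Cauchy–Schwarz with respect to the weight a, splitting a = √a · √a, and then Tonelli.
  calc ∑' k, (∑' j, a j * b (k - j)) ^ 2
      = ∑' k, (∑' j, a j ^ (1 / 2 : ℝ) * (a j ^ (1 / 2 : ℝ) * b (k - j))) ^ 2 := by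
        congr 1; ext k; congr 2; ext j
        rw [← mul_assoc, ← pow_two, hs]
    _ ≤ ∑' k, (∑' j, a j) * ∑' j, a j * b (k - j) ^ 2 := by
        refine ENNReal.tsum_le_tsum fun k => ?_
        refine (ENNReal_tsum_mul_sq_le _ _).trans_eq ?_
        simp_rw [mul_pow, hs]
    _ = (∑' j, a j) * ∑' j, a j * ∑' k, b (k - j) ^ 2 := by
        rw [ENNReal.tsum_mul_left, ENNReal.tsum_comm]
        simp_rw [ENNReal.tsum_mul_left]
    _ = _ := by
        have : ∀ j : ℤ, ∑' k, b (k - j) ^ 2 = ∑' k, b k ^ 2 := fun j =>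
          (Equiv.subRight j).tsum_eq fun k => b k ^ 2
        simp_rw [this, ENNReal.tsum_mul_right]
        ring

/-- The `ℓ²` norm of `(2π|k|)⁻¹`, the constant in the embedding of `H¹` into functions with
summable Fourier coefficients. -/
noncomputable def embConst : ℝ := Real.sqrt (∑' k : ℤ, ((kap k)⁻¹) ^ 2)

theorem embConst_nonneg : 0 ≤ embConst := Real.sqrt_nonneg _

theorem tsum_inv_kap_sq : ∑' k : ℤ, ENNReal.ofReal (kap k)⁻¹ ^ 2 = ENNReal.ofReal embConst ^ 2 := by
  have h0 : ∀ k, 0 ≤ (kap k)⁻¹ := fun k => inv_nonneg.2 (kap_nonneg k)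
  rw [← ENNReal.ofReal_pow embConst_nonneg, embConst,
    Real.sq_sqrt (tsum_nonneg fun _ => by positivity),
    ENNReal.ofReal_tsum_of_nonneg (fun _ => by positivity) summable_inv_kap_sq]
  simp_rw [ENNReal.ofReal_pow (h0 _)]

/-- Cauchy–Schwarz against (2π|k|)⁻¹ ∈ ℓ². This replaces the embedding of H¹ into bounded functions:
with w = `J (m + 1) x`, the norm of `J m x` controls the first derivative of w. -/
theorem tsum_enorm_coef_J_le (m : ℕ) (x : L2) :
    ∑' k, ‖coef (J (m + 1) x) k‖ₑ ≤ ENNReal.ofReal embConst * ‖J m x‖ₑ := by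
  have h : ∀ k, ‖coef (J (m + 1) x) k‖ₑ = ENNReal.ofReal (kap k)⁻¹ * ‖coef (J m x) k‖ₑ := by
    intro k
    rw [← ofReal_norm, ← ofReal_norm,
      ← ENNReal.ofReal_mul (inv_nonneg.2 (kap_nonneg k)), norm_coef_J, norm_coef_J, pow_succ']
    ring_nf
  have h2 := ENNReal_tsum_mul_sq_le (fun k => ENNReal.ofReal (kap k)⁻¹)
    (fun k => ‖coef (J m x) k‖ₑ)
  simp_rw [← h] at h2
  rw [tsum_inv_kap_sq, tsum_enorm_coef_sq, ← mul_pow] at h2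
  exact (ENNReal.pow_le_pow_left_iff two_ne_zero).1 h2

/-- The Fourier coefficients of a product of two functions. -/
noncomputable def cv (φ ψ : L2) (k : ℤ) : ℂ :=
  fourierCoeff (fun x : UnitAddCircle => ((φ x * ψ x : ℝ) : ℂ)) k

theorem hasSum_cv (φ ψ : L2) (k : ℤ) :
    HasSum (fun j => coef φ j * coef ψ (k - j)) (cv φ ψ k) := hasSum_coef_mul φ ψ k

theorem cv_neg_index (φ ψ : L2) (k : ℤ) : cv φ ψ (-k) = conj (cv φ ψ k) :=
  fourierCoeff_neg_index _ k

theorem cv_add_left (φ φ' ψ : L2) (k : ℤ) : cv (φ + φ') ψ k = cv φ ψ k + cv φ' ψ k := by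
  refine (hasSum_cv _ _ k).unique ?_
  simp_rw [coef_add, add_mul]
  exact (hasSum_cv _ _ k).add (hasSum_cv _ _ k)

theorem cv_smul_left (c : ℝ) (φ ψ : L2) (k : ℤ) : cv (c • φ) ψ k = c * cv φ ψ k := by
  refine (hasSum_cv _ _ k).unique ?_
  simp_rw [coef_smul, mul_assoc]
  exact (hasSum_cv _ _ k).mul_left _

theorem cv_comm (φ ψ : L2) (k : ℤ) : cv φ ψ k = cv ψ φ k := by
  unfold cv; simp_rw [mul_comm]

theorem enorm_cv_le (φ ψ : L2) (k : ℤ) :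
    ‖cv φ ψ k‖ₑ ≤ ∑' j, ‖coef φ j‖ₑ * ‖coef ψ (k - j)‖ₑ := by
  rw [← (hasSum_cv φ ψ k).tsum_eq]
  refine (enorm_tsum_le_tsum_enorm).trans_eq ?_
  simp_rw [enorm_mul]

end Burgers

/-! ### The algebra property of Hⁿ and the cancellation of the cubic term. -/

namespace Burgers

open AddCircle ComplexConjugate

/-- The constant in the algebra property of `Hⁿ`, `n = m + 1`. -/
noncomputable def algConst (m : ℕ) : ℝ := 2 ^ (m + 1) * embConst

theorem algConst_nonneg (m : ℕ) : 0 ≤ algConst m :=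
  mul_nonneg (by positivity) embConst_nonneg

theorem tsum_cv_sq_le (φ ψ : L2) :
    ∑' k, ‖cv φ ψ k‖ₑ ^ 2 ≤ (∑' k, ‖coef φ k‖ₑ) ^ 2 * ‖ψ‖ₑ ^ 2 := by
  rw [← tsum_enorm_coef_sq ψ]
  refine le_trans ?_ (tsum_conv_sq_le _ _)
  exact ENNReal.tsum_le_tsum fun k => pow_le_pow_left' (enorm_cv_le φ ψ k) 2

theorem kap_pow_mul_enorm_coef_J_le (m : ℕ) (x : L2) (k : ℤ) :
    ENNReal.ofReal (kap k ^ m) * ‖coef (J m x) k‖ₑ ≤ ‖coef x k‖ₑ := by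
  rw [← ofReal_norm, ← ofReal_norm, ← ENNReal.ofReal_mul (pow_nonneg (kap_nonneg k) m),
    norm_coef_J, ← mul_assoc, ← mul_pow]
  refine ENNReal.ofReal_le_ofReal (mul_le_of_le_one_left (norm_nonneg _) ?_)
  exact pow_le_one₀ (mul_nonneg (kap_nonneg k) (inv_nonneg.2 (kap_nonneg k))) mul_inv_le_one

/-- The Leibniz rule on the Fourier side. By (a + b)^(m+1) ≤ 2^m (a^(m+1) + b^(m+1)) all derivatives
fall on a single factor, whose weight then cancels against the multiplier. -/
theorem enorm_kap_pow_mul_cv_le (m : ℕ) (x y : L2) (k : ℤ) :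
    ‖((kap k ^ (m + 1) : ℝ) : ℂ) * cv (J (m + 1) x) (J (m + 1) y) k‖ₑ ≤
      2 ^ m * ((∑' j, ‖coef (J (m + 1) y) j‖ₑ * ‖coef x (k - j)‖ₑ) +
        ∑' j, ‖coef (J (m + 1) x) j‖ₑ * ‖coef y (k - j)‖ₑ) := by
  set p := fun j => ‖coef (J (m + 1) x) j‖ₑ
  set q := fun j => ‖coef (J (m + 1) y) j‖ₑ
  have hK : ∀ j, ENNReal.ofReal (kap k ^ (m + 1)) ≤
      2 ^ m * (ENNReal.ofReal (kap j ^ (m + 1)) + ENNReal.ofReal (kap (k - j) ^ (m + 1))) := by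
    intro j
    have h0 := kap_nonneg k
    have h1 := kap_nonneg j
    have h2 := kap_nonneg (k - j)
    have h2m : (2 : ℝ≥0∞) ^ m = ENNReal.ofReal (2 ^ m) := by
      rw [ENNReal.ofReal_pow (by norm_num)]; norm_num
    rw [← ENNReal.ofReal_add (by positivity) (by positivity), h2m,
      ← ENNReal.ofReal_mul (by positivity)]
    refine ENNReal.ofReal_le_ofReal ?_
    refine (pow_le_pow_left₀ h0 (kap_le_add k j) _).trans ?_
    simpa using add_pow_le h1 h2 (m + 1)
  have hswap : ∑' j, ‖coef x j‖ₑ * q (k - j) = ∑' j, q j * ‖coef x (k - j)‖ₑ := by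
    rw [← (Equiv.subLeft k).tsum_eq]
    refine tsum_congr fun j => ?_
    simp only [Equiv.subLeft_apply, sub_sub_cancel]
    ring
  rw [← hswap, ← ENNReal.tsum_add, ← ENNReal.tsum_mul_left, enorm_mul]
  have hE : ‖((kap k ^ (m + 1) : ℝ) : ℂ)‖ₑ = ENNReal.ofReal (kap k ^ (m + 1)) := by
    rw [← ofReal_norm, Complex.norm_real, Real.norm_of_nonneg (pow_nonneg (kap_nonneg k) _)]
  rw [hE]
  refine (mul_le_mul_right (enorm_cv_le _ _ k) _).trans ?_
  rw [← ENNReal.tsum_mul_left]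
  refine ENNReal.tsum_le_tsum fun j => ?_
  calc ENNReal.ofReal (kap k ^ (m + 1)) * (p j * q (k - j))
      ≤ 2 ^ m * (ENNReal.ofReal (kap j ^ (m + 1)) + ENNReal.ofReal (kap (k - j) ^ (m + 1))) *
        (p j * q (k - j)) := mul_le_mul_left (hK j) _
    _ = 2 ^ m * ((ENNReal.ofReal (kap j ^ (m + 1)) * p j) * q (k - j) +
        p j * (ENNReal.ofReal (kap (k - j) ^ (m + 1)) * q (k - j))) := by ring
    _ ≤ _ := by
        gcongr
        · exact kap_pow_mul_enorm_coef_J_le _ _ _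
        · exact kap_pow_mul_enorm_coef_J_le _ _ _

theorem ofReal_algConst_sq (m : ℕ) :
    ENNReal.ofReal (algConst m ^ 2) = (2 ^ (m + 1)) ^ 2 * ENNReal.ofReal embConst ^ 2 := by
  rw [algConst, mul_pow, ENNReal.ofReal_mul (by positivity), ENNReal.ofReal_pow embConst_nonneg,
    ENNReal.ofReal_pow (by positivity), ENNReal.ofReal_pow (by norm_num)]
  norm_num

/-- Young's inequality with the undifferentiated factor in ℓ¹. The estimate is tame: each term has
the top norm of one factor only and the weaker `J m` norm of the other. The second Gronwall argument
rests on this. -/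
theorem tsum_kap_pow_mul_cv_sq_le (m : ℕ) (x y : L2) :
    ∑' k, ‖((kap k ^ (m + 1) : ℝ) : ℂ) * cv (J (m + 1) x) (J (m + 1) y) k‖ₑ ^ 2 ≤
      ENNReal.ofReal (algConst m ^ 2) *
        (‖x‖ₑ ^ 2 * ‖J m y‖ₑ ^ 2 + ‖J m x‖ₑ ^ 2 * ‖y‖ₑ ^ 2) := by
  calc ∑' k, ‖((kap k ^ (m + 1) : ℝ) : ℂ) * cv (J (m + 1) x) (J (m + 1) y) k‖ₑ ^ 2
      ≤ ∑' k, (2 ^ m) ^ 2 * (2 * ((∑' j, ‖coef (J (m + 1) y) j‖ₑ * ‖coef x (k - j)‖ₑ) ^ 2 +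
        (∑' j, ‖coef (J (m + 1) x) j‖ₑ * ‖coef y (k - j)‖ₑ) ^ 2)) := by
        refine ENNReal.tsum_le_tsum fun k => ?_
        refine (pow_le_pow_left' (enorm_kap_pow_mul_cv_le m x y k) 2).trans ?_
        rw [mul_pow]
        gcongr
        exact ENNReal_add_sq_le _ _
    _ ≤ (2 ^ m) ^ 2 * (2 * ((ENNReal.ofReal embConst * ‖J m y‖ₑ) ^ 2 * ‖x‖ₑ ^ 2 +
        (ENNReal.ofReal embConst * ‖J m x‖ₑ) ^ 2 * ‖y‖ₑ ^ 2)) := by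
        rw [ENNReal.tsum_mul_left, ENNReal.tsum_mul_left, ENNReal.tsum_add]
        gcongr
        · refine (tsum_conv_sq_le (fun j => ‖coef (J (m + 1) y) j‖ₑ) fun j => ‖coef x j‖ₑ).trans ?_
          rw [tsum_enorm_coef_sq]
          gcongr
          exact tsum_enorm_coef_J_le m y
        · refine (tsum_conv_sq_le (fun j => ‖coef (J (m + 1) x) j‖ₑ) fun j => ‖coef y j‖ₑ).trans ?_
          rw [tsum_enorm_coef_sq]
          gcongr
          exact tsum_enorm_coef_J_le m x
    _ = (2 ^ m) ^ 2 * 2 * ENNReal.ofReal embConst ^ 2 *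
          (‖x‖ₑ ^ 2 * ‖J m y‖ₑ ^ 2 + ‖J m x‖ₑ ^ 2 * ‖y‖ₑ ^ 2) := by ring
    _ ≤ _ := by
        rw [ofReal_algConst_sq]
        gcongr
        rw [show ((2 : ℝ≥0∞) ^ (m + 1)) ^ 2 = (2 ^ m) ^ 2 * 2 * 2 by ring]
        exact le_mul_of_one_le_right zero_le one_le_two

theorem summable_norm_sq_of_tsum_ne_top {c : ℤ → ℂ} (h : ∑' k, ‖c k‖ₑ ^ 2 ≠ ∞) :
    Summable fun k => ‖c k‖ ^ 2 := by
  have := ENNReal.summable_toReal h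
  simpa using this

theorem exists_B (m : ℕ) (x y : L2) : ∃ ψ : L2, ∀ k,
    coef ψ k = ((kap k ^ (m + 1) : ℝ) : ℂ) * cv (J (m + 1) x) (J (m + 1) y) k := by
  refine exists_coef_eq (summable_norm_sq_of_tsum_ne_top ?_) fun k => ?_
  · refine ((tsum_kap_pow_mul_cv_sq_le m x y).trans_lt ?_).ne
    finiteness
  · rw [kap_neg, cv_neg_index, map_mul, Complex.conj_ofReal]

/-- The product of functions in `Hⁿ`, `n = m + 1`, in the coordinates given by `J n : L² → Hⁿ`. -/
noncomputable def B (m : ℕ) (x y : L2) : L2 := (exists_B m x y).choose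

theorem coef_B (m : ℕ) (x y : L2) (k : ℤ) :
    coef (B m x y) k = ((kap k ^ (m + 1) : ℝ) : ℂ) * cv (J (m + 1) x) (J (m + 1) y) k :=
  (exists_B m x y).choose_spec k

theorem norm_B_sq_le (m : ℕ) (x y : L2) :
    ‖B m x y‖ ^ 2 ≤ algConst m ^ 2 * (‖x‖ ^ 2 * ‖J m y‖ ^ 2 + ‖J m x‖ ^ 2 * ‖y‖ ^ 2) := by
  have h := tsum_kap_pow_mul_cv_sq_le m x y
  simp_rw [← coef_B, tsum_enorm_coef_sq] at h
  simp_rw [← ofReal_norm, ← ENNReal.ofReal_pow (norm_nonneg _)] at h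
  rw [← ENNReal.ofReal_mul (by positivity), ← ENNReal.ofReal_mul (by positivity),
    ← ENNReal.ofReal_add (by positivity) (by positivity), ← ENNReal.ofReal_mul (by positivity)] at h
  exact (ENNReal.ofReal_le_ofReal_iff (by positivity)).1 h

theorem norm_B_le (m : ℕ) (x y : L2) : ‖B m x y‖ ≤ 2 * algConst m * ‖x‖ * ‖y‖ := by
  have h0 := algConst_nonneg m
  refine (pow_le_pow_iff_left₀ (norm_nonneg _) (by positivity) two_ne_zero).1 ?_
  refine (norm_B_sq_le m x y).trans ?_
  have h1 : ‖J m x‖ ^ 2 ≤ ‖x‖ ^ 2 := pow_le_pow_left₀ (norm_nonneg _) (norm_J_le m x) 2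
  have h2 : ‖J m y‖ ^ 2 ≤ ‖y‖ ^ 2 := pow_le_pow_left₀ (norm_nonneg _) (norm_J_le m y) 2
  calc algConst m ^ 2 * (‖x‖ ^ 2 * ‖J m y‖ ^ 2 + ‖J m x‖ ^ 2 * ‖y‖ ^ 2)
      ≤ algConst m ^ 2 * (‖x‖ ^ 2 * ‖y‖ ^ 2 + ‖x‖ ^ 2 * ‖y‖ ^ 2) := by gcongr
    _ ≤ algConst m ^ 2 * (4 * (‖x‖ ^ 2 * ‖y‖ ^ 2)) := by
        have : 0 ≤ ‖x‖ ^ 2 * ‖y‖ ^ 2 := by positivity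
        gcongr; linarith
    _ = _ := by ring

theorem B_comm (m : ℕ) (x y : L2) : B m x y = B m y x :=
  L2_ext fun k => by rw [coef_B, coef_B, cv_comm]

theorem B_add_left (m : ℕ) (x x' y : L2) : B m (x + x') y = B m x y + B m x' y :=
  L2_ext fun k => by simp only [coef_B, coef_add, J_add, cv_add_left]; ring

theorem B_smul_left (m : ℕ) (c : ℝ) (x y : L2) : B m (c • x) y = c • B m x y :=
  L2_ext fun k => by simp only [coef_B, coef_smul, J_smul, cv_smul_left]; ring

theorem B_add_right (m : ℕ) (x y y' : L2) : B m x (y + y') = B m x y + B m x y' := by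
  rw [B_comm, B_add_left, B_comm, B_comm m y']

theorem B_smul_right (m : ℕ) (c : ℝ) (x y : L2) : B m x (c • y) = c • B m x y := by
  rw [B_comm, B_smul_left, B_comm]

theorem B_self_sub (m : ℕ) (x y : L2) : B m x x - B m y y = B m (x + y) (x - y) := by
  rw [sub_eq_add_neg x y, ← neg_one_smul ℝ y, B_add_left, B_add_right, B_add_right, B_smul_right,
    B_smul_right, B_comm m y x]
  module

theorem norm_B_self_sub_le (m : ℕ) (x y : L2) :
    ‖B m x x - B m y y‖ ≤ 2 * algConst m * (‖x‖ + ‖y‖) * ‖x - y‖ := by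
  rw [B_self_sub]
  refine (norm_B_le m _ _).trans ?_
  have h0 := algConst_nonneg m
  gcongr
  exact norm_add_le x y

theorem continuous_B_self (m : ℕ) : Continuous fun x => B m x x := by
  refine continuous_iff_continuousAt.2 fun x => ?_
  rw [ContinuousAt, tendsto_iff_norm_sub_tendsto_zero]
  refine squeeze_zero (fun _ => norm_nonneg _) (fun y => norm_B_self_sub_le m y x) ?_
  have : Continuous fun y => 2 * algConst m * (‖y‖ + ‖x‖) * ‖y - x‖ := by fun_prop
  simpa using this.tendsto x

/-- The weight in `B` erases the mean of the product, hence the exclusion of k = 0. Nothing is lost,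
since the equation contains only the derivative of the square. -/
theorem coef_J_B {m : ℕ} (x y : L2) {k : ℤ} (hk : k ≠ 0) :
    coef (J (m + 1) (B m x y)) k = cv (J (m + 1) x) (J (m + 1) y) k := by
  have h := (kap_pos hk).ne'
  rw [coef_J, coef_B, ← mul_assoc, ← Complex.ofReal_mul, ← mul_pow, inv_mul_cancel₀ h]
  simp

/-- An L² bound for the product, less its mean: one factor is measured in L², the other by its
absolutely summable coefficients. -/
theorem norm_J_B_le (m : ℕ) (x y : L2) :
    ‖J (m + 1) (B m x y)‖ ≤ embConst * ‖J m y‖ * ‖J (m + 1) x‖ := by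
  have h : ‖J (m + 1) (B m x y)‖ₑ ^ 2 ≤
      (ENNReal.ofReal embConst * ‖J m y‖ₑ) ^ 2 * ‖J (m + 1) x‖ₑ ^ 2 := by
    rw [← tsum_enorm_coef_sq]
    calc _ ≤ ∑' k, ‖cv (J (m + 1) y) (J (m + 1) x) k‖ₑ ^ 2 := by
            refine ENNReal.tsum_le_tsum fun k => ?_
            rcases eq_or_ne k 0 with rfl | hk
            · simp [coef_J]
            · rw [coef_J_B x y hk, cv_comm]
      _ ≤ _ := tsum_cv_sq_le _ _
      _ ≤ _ := by
            gcongr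
            exact tsum_enorm_coef_J_le m y
  have h0 := embConst_nonneg
  rw [← mul_pow] at h
  replace h := (ENNReal.pow_le_pow_left_iff two_ne_zero).1 h
  rw [← ofReal_norm, ← ofReal_norm, ← ofReal_norm, ← ENNReal.ofReal_mul h0,
    ← ENNReal.ofReal_mul (by positivity)] at h
  exact (ENNReal.ofReal_le_ofReal_iff (by positivity)).1 h

/-- Licenses the rearrangements in the cancellation identity. With p the coefficients of w, k p_k
lies in ℓ² because w ∈ H¹, and p * p lies in ℓ² because p ∈ ℓ¹ ∩ ℓ². -/
theorem summable_triple (m : ℕ) (x : L2) : Summable fun z : ℤ × ℤ =>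
    (z.1 : ℂ) * (coef (J (m + 1) x) z.2 * coef (J (m + 1) x) (z.1 - z.2) *
      coef (J (m + 1) x) (-z.1)) := by
  set p := coef (J (m + 1) x) with hp
  have hpn : ∀ k, ‖p (-k)‖ₑ = ‖p k‖ₑ := fun k => by
    rw [hp, coef_neg_index, ← ofReal_norm, ← ofReal_norm, RCLike.norm_conj]
  have hk : ∀ k : ℤ, ‖(k : ℂ)‖ₑ * ‖p k‖ₑ ≤ ‖coef (J m x) k‖ₑ := by
    intro k
    rw [← enorm_mul, ← ofReal_norm, ← ofReal_norm]
    refine ENNReal.ofReal_le_ofReal ?_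
    rcases eq_or_ne k 0 with rfl | hk
    · simp
    have h1 : ‖(k : ℂ)‖ ≤ kap k := by
      rw [Complex.norm_intCast, kap]
      have := Real.pi_gt_three
      nlinarith [abs_nonneg (k : ℝ)]
    have h2 := kap_pos hk
    have h3 : 0 ≤ (kap k)⁻¹ ^ m * ‖coef x k‖ := by positivity
    rw [norm_mul, hp, norm_coef_J, norm_coef_J, pow_succ']
    calc ‖(k : ℂ)‖ * ((kap k)⁻¹ * (kap k)⁻¹ ^ m * ‖coef x k‖)
        = (‖(k : ℂ)‖ * (kap k)⁻¹) * ((kap k)⁻¹ ^ m * ‖coef x k‖) := by ring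
      _ ≤ 1 * ((kap k)⁻¹ ^ m * ‖coef x k‖) := by
          gcongr
          rw [← div_eq_mul_inv, div_le_one h2]
          exact h1
      _ = _ := one_mul _
  have hl1 : ∑' k, ‖p k‖ₑ ≠ ∞ := by
    refine ((tsum_enorm_coef_J_le m x).trans_lt ?_).ne
    finiteness
  have key : ∑' z : ℤ × ℤ, ‖(z.1 : ℂ) * (p z.2 * p (z.1 - z.2) * p (-z.1))‖ₑ ≠ ∞ := by
    rw [ENNReal.tsum_prod (f := fun a b : ℤ => ‖(a : ℂ) * (p b * p (a - b) * p (-a))‖ₑ)]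
    have h1 : ∀ a : ℤ, ∑' b, ‖(a : ℂ) * (p b * p (a - b) * p (-a))‖ₑ ≤
        ‖coef (J m x) a‖ₑ * ∑' b, ‖p b‖ₑ * ‖p (a - b)‖ₑ := by
      intro a
      rw [← ENNReal.tsum_mul_left]
      refine ENNReal.tsum_le_tsum fun b => ?_
      calc ‖(a : ℂ) * (p b * p (a - b) * p (-a))‖ₑ
          = (‖(a : ℂ)‖ₑ * ‖p a‖ₑ) * (‖p b‖ₑ * ‖p (a - b)‖ₑ) := by
            rw [enorm_mul, enorm_mul, enorm_mul, hpn]; ring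
        _ ≤ _ := mul_le_mul_left (hk a) _
    have h2 : (∑' a : ℤ, ‖coef (J m x) a‖ₑ * ∑' b, ‖p b‖ₑ * ‖p (a - b)‖ₑ) ^ 2 ≤
        ‖J m x‖ₑ ^ 2 * ((∑' k, ‖p k‖ₑ) ^ 2 * ‖J (m + 1) x‖ₑ ^ 2) := by
      refine (ENNReal_tsum_mul_sq_le _ _).trans ?_
      rw [tsum_enorm_coef_sq]
      gcongr
      refine (tsum_conv_sq_le (fun k => ‖p k‖ₑ) fun k => ‖p k‖ₑ).trans_eq ?_
      rw [hp, tsum_enorm_coef_sq]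
    have h3 : ∑' a : ℤ, ‖coef (J m x) a‖ₑ * ∑' b, ‖p b‖ₑ * ‖p (a - b)‖ₑ ≠ ∞ := by
      intro h
      rw [h] at h2
      have : ‖J m x‖ₑ ^ 2 * ((∑' k, ‖p k‖ₑ) ^ 2 * ‖J (m + 1) x‖ₑ ^ 2) < ∞ := by finiteness
      exact absurd (h2.trans_lt this) (by simp)
    exact ((ENNReal.tsum_le_tsum h1).trans_lt h3.lt_top).ne
  refine Summable.of_norm ?_
  have := ENNReal.summable_toReal key
  simpa using this

/-- The Fourier form of the identity `∫ w² ∂ₓw = 0`. -/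
theorem hasSum_mul_cv_self (m : ℕ) (x : L2) :
    HasSum (fun k : ℤ => (k : ℂ) * cv (J (m + 1) x) (J (m + 1) x) k *
      conj (coef (J (m + 1) x) k)) 0 := by
  set p := coef (J (m + 1) x) with hp
  have hs := (summable_triple m x).hasSum
  rw [← hp] at hs
  set S := ∑' z : ℤ × ℤ, (z.1 : ℂ) * (p z.2 * p (z.1 - z.2) * p (-z.1))
  -- The frequencies b, a - b, -a add up to zero and the product of coefficients is symmetric in
  -- them. `e₁` and `e₂` permute them and change the weight a into -b and b - a. The three weights
  -- sum to zero, so 3S = 0.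
  let e₁ : ℤ × ℤ ≃ ℤ × ℤ :=
    ⟨fun z => (-z.2, -z.1), fun z => (-z.2, -z.1), fun z => by simp, fun z => by simp⟩
  let e₂ : ℤ × ℤ ≃ ℤ × ℤ :=
    ⟨fun z => (z.2 - z.1, z.2), fun z => (z.2 - z.1, z.2), fun z => by simp, fun z => by simp⟩
  have h1 := (e₁.hasSum_iff).2 hs
  have h2 := (e₂.hasSum_iff).2 hs
  have hS : S = 0 := by
    have h12 := (hs.add h1).add h2
    have hz : HasSum (fun _ : ℤ × ℤ => (0 : ℂ)) (S + S + S) := by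
      convert h12 using 2 with z
      obtain ⟨a, b⟩ := z
      simp only [Function.comp, e₁, e₂, Equiv.coe_fn_mk]
      have e1 : -b - -a = a - b := by ring
      have e2 : b - a - b = -a := by ring
      have e3 : -(b - a) = a - b := by ring
      rw [e1, e2, e3, neg_neg]
      push_cast
      ring
    have := hz.unique hasSum_zero
    have h3 : (3 : ℂ) * S = 0 := by rw [← this]; ring
    simpa using h3
  rw [hS] at hs
  refine hs.prod_fiberwise fun k => ?_
  have h := ((hasSum_cv (J (m + 1) x) (J (m + 1) x) k).mul_left (k : ℂ)).mul_right (p (-k))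
  rw [hp, ← coef_neg_index]
  simpa only [mul_assoc] using h

end Burgers

/-! ### Right-continuous curves and Duhamel's formula for one mode. -/

namespace Burgers

open ComplexConjugate

/-- Right-continuity at every point. -/
def RightCont {E : Type*} [TopologicalSpace E] (f : ℝ → E) : Prop :=
  ∀ t, ContinuousWithinAt f (Ioi t) t

theorem RightCont.comp {E F : Type*} [TopologicalSpace E] [TopologicalSpace F] {f : ℝ → E}
    {g : E → F} (hg : Continuous g) (hf : RightCont f) : RightCont fun t => g (f t) :=
  fun t => hg.continuousAt.comp_continuousWithinAt (hf t)

theorem _root_.Continuous.rightCont {E : Type*} [TopologicalSpace E] {f : ℝ → E}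
    (hf : Continuous f) : RightCont f :=
  fun _ => hf.continuousWithinAt

theorem RightCont.stronglyMeasurable {E : Type*} [NormedAddCommGroup E] {f : ℝ → E}
    (hf : RightCont f) : StronglyMeasurable f := by
  -- Sample f at the first point of the grid ℤ/(n+1) strictly to the right of t. The + 1 makes the
  -- inequality strict, as continuity along `Ioi t` requires.
  let g : ℕ → ℝ → E := fun n t => f (((⌊(n + 1 : ℝ) * t⌋ : ℤ) + 1 : ℝ) / (n + 1))
  refine stronglyMeasurable_of_tendsto (f := g) atTop (fun n => ?_) (tendsto_pi_nhds.2 fun t => ?_)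
  · have h1 : StronglyMeasurable fun j : ℤ => f (((j : ℝ) + 1) / (n + 1)) :=
      StronglyMeasurable.of_discrete
    exact h1.comp_measurable (Int.measurable_floor.comp (measurable_const_mul _))
  · refine (hf t).tendsto.comp (tendsto_nhdsWithin_iff.2 ⟨?_, .of_forall fun n => ?_⟩)
    · have hlim : Tendsto (fun n : ℕ => t + 1 / ((n : ℝ) + 1)) atTop (𝓝 t) := by
        simpa using tendsto_const_nhds.add (tendsto_one_div_add_atTop_nhds_zero_nat (𝕜 := ℝ))
      refine tendsto_of_tendsto_of_tendsto_of_le_of_le tendsto_const_nhds hlim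
        (fun n => ?_) (fun n => ?_)
      · have hn : (0 : ℝ) < n + 1 := by positivity
        rw [le_div_iff₀ hn]
        have := Int.lt_floor_add_one ((n + 1 : ℝ) * t)
        linarith
      · have hn : (0 : ℝ) < n + 1 := by positivity
        have h1 : t + 1 / ((n : ℝ) + 1) = ((n + 1) * t + 1) / (n + 1) := by field_simp
        have := Int.floor_le ((n + 1 : ℝ) * t)
        simp only [h1]
        gcongr
    · have hn : (0 : ℝ) < n + 1 := by positivity
      simp only [mem_Ioi]
      rw [lt_div_iff₀ hn]
      have := Int.lt_floor_add_one ((n + 1 : ℝ) * t)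
      linarith

theorem RightCont.intervalIntegrable {E : Type*} [NormedAddCommGroup E] {f : ℝ → E}
    (hf : RightCont f) {M : ℝ} (hM : ∀ t, ‖f t‖ ≤ M) (a b : ℝ) :
    IntervalIntegrable f volume a b :=
  (intervalIntegrable_const (c := M)).mono_fun' hf.stronglyMeasurable.aestronglyMeasurable
    (.of_forall hM)

/-- The fundamental theorem of calculus for the right derivative of a primitive. -/
theorem hasDerivWithinAt_primitive {E : Type*} [NormedAddCommGroup E] [NormedSpace ℝ E]
    [CompleteSpace E] {h : ℝ → E} (hr : RightCont h) (hi : ∀ a b, IntervalIntegrable h volume a b)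
    (t : ℝ) : HasDerivWithinAt (fun t => ∫ s in (0 : ℝ)..t, h s) (h t) (Ioi t) t := by
  have := intervalIntegral.integral_hasDerivWithinAt_right (s := Ici t) (t := Ioi t) (hi 0 t)
    hr.stronglyMeasurable.stronglyMeasurableAtFilter (hr t)
  exact this.mono Ioi_subset_Ici_self

theorem continuous_primitive' {E : Type*} [NormedAddCommGroup E] [NormedSpace ℝ E]
    {h : ℝ → E} (hi : ∀ a b, IntervalIntegrable h volume a b) :
    Continuous fun t => ∫ s in (0 : ℝ)..t, h s :=
  intervalIntegral.continuous_primitive hi 0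

/-- Duhamel's formula for the solution of `y' = -l y + g`, `y(0) = 0`. -/
noncomputable def duh (l : ℝ) (g : ℝ → ℂ) (t : ℝ) : ℂ :=
  Real.exp (-l * t) • ∫ s in (0 : ℝ)..t, Real.exp (l * s) • g s

theorem intervalIntegrable_exp_smul {l : ℝ} {g : ℝ → ℂ}
    (hi : ∀ a b, IntervalIntegrable g volume a b) (a b : ℝ) :
    IntervalIntegrable (fun s => Real.exp (l * s) • g s) volume a b :=
  (hi a b).continuousOn_smul (by fun_prop)

theorem rightCont_exp_smul {l : ℝ} {g : ℝ → ℂ} (hr : RightCont g) :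
    RightCont fun s => Real.exp (l * s) • g s :=
  fun t => ContinuousWithinAt.smul (f := fun s => Real.exp (l * s))
    (Continuous.continuousWithinAt (by fun_prop)) (hr t)

theorem continuous_duh {l : ℝ} {g : ℝ → ℂ} (hi : ∀ a b, IntervalIntegrable g volume a b) :
    Continuous (duh l g) :=
  Continuous.smul (f := fun t => Real.exp (-l * t)) (by fun_prop)
    (continuous_primitive' (intervalIntegrable_exp_smul hi))

theorem duh_zero_time (l : ℝ) (g : ℝ → ℂ) : duh l g 0 = 0 := by simp [duh]

theorem hasDerivWithinAt_duh {l : ℝ} {g : ℝ → ℂ} (hr : RightCont g)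
    (hi : ∀ a b, IntervalIntegrable g volume a b) (t : ℝ) :
    HasDerivWithinAt (duh l g) (-(l : ℂ) * duh l g t + g t) (Ioi t) t := by
  have h1 : HasDerivWithinAt (fun t => Real.exp (-l * t)) (Real.exp (-l * t) * (-l)) (Ioi t) t := by
    have := ((hasDerivAt_id t).const_mul (-l)).exp
    simpa using this.hasDerivWithinAt
  have h2 := h1.smul (hasDerivWithinAt_primitive (rightCont_exp_smul (l := l) hr)
    (intervalIntegrable_exp_smul hi) t)
  refine h2.congr_deriv ?_
  have he : Real.exp (-l * t) * Real.exp (l * t) = 1 := by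
    rw [← Real.exp_add, show -l * t + l * t = 0 by ring, Real.exp_zero]
  rw [smul_smul, he, one_smul, duh, mul_comm (Real.exp _), mul_smul, Complex.real_smul]
  push_cast
  ring

theorem intervalIntegrable_deriv_duh {l : ℝ} {g : ℝ → ℂ}
    (hi : ∀ a b, IntervalIntegrable g volume a b) (a b : ℝ) :
    IntervalIntegrable (fun s => -(l : ℂ) * duh l g s + g s) volume a b :=
  ((continuous_const.mul (continuous_duh hi)).intervalIntegrable a b).add (hi a b)

theorem duh_eq_integral {l : ℝ} {g : ℝ → ℂ} (hr : RightCont g)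
    (hi : ∀ a b, IntervalIntegrable g volume a b) {t : ℝ} :
    duh l g t = ∫ s in (0 : ℝ)..t, (-(l : ℂ) * duh l g s + g s) := by
  rw [intervalIntegral.integral_eq_sub_of_hasDeriv_right (continuous_duh hi).continuousOn
    (fun x _ => hasDerivWithinAt_duh hr hi x) (intervalIntegrable_deriv_duh hi 0 t), duh_zero_time,
    sub_zero]

/-- A solution of the integrated equation `y' = -l y + g`, `y(0) = 0` is given by Duhamel's
formula. -/
theorem integral_eq_duh {l T : ℝ} {g h : ℝ → ℂ} (hhr : RightCont h)
    (hhi : ∀ a b, IntervalIntegrable h volume a b)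
    (hi : ∀ a b, IntervalIntegrable g volume a b)
    (heq : ∀ t ∈ Ico 0 T, h t = -(l : ℂ) * (∫ s in (0 : ℝ)..t, h s) + g t)
    {t : ℝ} (ht : t ∈ Icc 0 T) : ∫ s in (0 : ℝ)..t, h s = duh l g t := by
  set U := fun t => ∫ s in (0 : ℝ)..t, h s with hU
  -- With the integrating factor, e^{lt} U(t) has right derivative e^{lt} g(t).
  have hc : Continuous fun t => Real.exp (l * t) • U t :=
    Continuous.smul (f := fun t => Real.exp (l * t)) (by fun_prop) (continuous_primitive' hhi)
  have hd : ∀ x ∈ Ioo 0 t, HasDerivWithinAt (fun t => Real.exp (l * t) • U t)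
      (Real.exp (l * x) • g x) (Ioi x) x := by
    intro x hx
    have h1 : HasDerivWithinAt (fun t => Real.exp (l * t)) (Real.exp (l * x) * l) (Ioi x) x := by
      have := ((hasDerivAt_id x).const_mul l).exp
      simpa using this.hasDerivWithinAt
    refine (h1.smul (hasDerivWithinAt_primitive hhr hhi x)).congr_deriv ?_
    rw [heq x ⟨hx.1.le, hx.2.trans_le ht.2⟩]
    simp only [Complex.real_smul]
    push_cast
    ring
  have := intervalIntegral.integral_eq_sub_of_hasDeriv_right_of_le ht.1 hc.continuousOn hd
    (intervalIntegrable_exp_smul hi 0 t)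
  rw [duh, this]
  simp only [hU, intervalIntegral.integral_same, smul_zero, sub_zero, smul_smul, ← Real.exp_add]
  rw [show -l * t + l * t = 0 by ring]
  simp

/-- The energy identity of y' = -l y + g. The forcing is only right-continuous, so |y|² has just a
right derivative; with continuity this suffices for the fundamental theorem of calculus. -/
theorem norm_duh_sq_add {l : ℝ} {g : ℝ → ℂ} (hr : RightCont g)
    (hi : ∀ a b, IntervalIntegrable g volume a b) (t : ℝ) :
    ‖duh l g t‖ ^ 2 + 2 * l * ∫ s in (0 : ℝ)..t, ‖duh l g s‖ ^ 2 =
      ∫ s in (0 : ℝ)..t, 2 * inner ℝ (duh l g s) (g s) := by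
  have hc := continuous_duh (l := l) hi
  have hinner : ∀ a b, IntervalIntegrable (fun s => 2 * inner ℝ (duh l g s) (g s)) volume a b := by
    intro a b
    refine IntervalIntegrable.const_mul ?_ 2
    have h := (hi a b).continuousOn_mul hc.continuousOn
    refine (IntervalIntegrable.mono_fun h ?_ ?_)
    · exact (hc.aestronglyMeasurable.inner (hr.stronglyMeasurable.aestronglyMeasurable))
    · refine .of_forall fun s => ?_
      simpa using norm_inner_le_norm (𝕜 := ℝ) (duh l g s) (g s)
  have hsq : ∀ a b, IntervalIntegrable (fun s => 2 * l * ‖duh l g s‖ ^ 2) volume a b :=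
    fun a b => Continuous.intervalIntegrable (by fun_prop) a b
  have hd := intervalIntegral.integral_eq_sub_of_hasDeriv_right
    (f := fun t => ‖duh l g t‖ ^ 2) (a := 0) (b := t)
    (f' := fun s => 2 * inner ℝ (duh l g s) (g s) - 2 * l * ‖duh l g s‖ ^ 2)
    (by fun_prop)
    (fun x _ => by
      refine (hasDerivWithinAt_duh hr hi x).norm_sq.congr_deriv ?_
      rw [inner_add_right, ← Complex.ofReal_neg, ← Complex.real_smul, inner_smul_right,
        real_inner_self_eq_norm_sq]
      ring)
    ((hinner 0 t).sub (hsq 0 t))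
  rw [intervalIntegral.integral_sub (hinner 0 t) (hsq 0 t), duh_zero_time, norm_zero,
    intervalIntegral.integral_const_mul (2 * l)] at hd
  linarith

end Burgers

/-! ### The linear problem: energy estimates and continuity in time. -/

namespace Burgers

open ComplexConjugate

/-- Bounded right-continuous curves. -/
structure BddRightCont {E : Type*} [NormedAddCommGroup E] (f : ℝ → E) : Prop where
  rightCont : RightCont f
  bdd : ∃ M, ∀ t, ‖f t‖ ≤ M

namespace BddRightCont

variable {E F : Type*} [NormedAddCommGroup E] [NormedAddCommGroup F] {f g : ℝ → E}

theorem intervalIntegrable (hf : BddRightCont f) (a b : ℝ) : IntervalIntegrable f volume a b := by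
  obtain ⟨M, hM⟩ := hf.bdd
  exact hf.rightCont.intervalIntegrable hM a b

theorem add (hf : BddRightCont f) (hg : BddRightCont g) : BddRightCont fun t => f t + g t := by
  obtain ⟨M, hM⟩ := hf.bdd
  obtain ⟨N, hN⟩ := hg.bdd
  exact ⟨fun t => (hf.rightCont t).add (hg.rightCont t), M + N, fun t =>
    (norm_add_le _ _).trans (add_le_add (hM t) (hN t))⟩

theorem sub (hf : BddRightCont f) (hg : BddRightCont g) : BddRightCont fun t => f t - g t := by
  obtain ⟨M, hM⟩ := hf.bdd
  obtain ⟨N, hN⟩ := hg.bdd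
  exact ⟨fun t => (hf.rightCont t).sub (hg.rightCont t), M + N, fun t =>
    (norm_sub_le _ _).trans (add_le_add (hM t) (hN t))⟩

theorem smul [NormedSpace ℝ E] {c : ℝ → ℝ} (hc : BddRightCont c) (hf : BddRightCont f) :
    BddRightCont fun t => c t • f t := by
  obtain ⟨M, hM⟩ := hf.bdd
  obtain ⟨N, hN⟩ := hc.bdd
  refine ⟨fun t => (hc.rightCont t).smul (hf.rightCont t), N * M, fun t => ?_⟩
  rw [norm_smul]
  exact mul_le_mul (hN t) (hM t) (norm_nonneg _) ((norm_nonneg _).trans (hN t))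

theorem of_le {h : ℝ → F} (hf : BddRightCont f) (hh : RightCont h) (C : ℝ) (hC : 0 ≤ C)
    (hle : ∀ t, ‖h t‖ ≤ C * ‖f t‖) : BddRightCont h := by
  obtain ⟨M, hM⟩ := hf.bdd
  exact ⟨hh, C * M, fun t => (hle t).trans (mul_le_mul_of_nonneg_left (hM t) hC)⟩

theorem norm_sq (hf : BddRightCont f) : BddRightCont fun t => ‖f t‖ ^ 2 := by
  obtain ⟨M, hM⟩ := hf.bdd
  refine ⟨hf.rightCont.comp (g := fun x => ‖x‖ ^ 2) (by fun_prop), M ^ 2, fun t => ?_⟩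
  rw [norm_pow, norm_norm]
  exact pow_le_pow_left₀ (norm_nonneg _) (hM t) 2

end BddRightCont

theorem BddRightCont.coef {f : ℝ → L2} (hf : BddRightCont f) (k : ℤ) :
    BddRightCont fun t => coef (f t) k :=
  hf.of_le (hf.rightCont.comp (g := fun φ => Burgers.coef φ k) (continuous_coef k)) 1 zero_le_one fun t => by
    simpa using norm_coef_le (f t) k

theorem BddRightCont.J {f : ℝ → L2} (hf : BddRightCont f) (m : ℕ) :
    BddRightCont fun t => J m (f t) :=
  hf.of_le (hf.rightCont.comp (continuous_J m)) 1 zero_le_one fun t => by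
    simpa using norm_J_le m (f t)

theorem BddRightCont.B_self {f : ℝ → L2} (hf : BddRightCont f) (m : ℕ) :
    BddRightCont fun t => B m (f t) (f t) :=
  hf.norm_sq.of_le (hf.rightCont.comp (continuous_B_self m)) (2 * algConst m)
    (mul_nonneg zero_le_two (algConst_nonneg m)) fun t => by
    refine (norm_B_le m _ _).trans_eq ?_
    rw [norm_pow, norm_norm]; ring

theorem hasSum_integral_coef_sq {f : ℝ → L2} (hf : BddRightCont f) (t : ℝ) :
    HasSum (fun k => ∫ s in (0 : ℝ)..t, ‖coef (f s) k‖ ^ 2) (∫ s in (0 : ℝ)..t, ‖f s‖ ^ 2) := by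
  refine intervalIntegral.hasSum_integral_of_dominated_convergence
    (fun k s => ‖coef (f s) k‖ ^ 2) (fun k => ?_) (fun k => .of_forall fun s _ => by simp)
    (.of_forall fun s _ => (hasSum_sq_coef (f s)).summable) ?_
    (.of_forall fun s _ => hasSum_sq_coef (f s))
  · exact (hf.coef k).norm_sq.rightCont.stronglyMeasurable.aestronglyMeasurable
  · simp_rw [fun s => (hasSum_sq_coef (f s)).tsum_eq]
    exact hf.norm_sq.intervalIntegrable _ _

/-- The forcing of the `k`-th Fourier mode, `-½ · 2πi k F_k`. -/
noncomputable def forcing (F : L2) (k : ℤ) : ℂ :=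
  -((Real.pi * k : ℝ) : ℂ) * Complex.I * coef F k

theorem norm_forcing (F : L2) (k : ℤ) : ‖forcing F k‖ = kap k / 2 * ‖coef F k‖ := by
  rw [forcing, norm_mul, norm_mul, norm_neg, Complex.norm_I, Complex.norm_real, Real.norm_eq_abs,
    abs_mul, abs_of_pos Real.pi_pos, kap]
  ring

@[simp] theorem forcing_index_zero (F : L2) : forcing F 0 = 0 := by simp [forcing]

theorem forcing_neg_index (F : L2) (k : ℤ) : forcing F (-k) = conj (forcing F k) := by
  simp only [forcing, coef_neg_index, map_mul, map_neg, Complex.conj_I, Complex.conj_ofReal]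
  push_cast
  ring

theorem forcing_add (F G : L2) (k : ℤ) : forcing (F + G) k = forcing F k + forcing G k := by
  rw [forcing, coef_add, mul_add]; rfl

theorem forcing_sub (F G : L2) (k : ℤ) : forcing (F - G) k = forcing F k - forcing G k := by
  rw [forcing, coef_sub, mul_sub]; rfl

theorem BddRightCont.forcing {f : ℝ → L2} (hf : BddRightCont f) (k : ℤ) :
    BddRightCont fun t => forcing (f t) k :=
  (hf.coef k).of_le ((hf.coef k).rightCont.comp (continuous_const.mul continuous_id)) (kap k / 2)
    (div_nonneg (kap_nonneg k) zero_le_two) fun _ => (norm_forcing _ _).le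

/-- The `k`-th Fourier mode of the solution of `∂ₜx = ν ∂ₓₓx - ½ ∂ₓf`, `x(0) = 0`. -/
noncomputable def mode (ν : ℝ) (f : ℝ → L2) (k : ℤ) (t : ℝ) : ℂ :=
  duh (ν * kap k ^ 2) (fun s => forcing (f s) k) t

theorem continuous_mode {ν : ℝ} {f : ℝ → L2} (hf : BddRightCont f) (k : ℤ) :
    Continuous (mode ν f k) :=
  continuous_duh (hf.forcing k).intervalIntegrable

theorem intervalIntegrable_inner {f g : ℝ → ℂ} (hf : Continuous f) (hg : BddRightCont g) (a b : ℝ) :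
    IntervalIntegrable (fun s => inner ℝ (f s) (g s)) volume a b := by
  refine IntervalIntegrable.mono_fun
    ((hg.intervalIntegrable a b).continuousOn_mul hf.continuousOn) ?_ ?_
  · exact hf.aestronglyMeasurable.inner hg.rightCont.stronglyMeasurable.aestronglyMeasurable
  · refine .of_forall fun s => ?_
    simpa using norm_inner_le_norm (𝕜 := ℝ) (f s) (g s)

/-- Energy inequality for a single mode; the part `g` of the forcing is kept. -/
theorem mode_energy {ν : ℝ} (hν : 0 < ν) {f g h : ℝ → L2} (hf : BddRightCont f)
    (hg : BddRightCont g) (hh : BddRightCont h) (hfg : ∀ s, f s = g s + h s)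
    (k : ℤ) {t : ℝ} (ht : 0 ≤ t) :
    ‖mode ν f k t‖ ^ 2 + ν * ∫ s in (0 : ℝ)..t, (kap k * ‖mode ν f k s‖) ^ 2 ≤
      (∫ s in (0 : ℝ)..t, 2 * inner ℝ (mode ν f k s) (forcing (g s) k)) +
        (4 * ν)⁻¹ * ∫ s in (0 : ℝ)..t, ‖coef (h s) k‖ ^ 2 := by
  have hc := continuous_mode (ν := ν) hf k
  have h0 := norm_duh_sq_add (l := ν * kap k ^ 2) (hf.forcing k).rightCont
    (hf.forcing k).intervalIntegrable t
  change ‖mode ν f k t‖ ^ 2 + 2 * (ν * kap k ^ 2) * (∫ s in (0 : ℝ)..t, ‖mode ν f k s‖ ^ 2) =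
    ∫ s in (0 : ℝ)..t, 2 * inner ℝ (mode ν f k s) (forcing (f s) k) at h0
  have hi1 := ((intervalIntegrable_inner hc (hg.forcing k) 0 t).const_mul 2)
  have hi2 : IntervalIntegrable (fun s => ν * (kap k * ‖mode ν f k s‖) ^ 2) volume 0 t :=
    Continuous.intervalIntegrable (by fun_prop) _ _
  have hi3 := ((hh.coef k).norm_sq.intervalIntegrable 0 t).const_mul (4 * ν)⁻¹
  have hle : ∫ s in (0 : ℝ)..t, 2 * inner ℝ (mode ν f k s) (forcing (f s) k) ≤
      ∫ s in (0 : ℝ)..t, (2 * inner ℝ (mode ν f k s) (forcing (g s) k) +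
        ν * (kap k * ‖mode ν f k s‖) ^ 2 + (4 * ν)⁻¹ * ‖coef (h s) k‖ ^ 2) := by
    refine intervalIntegral.integral_mono_on ht
      ((intervalIntegrable_inner hc (hf.forcing k) 0 t).const_mul 2)
      ((hi1.add hi2).add hi3) fun s _ => ?_
    have e1 : inner ℝ (mode ν f k s) (forcing (h s) k) ≤
        ‖mode ν f k s‖ * (kap k / 2 * ‖coef (h s) k‖) := by
      rw [← norm_forcing]; exact real_inner_le_norm _ _
    rw [hfg, forcing_add, inner_add_right]
    -- Completing the square spends half of the dissipation 2ν and produces the constant (4ν)⁻¹.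
    have e2 : kap k * ‖mode ν f k s‖ * ‖coef (h s) k‖ ≤
        ν * (kap k * ‖mode ν f k s‖) ^ 2 + (4 * ν)⁻¹ * ‖coef (h s) k‖ ^ 2 := by
      have : 0 ≤ (4 * ν)⁻¹ * (2 * ν * (kap k * ‖mode ν f k s‖) - ‖coef (h s) k‖) ^ 2 := by
        positivity
      have e3 : (4 * ν)⁻¹ * (2 * ν * (kap k * ‖mode ν f k s‖) - ‖coef (h s) k‖) ^ 2 =
        ν * (kap k * ‖mode ν f k s‖) ^ 2 + (4 * ν)⁻¹ * ‖coef (h s) k‖ ^ 2 -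
          kap k * ‖mode ν f k s‖ * ‖coef (h s) k‖ := by
        field_simp; ring
      linarith
    linarith
  rw [intervalIntegral.integral_add (hi1.add hi2) hi3, intervalIntegral.integral_add hi1 hi2,
    intervalIntegral.integral_const_mul ν, intervalIntegral.integral_const_mul (4 * ν)⁻¹] at hle
  have hmul : ∫ s in (0 : ℝ)..t, (kap k * ‖mode ν f k s‖) ^ 2 =
      kap k ^ 2 * ∫ s in (0 : ℝ)..t, ‖mode ν f k s‖ ^ 2 := by
    simp_rw [mul_pow]; rw [intervalIntegral.integral_const_mul]
  rw [hmul] at hle ⊢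
  linarith

theorem mode_energy_le {ν : ℝ} (hν : 0 < ν) {f : ℝ → L2} (hf : BddRightCont f)
    (k : ℤ) {t : ℝ} (ht : 0 ≤ t) :
    ‖mode ν f k t‖ ^ 2 + ν * ∫ s in (0 : ℝ)..t, (kap k * ‖mode ν f k s‖) ^ 2 ≤
        (4 * ν)⁻¹ * ∫ s in (0 : ℝ)..t, ‖coef (f s) k‖ ^ 2 := by
  have h0 : BddRightCont fun _ : ℝ => (0 : L2) := ⟨continuous_const.rightCont, 0, by simp⟩
  have := mode_energy hν hf h0 hf (fun s => (zero_add _).symm) k ht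
  simpa [forcing] using this

theorem norm_mode_sq_le {ν : ℝ} (hν : 0 < ν) {f : ℝ → L2} (hf : BddRightCont f)
    (k : ℤ) {t : ℝ} (ht : 0 ≤ t) :
    ‖mode ν f k t‖ ^ 2 ≤ (4 * ν)⁻¹ * ∫ s in (0 : ℝ)..t, ‖coef (f s) k‖ ^ 2 := by
  refine le_trans ?_ (mode_energy_le hν hf k ht)
  have : 0 ≤ ∫ s in (0 : ℝ)..t, (kap k * ‖mode ν f k s‖) ^ 2 :=
    intervalIntegral.integral_nonneg ht fun s _ => by positivity
  have := mul_nonneg hν.le this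
  linarith

theorem mode_neg_index (ν : ℝ) (f : ℝ → L2) (k : ℤ) (t : ℝ) :
    mode ν f (-k) t = conj (mode ν f k t) := by
  simp only [mode, duh, forcing_neg_index, kap_neg, Complex.real_smul, map_mul,
    Complex.conj_ofReal]
  rw [← intervalIntegral.intervalIntegral_conj]
  simp only [map_mul, Complex.conj_ofReal]

theorem exists_sol {ν : ℝ} (hν : 0 < ν) {f : ℝ → L2} (hf : BddRightCont f) {t : ℝ} (ht : 0 ≤ t) :
    ∃ x : L2, ∀ k, coef x k = mode ν f k t :=
  exists_coef_eq (((hasSum_integral_coef_sq hf t).summable.mul_left (4 * ν)⁻¹).of_nonneg_of_le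
    (fun _ => by positivity) fun k => norm_mode_sq_le hν hf k ht) fun k => mode_neg_index _ _ _ _

open Classical in
/-- The function with given Fourier coefficients, if there is one. -/
noncomputable def synth (c : ℤ → ℂ) : L2 :=
  if h : ∃ x : L2, ∀ k, coef x k = c k then h.choose else 0

theorem coef_synth {c : ℤ → ℂ} (h : ∃ x : L2, ∀ k, coef x k = c k) (k : ℤ) :
    coef (synth c) k = c k := by
  rw [synth, dif_pos h]
  exact h.choose_spec k

/-- The solution of `∂ₜx = ν ∂ₓₓx - ½ ∂ₓf`, `x(0) = 0`. -/
noncomputable def sol (ν : ℝ) (f : ℝ → L2) (t : ℝ) : L2 := synth fun k => mode ν f k t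

theorem coef_sol {ν : ℝ} (hν : 0 < ν) {f : ℝ → L2} (hf : BddRightCont f) {t : ℝ} (ht : 0 ≤ t)
    (k : ℤ) : coef (sol ν f t) k = mode ν f k t :=
  coef_synth (exists_sol hν hf ht) k

/-- The derivative in front of f costs nothing, because each mode absorbs it in its dissipation. All
Volterra estimates below come from this bound. -/
theorem norm_sol_sq_le {ν : ℝ} (hν : 0 < ν) {f : ℝ → L2} (hf : BddRightCont f) {t : ℝ}
    (ht : 0 ≤ t) : ‖sol ν f t‖ ^ 2 ≤ (4 * ν)⁻¹ * ∫ s in (0 : ℝ)..t, ‖f s‖ ^ 2 := by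
  refine hasSum_le (fun k => ?_) (hasSum_sq_coef _) ((hasSum_integral_coef_sq hf t).mul_left _)
  rw [coef_sol hν hf ht]
  exact norm_mode_sq_le hν hf k ht

theorem duh_sub {l : ℝ} {f g : ℝ → ℂ} (hf : ∀ a b, IntervalIntegrable f volume a b)
    (hg : ∀ a b, IntervalIntegrable g volume a b) (t : ℝ) :
    duh l (fun s => f s - g s) t = duh l f t - duh l g t := by
  simp only [duh, smul_sub]
  rw [intervalIntegral.integral_sub (intervalIntegrable_exp_smul hf 0 t)
    (intervalIntegrable_exp_smul hg 0 t), smul_sub]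

theorem sol_sub {ν : ℝ} (hν : 0 < ν) {f g : ℝ → L2} (hf : BddRightCont f) (hg : BddRightCont g)
    {t : ℝ} (ht : 0 ≤ t) : sol ν f t - sol ν g t = sol ν (fun s => f s - g s) t := by
  refine L2_ext fun k => ?_
  rw [coef_sub, coef_sol hν hf ht, coef_sol hν hg ht, coef_sol hν (hf.sub hg) ht, mode, mode, mode,
    ← duh_sub (hf.forcing k).intervalIntegrable (hg.forcing k).intervalIntegrable]
  simp_rw [forcing_sub]

/-- Every mode is continuous, and on [0,T] its square is dominated by a summable sequence not
depending on time, so dominated convergence applies to the series. -/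
theorem continuousOn_sol {ν : ℝ} (hν : 0 < ν) {f : ℝ → L2} (hf : BddRightCont f) (T : ℝ) :
    ContinuousOn (sol ν f) (Icc 0 T) := by
  intro t ht
  rw [ContinuousWithinAt, tendsto_iff_norm_sub_tendsto_zero]
  have hsq : Tendsto (fun s => ‖sol ν f s - sol ν f t‖ ^ 2) (𝓝[Icc 0 T] t) (𝓝 0) := by
    set M : ℤ → ℝ := fun k => (4 * ν)⁻¹ * ∫ s in (0 : ℝ)..T, ‖coef (f s) k‖ ^ 2 with hM
    have hMs : Summable M := (hasSum_integral_coef_sq hf T).summable.mul_left _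
    have hb : ∀ s ∈ Icc 0 T, ∀ k, ‖mode ν f k s‖ ^ 2 ≤ M k := by
      intro s hs k
      refine (norm_mode_sq_le hν hf k hs.1).trans ?_
      refine mul_le_mul_of_nonneg_left ?_ (by positivity)
      exact intervalIntegral.integral_mono_interval le_rfl hs.1 hs.2
        (.of_forall fun s => by positivity) ((hf.coef k).norm_sq.intervalIntegrable 0 T)
    have hlim := tendsto_tsum_of_dominated_convergence (𝓕 := 𝓝[Icc 0 T] t)
      (f := fun s k => ‖mode ν f k s - mode ν f k t‖ ^ 2) (g := fun _ => (0 : ℝ))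
      (bound := fun k => 4 * M k) (hMs.mul_left 4)
      (fun k => by
        have h1 : Continuous fun s => ‖mode ν f k s - mode ν f k t‖ ^ 2 := by
          have := continuous_mode (ν := ν) hf k
          fun_prop
        have h2 := (h1.tendsto t).mono_left (nhdsWithin_le_nhds (s := Icc 0 T))
        simpa using h2)
      (by
        filter_upwards [self_mem_nhdsWithin] with s hs k
        have h1 := hb s hs k
        have h2 := hb t ht k
        rw [norm_pow, norm_norm]
        have h3 := norm_sub_le (mode ν f k s) (mode ν f k t)
        nlinarith [sq_nonneg (‖mode ν f k s‖ - ‖mode ν f k t‖), norm_nonneg (mode ν f k s),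
          norm_nonneg (mode ν f k t), norm_nonneg (mode ν f k s - mode ν f k t)])
    rw [tsum_zero] at hlim
    refine hlim.congr' ?_
    filter_upwards [self_mem_nhdsWithin] with s hs
    rw [← (hasSum_sq_coef _).tsum_eq]
    simp_rw [coef_sub, coef_sol hν hf hs.1, coef_sol hν hf ht.1]
  have := hsq.sqrt
  simpa using this

end Burgers

/-! ### Volterra fixed points, Gronwall's inequality and the truncated equation. -/

namespace Burgers

/-- Each integration gains a factor L t / (j + 1). The factorial decay yields both the convergence
of Picard iteration on an arbitrarily long interval and uniqueness. -/
theorem le_pow_div_factorial_of_iterated_integral {L M T : ℝ} (hL : 0 ≤ L) {y : ℕ → ℝ → ℝ}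
    (hi : ∀ j, ∀ t ∈ Icc 0 T, IntervalIntegrable (y j) volume 0 t)
    (h0 : ∀ t ∈ Icc 0 T, y 0 t ≤ M)
    (hstep : ∀ j, ∀ t ∈ Icc 0 T, y (j + 1) t ≤ L * ∫ s in (0 : ℝ)..t, y j s) (j : ℕ) :
    ∀ t ∈ Icc 0 T, y j t ≤ M * ((L * t) ^ j / j.factorial) := by
  induction j with
  | zero => intro t ht; simpa using h0 t ht
  | succ j ih =>
    intro t ht
    refine (hstep j t ht).trans ?_
    have hle : ∫ s in (0 : ℝ)..t, y j s ≤
        ∫ s in (0 : ℝ)..t, M * ((L * s) ^ j / j.factorial) :=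
      intervalIntegral.integral_mono_on ht.1 (hi j t ht)
        (Continuous.intervalIntegrable (by fun_prop) _ _)
        fun s hs => ih s ⟨hs.1, hs.2.trans ht.2⟩
    have hval : ∫ s in (0 : ℝ)..t, M * ((L * s) ^ j / j.factorial) =
        M * (L ^ j / j.factorial) * (t ^ (j + 1) / (j + 1)) := by
      have : ∀ s : ℝ, M * ((L * s) ^ j / j.factorial) = M * (L ^ j / j.factorial) * s ^ j := by
        intro s; rw [mul_pow]; ring
      simp_rw [this]
      rw [intervalIntegral.integral_const_mul, integral_pow]
      simp
    refine (mul_le_mul_of_nonneg_left (hle.trans_eq hval) hL).trans_eq ?_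
    rw [Nat.factorial_succ]
    push_cast
    have : (j.factorial : ℝ) ≠ 0 := by exact_mod_cast j.factorial_ne_zero
    have : (j : ℝ) + 1 ≠ 0 := by positivity
    field_simp
    ring

/-- A bounded nonnegative function dominated by a multiple of its primitive vanishes. -/
theorem eq_zero_of_le_mul_integral {L M T : ℝ} (hL : 0 ≤ L) {y : ℝ → ℝ}
    (hi : ∀ t ∈ Icc 0 T, IntervalIntegrable y volume 0 t) (h0 : ∀ t ∈ Icc 0 T, 0 ≤ y t)
    (hM : ∀ t ∈ Icc 0 T, y t ≤ M)
    (h : ∀ t ∈ Icc 0 T, y t ≤ L * ∫ s in (0 : ℝ)..t, y s) : ∀ t ∈ Icc 0 T, y t = 0 := by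
  intro t ht
  have hb := fun j => le_pow_div_factorial_of_iterated_integral (y := fun _ => y) hL
    (fun _ => hi) hM (fun _ => h) j t ht
  have hlim := (FloorSemiring.tendsto_pow_div_factorial_atTop (L * t)).const_mul M
  rw [mul_zero] at hlim
  exact le_antisymm (ge_of_tendsto' hlim hb) (h0 t ht)

/-- Picard iteration on `C([0,T]; E)` for maps of Volterra type. -/
theorem exists_fixedPoint_of_volterra {E : Type*} [NormedAddCommGroup E] [CompleteSpace E]
    {T L : ℝ} (hT : 0 ≤ T) (hL : 0 ≤ L) (Φ : C(Icc (0 : ℝ) T, E) → C(Icc (0 : ℝ) T, E))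
    (hΦ : ∀ w w' : C(Icc (0 : ℝ) T, E), ∀ t (ht : t ∈ Icc 0 T),
      ‖Φ w ⟨t, ht⟩ - Φ w' ⟨t, ht⟩‖ ^ 2 ≤
        L * ∫ s in (0 : ℝ)..t, ‖IccExtend hT w s - IccExtend hT w' s‖ ^ 2) :
    ∃ w, Φ w = w := by
  have key : ∀ (j : ℕ) (w w' : C(Icc (0 : ℝ) T, E)), ∀ t (ht : t ∈ Icc 0 T),
      ‖Φ^[j] w ⟨t, ht⟩ - Φ^[j] w' ⟨t, ht⟩‖ ^ 2 ≤
        dist w w' ^ 2 * ((L * t) ^ j / j.factorial) := by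
    intro j w w' t ht
    have := le_pow_div_factorial_of_iterated_integral (T := T) (M := dist w w' ^ 2) hL
      (y := fun j t => ‖IccExtend hT (Φ^[j] w) t - IccExtend hT (Φ^[j] w') t‖ ^ 2)
      (fun j t _ => by
        refine Continuous.intervalIntegrable ?_ _ _
        exact ((((Φ^[j] w).continuous.Icc_extend').sub
          ((Φ^[j] w').continuous.Icc_extend')).norm.pow 2))
      (fun t ht => by
        rw [IccExtend_of_mem _ _ ht, IccExtend_of_mem _ _ ht, ← dist_eq_norm]
        exact pow_le_pow_left₀ dist_nonneg (ContinuousMap.dist_apply_le_dist _) 2)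
      (fun j t ht => by
        rw [IccExtend_of_mem _ _ ht, IccExtend_of_mem _ _ ht, Function.iterate_succ_apply',
          Function.iterate_succ_apply']
        exact hΦ _ _ t ht) j t ht
    simpa only [IccExtend_of_mem hT _ ht] using this
  have hlim := FloorSemiring.tendsto_pow_div_factorial_atTop (L * T)
  -- The estimates concern squared distances, so 1/4 here means Lipschitz constant 1/2.
  obtain ⟨j, hj⟩ := (hlim.eventually (gt_mem_nhds (show (0 : ℝ) < 1 / 4 by norm_num))).exists
  have hcontr : ContractingWith (1 / 2) Φ^[j] := by
    refine ⟨by rw [← NNReal.coe_lt_coe]; norm_num, LipschitzWith.of_dist_le_mul fun w w' => ?_⟩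
    rw [ContinuousMap.dist_le (by positivity)]
    rintro ⟨t, ht⟩
    have h1 := key j w w' t ht
    have h2 : (L * t) ^ j / j.factorial ≤ (L * T) ^ j / j.factorial := by
      gcongr
      · exact mul_nonneg hL ht.1
      · exact ht.2
    have h3 : ‖Φ^[j] w ⟨t, ht⟩ - Φ^[j] w' ⟨t, ht⟩‖ ^ 2 ≤ (1 / 2 * dist w w') ^ 2 := by
      refine h1.trans ?_
      have := mul_le_mul_of_nonneg_left (h2.trans hj.le) (sq_nonneg (dist w w'))
      refine this.trans_eq ?_
      ring
    rw [dist_eq_norm]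
    have := (pow_le_pow_iff_left₀ (norm_nonneg _) (by positivity) two_ne_zero).1 h3
    simpa using this
  have : Nonempty C(Icc (0 : ℝ) T, E) := ⟨0⟩
  -- Φ commutes with its iterate and so preserves the iterate's unique fixed point.
  exact ⟨_, hcontr.isFixedPt_fixedPoint_iterate⟩

/-- Gronwall's inequality in integral form. -/
theorem add_le_mul_exp_of_le_integral {a y : ℝ → ℝ} (ha : Continuous a) (hy : Continuous y)
    (ha0 : ∀ t, 0 ≤ a t) {b T : ℝ}
    (h : ∀ t ∈ Icc 0 T, y t ≤ ∫ s in (0 : ℝ)..t, a s * (y s + b)) :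
    ∀ t ∈ Icc 0 T, y t + b ≤ b * Real.exp (∫ s in (0 : ℝ)..t, a s) := by
  intro t ht
  set A := fun t => ∫ s in (0 : ℝ)..t, a s with hA
  set G := fun t => ∫ s in (0 : ℝ)..t, a s * (y s + b) with hG
  have hA' : ∀ t, HasDerivAt A (a t) t := fun t =>
    ha.integral_hasStrictDerivAt 0 t |>.hasDerivAt
  have hG' : ∀ t, HasDerivAt G (a t * (y t + b)) t := fun t =>
    (Continuous.integral_hasStrictDerivAt (by fun_prop) 0 t).hasDerivAt
  have hd : ∀ t, HasDerivAt (fun t => (G t + b) * Real.exp (-A t))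
      ((a t * (y t + b)) * Real.exp (-A t) + (G t + b) * (Real.exp (-A t) * -a t)) t := fun t =>
    ((hG' t).add_const b).mul ((hA' t).neg.exp)
  -- The derivative equals a e^{-A} (y - G), which is nonpositive by hypothesis.
  have hanti : AntitoneOn (fun t => (G t + b) * Real.exp (-A t)) (Icc 0 T) := by
    refine antitoneOn_of_deriv_nonpos (convex_Icc 0 T)
      (fun t _ => (hd t).continuousAt.continuousWithinAt)
      (fun t _ => (hd t).differentiableAt.differentiableWithinAt) fun t ht => ?_
    rw [interior_Icc] at ht
    rw [(hd t).deriv]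
    have h1 := h t ⟨ht.1.le, ht.2.le⟩
    have h2 : 0 ≤ a t * Real.exp (-A t) := mul_nonneg (ha0 t) (Real.exp_pos _).le
    have h3 : a t * Real.exp (-A t) * (y t - G t) ≤ 0 :=
      mul_nonpos_of_nonneg_of_nonpos h2 (sub_nonpos.2 h1)
    linarith
  have hle := hanti (left_mem_Icc.2 (ht.1.trans ht.2)) ht ht.1
  simp only [hG, hA, intervalIntegral.integral_same, neg_zero, Real.exp_zero, zero_add,
    mul_one] at hle
  have h4 : (G t + b) ≤ b * Real.exp (A t) := by
    have := mul_le_mul_of_nonneg_right hle (Real.exp_pos (A t)).le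
    rwa [mul_assoc, ← Real.exp_add, neg_add_cancel, Real.exp_zero, mul_one] at this
  have := h t ht
  change y t + b ≤ b * Real.exp (A t)
  linarith

/-- The factor of the radial retraction onto the ball of radius `R`. -/
noncomputable def cutoff {E : Type*} [NormedAddCommGroup E] (R : ℝ) (x : E) : ℝ := R / max R ‖x‖

section cutoff

variable {E : Type*} [NormedAddCommGroup E] {R : ℝ}

theorem cutoff_nonneg (hR : 0 < R) (x : E) : 0 ≤ cutoff R x :=
  div_nonneg hR.le (hR.le.trans (le_max_left _ _))

theorem cutoff_le_one (hR : 0 < R) (x : E) : cutoff R x ≤ 1 :=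
  div_le_one_of_le₀ (le_max_left _ _) (hR.le.trans (le_max_left _ _))

theorem cutoff_eq_one (hR : 0 < R) {x : E} (hx : ‖x‖ ≤ R) : cutoff R x = 1 := by
  rw [cutoff, max_eq_left hx, div_self hR.ne']

theorem continuous_cutoff (hR : 0 < R) : Continuous (cutoff R : E → ℝ) :=
  Continuous.div (by fun_prop) (by fun_prop) fun x => (lt_max_of_lt_left hR).ne'

variable [NormedSpace ℝ E]

theorem norm_cutoff_smul_le (hR : 0 < R) (x : E) : ‖cutoff R x • x‖ ≤ R := by
  rw [norm_smul, Real.norm_of_nonneg (cutoff_nonneg hR x), cutoff, div_mul_eq_mul_div,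
    div_le_iff₀ (lt_max_of_lt_left hR)]
  exact mul_le_mul_of_nonneg_left (le_max_right _ _) hR.le

/-- Split the difference as θ(x)(x - y) + (θ(x) - θ(y)) y, where θ is the cutoff factor; each
summand is at most ‖x - y‖. The constant 2 is not sharp in L², but this argument uses no inner
product. -/
theorem norm_cutoff_smul_sub_le (hR : 0 < R) (x y : E) :
    ‖cutoff R x • x - cutoff R y • y‖ ≤ 2 * ‖x - y‖ := by
  have h1 : cutoff R x • x - cutoff R y • y =
      cutoff R x • (x - y) + (cutoff R x - cutoff R y) • y := by module
  have h2 : |cutoff R x - cutoff R y| * ‖y‖ ≤ ‖x - y‖ := by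
    have hx : 0 < max R ‖x‖ := lt_max_of_lt_left hR
    have hy : 0 < max R ‖y‖ := lt_max_of_lt_left hR
    have e1 : cutoff R x - cutoff R y = cutoff R x * (max R ‖y‖ - max R ‖x‖) / max R ‖y‖ := by
      unfold cutoff; field_simp
    have e2 : |max R ‖y‖ - max R ‖x‖| ≤ ‖x - y‖ := by
      have := abs_max_sub_max_le_max R ‖y‖ R ‖x‖
      rw [sub_self, abs_zero, max_eq_right (abs_nonneg (‖y‖ - ‖x‖))] at this
      refine this.trans ?_
      rw [norm_sub_rev]
      exact abs_norm_sub_norm_le y x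
    rw [e1, abs_div, abs_mul, abs_of_nonneg (cutoff_nonneg hR x), abs_of_pos hy,
      div_mul_eq_mul_div, div_le_iff₀ hy]
    exact mul_le_mul ((mul_le_of_le_one_left (abs_nonneg _) (cutoff_le_one hR x)).trans e2)
      (le_max_right _ _) (norm_nonneg _) (norm_nonneg _)
  rw [h1]
  refine (norm_add_le _ _).trans ?_
  rw [norm_smul, norm_smul, Real.norm_of_nonneg (cutoff_nonneg hR x), Real.norm_eq_abs]
  have := mul_le_of_le_one_left (norm_nonneg (x - y)) (cutoff_le_one hR x)
  linarith

end cutoff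

/-- The square `(x + V)²` in the coordinates of `Hⁿ`, `n = m + 1`. -/
noncomputable def sqAdd (m : ℕ) (V x : ℝ → L2) (s : ℝ) : L2 := B m (x s + V s) (x s + V s)

theorem BddRightCont.sqAdd {V x : ℝ → L2} (hV : BddRightCont V) (hx : BddRightCont x) (m : ℕ) :
    BddRightCont (sqAdd m V x) := (hx.add hV).B_self m

/-- Smoothing of the linear problem combined with the local Lipschitz bound of the square. Serves
for existence, with M the truncation radius, and for uniqueness, with M a common bound of two
solutions. -/
theorem norm_sol_sq_sub_le {ν : ℝ} (hν : 0 < ν) {m : ℕ} {V x y : ℝ → L2} (hV : BddRightCont V)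
    (hx : BddRightCont x) (hy : BddRightCont y) {N M : ℝ} (hN : ∀ s, ‖V s‖ ≤ N)
    (hxM : ∀ s, ‖x s‖ ≤ M) (hyM : ∀ s, ‖y s‖ ≤ M) {t : ℝ} (ht : 0 ≤ t) :
    ‖sol ν (sqAdd m V x) t - sol ν (sqAdd m V y) t‖ ^ 2 ≤
      ((4 * ν)⁻¹ * (4 * algConst m * (M + N)) ^ 2) * ∫ s in (0 : ℝ)..t, ‖x s - y s‖ ^ 2 := by
  have h0 := algConst_nonneg m
  rw [sol_sub hν (hV.sqAdd hx m) (hV.sqAdd hy m) ht]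
  refine (norm_sol_sq_le hν ((hV.sqAdd hx m).sub (hV.sqAdd hy m)) ht).trans ?_
  rw [mul_assoc, ← intervalIntegral.integral_const_mul ((4 * algConst m * (M + N)) ^ 2)]
  refine mul_le_mul_of_nonneg_left ?_ (by positivity)
  refine intervalIntegral.integral_mono_on ht
    (((hV.sqAdd hx m).sub (hV.sqAdd hy m)).norm_sq.intervalIntegrable _ _)
    (((hx.sub hy).norm_sq.intervalIntegrable _ _).const_mul _) fun s _ => ?_
  rw [← mul_pow]
  refine pow_le_pow_left₀ (norm_nonneg _) ?_ 2
  refine (norm_B_self_sub_le m _ _).trans ?_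
  rw [add_sub_add_right_eq_sub]
  have h1 : ‖x s + V s‖ ≤ M + N := (norm_add_le _ _).trans (add_le_add (hxM s) (hN s))
  have h2 : ‖y s + V s‖ ≤ M + N := (norm_add_le _ _).trans (add_le_add (hyM s) (hN s))
  refine mul_le_mul_of_nonneg_right ?_ (norm_nonneg _)
  calc 2 * algConst m * (‖x s + V s‖ + ‖y s + V s‖)
      ≤ 2 * algConst m * ((M + N) + (M + N)) := by gcongr
    _ = _ := by ring

/-- Global solvability of the equation with truncated nonlinearity. -/
theorem exists_truncated_solution {ν T R : ℝ} (hν : 0 < ν) (hT : 0 < T) (hR : 0 < R) (m : ℕ)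
    {V : ℝ → L2} (hV : BddRightCont V) :
    ∃ x : ℝ → L2, Continuous x ∧ BddRightCont x ∧
      ∀ t ∈ Icc 0 T, x t = sol ν (sqAdd m V fun s => cutoff R (x s) • x s) t := by
  obtain ⟨N, hN⟩ := hV.bdd
  have hcut : Continuous fun x : L2 => cutoff R x • x := (continuous_cutoff hR).smul continuous_id
  have hext : ∀ w : C(Icc (0 : ℝ) T, L2), Continuous (IccExtend hT.le w) := fun w =>
    w.continuous.Icc_extend'
  have hreg : ∀ w : C(Icc (0 : ℝ) T, L2),
      BddRightCont fun s => cutoff R (IccExtend hT.le w s) • IccExtend hT.le w s := fun w =>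
    ⟨(hcut.comp (hext w)).rightCont, R, fun s => norm_cutoff_smul_le hR _⟩
  let Φ : C(Icc (0 : ℝ) T, L2) → C(Icc (0 : ℝ) T, L2) := fun w =>
    ⟨(Icc 0 T).domRestrict (sol ν (sqAdd m V fun s =>
        cutoff R (IccExtend hT.le w s) • IccExtend hT.le w s)),
      (continuousOn_sol hν (hV.sqAdd (hreg w) m) T).domRestrict⟩
  obtain ⟨w, hw⟩ := exists_fixedPoint_of_volterra hT.le
    -- The last factor 4 is the square of the Lipschitz constant 2 of the truncation.
    (L := (4 * ν)⁻¹ * (4 * algConst m * (R + N)) ^ 2 * 4) (by positivity) Φ (by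
      intro w w' t ht
      refine (norm_sol_sq_sub_le hν hV (hreg w) (hreg w') hN
        (fun s => norm_cutoff_smul_le hR _) (fun s => norm_cutoff_smul_le hR _) ht.1).trans ?_
      rw [mul_assoc _ (4 : ℝ), ← intervalIntegral.integral_const_mul (4 : ℝ)]
      refine mul_le_mul_of_nonneg_left ?_ (by positivity)
      have hcw := hext w
      have hcw' := hext w'
      refine intervalIntegral.integral_mono_on ht.1
        (((hreg w).sub (hreg w')).norm_sq.intervalIntegrable _ _)
        (Continuous.intervalIntegrable (by fun_prop) _ _) fun s _ => ?_
      refine (pow_le_pow_left₀ (norm_nonneg _) (norm_cutoff_smul_sub_le hR _ _) 2).trans_eq ?_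
      ring)
  refine ⟨IccExtend hT.le w, hext w, ⟨(hext w).rightCont, ‖w‖, fun t => ?_⟩, fun t ht => ?_⟩
  · exact w.norm_coe_le_norm _
  · have := congrArg (fun u : C(Icc (0 : ℝ) T, L2) => u ⟨t, ht⟩) hw
    rw [IccExtend_of_mem _ _ ht]
    exact this.symm

end Burgers

/-! ### A priori bounds independent of the truncation. -/

namespace Burgers

open ComplexConjugate

theorem kap_mul_norm_coef_J_succ_le (m : ℕ) (x : L2) (k : ℤ) :
    kap k * ‖coef (J (m + 1) x) k‖ ≤ ‖coef (J m x) k‖ := by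
  rw [norm_coef_J, norm_coef_J, pow_succ']
  have h0 := inv_nonneg.2 (kap_nonneg k)
  have h : 0 ≤ (kap k)⁻¹ ^ m * ‖coef x k‖ := by positivity
  calc kap k * ((kap k)⁻¹ * (kap k)⁻¹ ^ m * ‖coef x k‖)
      = (kap k * (kap k)⁻¹) * ((kap k)⁻¹ ^ m * ‖coef x k‖) := by ring
    _ ≤ 1 * ((kap k)⁻¹ ^ m * ‖coef x k‖) := mul_le_mul_of_nonneg_right mul_inv_le_one h
    _ = _ := one_mul _

theorem kap_mul_norm_coef_J_succ (m : ℕ) {x : L2} (hx : coef x 0 = 0) (k : ℤ) :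
    kap k * ‖coef (J (m + 1) x) k‖ = ‖coef (J m x) k‖ := by
  rcases eq_or_ne k 0 with rfl | hk
  · simp [norm_coef_J, hx]
  · rw [norm_coef_J, norm_coef_J, pow_succ']
    have := (kap_pos hk).ne'
    field_simp

theorem forcing_smul (c : ℝ) (F : L2) (k : ℤ) : forcing (c • F) k = c * forcing F k := by
  simp only [forcing, coef_smul]; ring

/-- The real part of the cancellation identity multiplied by -2πci. The factor c stands for the
squared cutoff, a scalar at each time, so truncation does not spoil the cancellation. -/
theorem hasSum_inner_forcing (m : ℕ) (c : ℝ) (x : L2) :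
    HasSum (fun k => 2 * inner ℝ (coef (J (m + 1) x) k)
      (forcing (c • J (m + 1) (B m x x)) k)) 0 := by
  have h := (hasSum_mul_cv_self m x).mul_left (-(2 * c * Real.pi : ℝ) * Complex.I)
  rw [mul_zero] at h
  have h2 := Complex.reCLM.hasSum h
  rw [map_zero] at h2
  convert h2 using 2 with k
  rcases eq_or_ne k 0 with rfl | hk
  · simp
  rw [Complex.inner, forcing_smul, forcing, coef_J_B x x hk, Complex.reCLM_apply,
    ← Complex.re_ofReal_mul]
  congr 1
  push_cast
  ring

/-- The majorant for exchanging the sum over modes with the time integral. The derivative is moved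
onto w, where it turns `J (m + 1)` into `J m`. -/
theorem abs_inner_forcing_le (m : ℕ) {c : ℝ} (hc0 : 0 ≤ c) (hc1 : c ≤ 1) (x : L2) (k : ℤ) :
    ‖2 * inner ℝ (coef (J (m + 1) x) k) (forcing (c • J (m + 1) (B m x x)) k)‖ ≤
      ‖coef (J m x) k‖ ^ 2 + ‖coef (J (m + 1) (B m x x)) k‖ ^ 2 := by
  set w := coef (J (m + 1) x) k
  set q := coef (J (m + 1) (B m x x)) k
  have h1 : ‖inner ℝ w (forcing (c • J (m + 1) (B m x x)) k)‖ ≤ ‖w‖ * (c * (kap k / 2 * ‖q‖)) := by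
    refine (norm_inner_le_norm _ _).trans_eq ?_
    rw [forcing_smul, norm_mul, norm_forcing, Complex.norm_real, Real.norm_of_nonneg hc0]
  have h2 : kap k * ‖w‖ ≤ ‖coef (J m x) k‖ := kap_mul_norm_coef_J_succ_le m x k
  have h3 : 0 ≤ kap k * ‖w‖ * ‖q‖ :=
    mul_nonneg (mul_nonneg (kap_nonneg k) (norm_nonneg _)) (norm_nonneg _)
  rw [norm_mul, Real.norm_two]
  calc 2 * ‖inner ℝ w (forcing (c • J (m + 1) (B m x x)) k)‖
      ≤ 2 * (‖w‖ * (c * (kap k / 2 * ‖q‖))) := by gcongr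
    _ = c * (kap k * ‖w‖ * ‖q‖) := by ring
    _ ≤ kap k * ‖w‖ * ‖q‖ := mul_le_of_le_one_left h3 hc1
    _ ≤ ‖coef (J m x) k‖ * ‖q‖ := mul_le_mul_of_nonneg_right h2 (norm_nonneg _)
    _ ≤ _ := by nlinarith [sq_nonneg (‖coef (J m x) k‖ - ‖q‖), sq_nonneg (‖coef (J m x) k‖),
        sq_nonneg ‖q‖]

theorem hasSum_integral_inner_forcing (m : ℕ) {c : ℝ → ℝ} (hc : BddRightCont c)
    (hc0 : ∀ s, 0 ≤ c s) (hc1 : ∀ s, c s ≤ 1) {x : ℝ → L2} (hx : BddRightCont x) (t : ℝ) :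
    HasSum (fun k => ∫ s in (0 : ℝ)..t, 2 * inner ℝ (coef (J (m + 1) (x s)) k)
      (forcing (c s • J (m + 1) (B m (x s) (x s))) k)) 0 := by
  have hq : BddRightCont fun s => J (m + 1) (B m (x s) (x s)) := (hx.B_self m).J (m + 1)
  have hsum : ∀ s, HasSum (fun k => ‖coef (J m (x s)) k‖ ^ 2 +
      ‖coef (J (m + 1) (B m (x s) (x s))) k‖ ^ 2)
      (‖J m (x s)‖ ^ 2 + ‖J (m + 1) (B m (x s) (x s))‖ ^ 2) := fun s =>
    (hasSum_sq_coef _).add (hasSum_sq_coef _)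
  have := intervalIntegral.hasSum_integral_of_dominated_convergence (μ := volume) (a := 0) (b := t)
    (F := fun (k : ℤ) (s : ℝ) => 2 * inner ℝ (coef (J (m + 1) (x s)) k)
      (forcing (c s • J (m + 1) (B m (x s) (x s))) k)) (f := fun _ => (0 : ℝ))
    (fun k s => ‖coef (J m (x s)) k‖ ^ 2 + ‖coef (J (m + 1) (B m (x s) (x s))) k‖ ^ 2)
    (fun k => by
      have h1 := ((hx.J (m + 1)).coef k).rightCont.stronglyMeasurable.aestronglyMeasurable
        (μ := volume.restrict (uIoc 0 t))
      have h2 := ((hc.smul hq).forcing k).rightCont.stronglyMeasurable.aestronglyMeasurable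
        (μ := volume.restrict (uIoc 0 t))
      exact (h1.inner h2).const_mul 2)
    (fun k => .of_forall fun s _ => abs_inner_forcing_le m (hc0 s) (hc1 s) (x s) k)
    (.of_forall fun s _ => (hsum s).summable)
    (by
      simp_rw [fun s => (hsum s).tsum_eq]
      exact ((hx.J m).norm_sq.add hq.norm_sq).intervalIntegrable _ _)
    (.of_forall fun s _ => hasSum_inner_forcing m (c s) (x s))
  simpa using this

theorem mode_J (ν : ℝ) (n : ℕ) (f : ℝ → L2) (k : ℤ) (t : ℝ) :
    mode ν (fun s => J n (f s)) k t = (((kap k)⁻¹ ^ n : ℝ) : ℂ) * mode ν f k t := by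
  have : ∀ s, forcing (J n (f s)) k = (((kap k)⁻¹ ^ n : ℝ) : ℂ) * forcing (f s) k := fun s => by
    simp only [forcing, coef_J]; ring
  simp only [mode, duh, this, Complex.real_smul, mul_left_comm _ (((kap k)⁻¹ ^ n : ℝ) : ℂ),
    intervalIntegral.integral_const_mul]

theorem mode_index_zero (ν : ℝ) (f : ℝ → L2) (t : ℝ) : mode ν f 0 t = 0 := by
  simp [mode, duh]

theorem BddRightCont.of_eq {E : Type*} [NormedAddCommGroup E] {f g : ℝ → E}
    (hf : BddRightCont f) (h : ∀ t, g t = f t) : BddRightCont g := by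
  rwa [funext h]

/-- `x` solves on `[0,T]` the equation with truncated nonlinearity. -/
structure IsTruncated (m : ℕ) (ν T R : ℝ) (V x : ℝ → L2) : Prop where
  cont : Continuous x
  bdd : BddRightCont x
  eq : ∀ t ∈ Icc 0 T, x t = sol ν (sqAdd m V fun s => cutoff R (x s) • x s) t

section apriori

variable {m : ℕ} {ν T R N : ℝ} {V x : ℝ → L2}

theorem IsTruncated.bddRightCont_cutoff (h : IsTruncated m ν T R V x) (hR : 0 < R) :
    BddRightCont fun s => cutoff R (x s) :=
  ⟨((continuous_cutoff hR).comp h.cont).rightCont, 1, fun s => by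
    rw [Real.norm_of_nonneg (cutoff_nonneg hR _)]; exact cutoff_le_one hR _⟩

theorem IsTruncated.bddRightCont_sqAdd (h : IsTruncated m ν T R V x) (hR : 0 < R)
    (hV : BddRightCont V) : BddRightCont (sqAdd m V fun s => cutoff R (x s) • x s) :=
  hV.sqAdd ((h.bddRightCont_cutoff hR).smul h.bdd) m

theorem IsTruncated.coef_eq (h : IsTruncated m ν T R V x) (hν : 0 < ν) (hR : 0 < R)
    (hV : BddRightCont V) {t : ℝ} (ht : t ∈ Icc 0 T) (k : ℤ) :
    coef (x t) k = mode ν (sqAdd m V fun s => cutoff R (x s) • x s) k t := by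
  rw [h.eq t ht, coef_sol hν (h.bddRightCont_sqAdd hR hV) ht.1]

/-- Isolates the part quadratic in a, which does no work in the L² energy; the rest is affine in a.
-/
theorem sqAdd_smul_eq (θ : ℝ) (a v : L2) :
    B m (θ • a + v) (θ • a + v) = θ ^ 2 • B m a a + ((2 * θ) • B m a v + B m v v) := by
  simp only [B_add_left, B_add_right, B_smul_left, B_smul_right, B_comm m v a]
  module

theorem norm_J_cross_le {θ : ℝ} (h0 : 0 ≤ θ) (h1 : θ ≤ 1) (a : L2) {v : L2} (hv : ‖v‖ ≤ N) :
    ‖J (m + 1) ((2 * θ) • B m a v + B m v v)‖ ^ 2 ≤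
      5 * (embConst * N) ^ 2 * (‖J (m + 1) a‖ ^ 2 + N ^ 2) := by
  have hN : 0 ≤ N := (norm_nonneg _).trans hv
  have he := embConst_nonneg
  have hJ : ‖J m v‖ ≤ N := (norm_J_le m v).trans hv
  have hJ' : ‖J (m + 1) v‖ ≤ N := (norm_J_le _ v).trans hv
  have e1 : ‖J (m + 1) (B m a v)‖ ≤ embConst * N * ‖J (m + 1) a‖ :=
    (norm_J_B_le m a v).trans (by gcongr)
  have e2 : ‖J (m + 1) (B m v v)‖ ≤ embConst * N * N :=
    (norm_J_B_le m v v).trans (by gcongr)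
  have e3 : ‖J (m + 1) ((2 * θ) • B m a v + B m v v)‖ ≤
      embConst * N * (2 * ‖J (m + 1) a‖ + N) := by
    rw [J_add, J_smul]
    refine (norm_add_le _ _).trans ?_
    rw [norm_smul, Real.norm_of_nonneg (by positivity)]
    have : 2 * θ * ‖J (m + 1) (B m a v)‖ ≤ 2 * 1 * (embConst * N * ‖J (m + 1) a‖) := by gcongr
    linarith
  calc _ ≤ (embConst * N * (2 * ‖J (m + 1) a‖ + N)) ^ 2 := pow_le_pow_left₀ (norm_nonneg _) e3 2
    _ = (embConst * N) ^ 2 * (2 * ‖J (m + 1) a‖ + N) ^ 2 := by ring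
    -- Cauchy–Schwarz: (2p + N)² ≤ (2² + 1²)(p² + N²).
    _ ≤ (embConst * N) ^ 2 * (5 * (‖J (m + 1) a‖ ^ 2 + N ^ 2)) := by
        gcongr
        nlinarith [sq_nonneg (‖J (m + 1) a‖ - 2 * N)]
    _ = _ := by ring

/-- The L² energy inequality for w = `J (m + 1) x`, whose dissipation ‖w‖₁² is ‖`J m x`‖². Summing
over the modes removes the quadratic part, and only the affine part is paid for by Young's
inequality. R does not enter. -/
theorem IsTruncated.energy_zero (h : IsTruncated m ν T R V x) (hν : 0 < ν) (hR : 0 < R)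
    (hV : BddRightCont V) (hN : ∀ s, ‖V s‖ ≤ N) {t : ℝ} (ht : t ∈ Icc 0 T) :
    ‖J (m + 1) (x t)‖ ^ 2 + ν * ∫ s in (0 : ℝ)..t, ‖J m (x s)‖ ^ 2 ≤
      ∫ s in (0 : ℝ)..t, (4 * ν)⁻¹ * (5 * (embConst * N) ^ 2) *
        (‖J (m + 1) (x s)‖ ^ 2 + N ^ 2) := by
  set f := sqAdd m V fun s => cutoff R (x s) • x s with hf_def
  have hf : BddRightCont f := h.bddRightCont_sqAdd hR hV
  have hθ := h.bddRightCont_cutoff hR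
  have hθ2 : BddRightCont fun s => cutoff R (x s) ^ 2 :=
    (hθ.smul hθ).of_eq fun s => by rw [smul_eq_mul, pow_two]
  have hg : BddRightCont fun s => cutoff R (x s) ^ 2 • J (m + 1) (B m (x s) (x s)) :=
    hθ2.smul ((h.bdd.B_self m).J (m + 1))
  have hdec : ∀ s, J (m + 1) (f s) = cutoff R (x s) ^ 2 • J (m + 1) (B m (x s) (x s)) +
      J (m + 1) ((2 * cutoff R (x s)) • B m (x s) (V s) + B m (V s) (V s)) := fun s => by
    rw [hf_def, sqAdd, sqAdd_smul_eq, J_add, J_smul]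
  have hh : BddRightCont fun s =>
      J (m + 1) ((2 * cutoff R (x s)) • B m (x s) (V s) + B m (V s) (V s)) :=
    ((hf.J (m + 1)).sub hg).of_eq fun s => by rw [hdec s, add_sub_cancel_left]
  have hen := fun k => mode_energy hν (hf.J (m + 1)) hg hh hdec k ht.1
  have hmode : ∀ k, ∀ s ∈ Icc 0 T,
      mode ν (fun s => J (m + 1) (f s)) k s = coef (J (m + 1) (x s)) k := fun k s hs => by
    rw [mode_J, coef_J, h.coef_eq hν hR hV hs]
  have hz : ∀ s ∈ Icc 0 T, coef (x s) 0 = 0 := fun s hs => by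
    rw [h.coef_eq hν hR hV hs, mode_index_zero]
  have hsub : ∀ s ∈ uIcc 0 t, s ∈ Icc 0 T := fun s hs => by
    rw [uIcc_of_le ht.1] at hs; exact ⟨hs.1, hs.2.trans ht.2⟩
  have hen' : ∀ k, ‖coef (J (m + 1) (x t)) k‖ ^ 2 +
      ν * ∫ s in (0 : ℝ)..t, ‖coef (J m (x s)) k‖ ^ 2 ≤
      (∫ s in (0 : ℝ)..t, 2 * inner ℝ (coef (J (m + 1) (x s)) k)
        (forcing (cutoff R (x s) ^ 2 • J (m + 1) (B m (x s) (x s))) k)) +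
      (4 * ν)⁻¹ * ∫ s in (0 : ℝ)..t, ‖coef (J (m + 1)
        ((2 * cutoff R (x s)) • B m (x s) (V s) + B m (V s) (V s))) k‖ ^ 2 := by
    intro k
    have h1 := hen k
    rw [hmode k t ht, intervalIntegral.integral_congr (g := fun s => ‖coef (J m (x s)) k‖ ^ 2)
      fun s hs => by
        simp only [hmode k s (hsub s hs), kap_mul_norm_coef_J_succ m (hz s (hsub s hs))]] at h1
    refine h1.trans_eq ?_
    congr 1
    refine intervalIntegral.integral_congr fun s hs => ?_
    simp only [hmode k s (hsub s hs)]
  have hle := hasSum_le hen'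
    ((hasSum_sq_coef _).add ((hasSum_integral_coef_sq (h.bdd.J m) t).mul_left ν))
    ((hasSum_integral_inner_forcing m hθ2 (fun s => sq_nonneg _)
      (fun s => pow_le_one₀ (cutoff_nonneg hR _) (cutoff_le_one hR _)) h.bdd t).add
      ((hasSum_integral_coef_sq hh t).mul_left (4 * ν)⁻¹))
  rw [zero_add] at hle
  refine hle.trans ?_
  simp_rw [mul_assoc (4 * ν)⁻¹]
  rw [intervalIntegral.integral_const_mul]
  refine mul_le_mul_of_nonneg_left ?_ (by positivity)
  have hcx := h.cont
  have hcJ := continuous_J (m + 1)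
  refine intervalIntegral.integral_mono_on ht.1 (hh.norm_sq.intervalIntegrable _ _)
    (Continuous.intervalIntegrable (by fun_prop) _ _) fun s _ => ?_
  exact norm_J_cross_le (cutoff_nonneg hR _) (cutoff_le_one hR _) _ (hN s)

/-- The tame estimate for the square: linear in ‖a‖², with a coefficient involving only the norm
already controlled by the L² energy. -/
theorem norm_B_add_sq_le {θ : ℝ} (h0 : 0 ≤ θ) (h1 : θ ≤ 1) (a : L2) {v : L2} (hv : ‖v‖ ≤ N) :
    ‖B m (θ • a + v) (θ • a + v)‖ ^ 2 ≤
      8 * algConst m ^ 2 * (‖J m a‖ ^ 2 + N ^ 2) * (‖a‖ ^ 2 + N ^ 2) := by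
  have hN : 0 ≤ N := (norm_nonneg _).trans hv
  have hle : ∀ {b w : L2}, ‖w‖ ≤ N → ‖θ • b + w‖ ^ 2 ≤ 2 * (‖b‖ ^ 2 + N ^ 2) := by
    intro b w hw
    have e : ‖θ • b + w‖ ≤ ‖b‖ + N := by
      refine (norm_add_le _ _).trans ?_
      rw [norm_smul, Real.norm_of_nonneg h0]
      exact add_le_add (mul_le_of_le_one_left (norm_nonneg _) h1) hw
    calc _ ≤ (‖b‖ + N) ^ 2 := pow_le_pow_left₀ (norm_nonneg _) e 2
      _ ≤ _ := by nlinarith [sq_nonneg (‖b‖ - N)]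
  have e1 := hle (b := a) hv
  have e2 : ‖J m (θ • a + v)‖ ^ 2 ≤ 2 * (‖J m a‖ ^ 2 + N ^ 2) := by
    rw [J_add, J_smul]; exact hle ((norm_J_le m v).trans hv)
  calc _ ≤ algConst m ^ 2 * (‖θ • a + v‖ ^ 2 * ‖J m (θ • a + v)‖ ^ 2 +
        ‖J m (θ • a + v)‖ ^ 2 * ‖θ • a + v‖ ^ 2) := norm_B_sq_le m _ _
    _ = 2 * algConst m ^ 2 * (‖J m (θ • a + v)‖ ^ 2 * ‖θ • a + v‖ ^ 2) := by ring
    _ ≤ 2 * algConst m ^ 2 * ((2 * (‖J m a‖ ^ 2 + N ^ 2)) * (2 * (‖a‖ ^ 2 + N ^ 2))) := by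
        gcongr
    _ = _ := by ring

/-- The energy inequality at the level of Hⁿ, where no cancellation is used. It is stated for finite
sets of modes because summability of the dissipation is not yet known. -/
theorem IsTruncated.energy (h : IsTruncated m ν T R V x) (hν : 0 < ν) (hR : 0 < R)
    (hV : BddRightCont V) (hN : ∀ s, ‖V s‖ ≤ N) {t : ℝ} (ht : t ∈ Icc 0 T) (S : Finset ℤ) :
    ∑ k ∈ S, (‖coef (x t) k‖ ^ 2 + ν * ∫ s in (0 : ℝ)..t, (kap k * ‖coef (x s) k‖) ^ 2) ≤
      ∫ s in (0 : ℝ)..t, ((4 * ν)⁻¹ * (8 * algConst m ^ 2) * (‖J m (x s)‖ ^ 2 + N ^ 2)) *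
        (‖x s‖ ^ 2 + N ^ 2) := by
  set f := sqAdd m V fun s => cutoff R (x s) • x s with hf_def
  have hf : BddRightCont f := h.bddRightCont_sqAdd hR hV
  have hsub : ∀ s ∈ uIcc 0 t, s ∈ Icc 0 T := fun s hs => by
    rw [uIcc_of_le ht.1] at hs; exact ⟨hs.1, hs.2.trans ht.2⟩
  have h1 : ∀ k, ‖coef (x t) k‖ ^ 2 + ν * ∫ s in (0 : ℝ)..t, (kap k * ‖coef (x s) k‖) ^ 2 ≤
      (4 * ν)⁻¹ * ∫ s in (0 : ℝ)..t, ‖coef (f s) k‖ ^ 2 := fun k => by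
    rw [h.coef_eq hν hR hV ht, intervalIntegral.integral_congr
      (g := fun s => (kap k * ‖mode ν f k s‖) ^ 2)
      fun s hs => by simp only [h.coef_eq hν hR hV (hsub s hs), hf_def]]
    exact mode_energy_le hν hf k ht.1
  have hs := (hasSum_integral_coef_sq hf t).mul_left (4 * ν)⁻¹
  refine (Finset.sum_le_sum fun k _ => h1 k).trans ?_
  refine (sum_le_hasSum S (fun k _ => mul_nonneg (by positivity)
    (intervalIntegral.integral_nonneg ht.1 fun s _ => by positivity)) hs).trans ?_
  simp_rw [mul_assoc (4 * ν)⁻¹]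
  rw [intervalIntegral.integral_const_mul]
  refine mul_le_mul_of_nonneg_left ?_ (by positivity)
  have hcx := h.cont
  have hcJ := continuous_J m
  refine intervalIntegral.integral_mono_on ht.1 (hf.norm_sq.intervalIntegrable _ _)
    (Continuous.intervalIntegrable (by fun_prop) _ _) fun s _ => ?_
  exact norm_B_add_sq_le (cutoff_nonneg hR _) (cutoff_le_one hR _) _ (hN s)

end apriori

/-- A bound in `L²([0,T]; H¹)` for the truncated equation that does not depend on the
truncation. -/
theorem exists_integral_bound (m : ℕ) {ν T : ℝ} (hν : 0 < ν) (hT : 0 < T) (N : ℝ) :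
    ∃ K : ℝ, 0 ≤ K ∧ ∀ (R : ℝ) (V x : ℝ → L2), 0 < R → BddRightCont V → (∀ s, ‖V s‖ ≤ N) →
      IsTruncated m ν T R V x → ∫ s in (0 : ℝ)..T, ‖J m (x s)‖ ^ 2 ≤ K := by
  obtain ⟨a, ha⟩ : ∃ a, a = (4 * ν)⁻¹ * (5 * (embConst * N) ^ 2) := ⟨_, rfl⟩
  have ha0 : 0 ≤ a := by rw [ha]; positivity
  -- Gronwall's bound inserted in the right-hand side of the energy inequality at time T.
  refine ⟨T * (a * (N ^ 2 * Real.exp (T * a))) / ν, by positivity, fun R V x hR hV hN h => ?_⟩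
  have hcx := h.cont
  have hcJ := continuous_J (m + 1)
  have hcy : Continuous fun t => ‖J (m + 1) (x t)‖ ^ 2 := by fun_prop
  have hen := fun t (ht : t ∈ Icc 0 T) => h.energy_zero hν hR hV hN ht
  rw [← ha] at hen
  have hI : ∀ t ∈ Icc 0 T, 0 ≤ ν * ∫ s in (0 : ℝ)..t, ‖J m (x s)‖ ^ 2 := fun t ht =>
    mul_nonneg hν.le (intervalIntegral.integral_nonneg ht.1 fun s _ => by positivity)
  have hz : ∀ t ∈ Icc 0 T, ‖J (m + 1) (x t)‖ ^ 2 + N ^ 2 ≤ N ^ 2 * Real.exp (T * a) := by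
    intro t ht
    have := add_le_mul_exp_of_le_integral (a := fun _ => a)
      (y := fun t => ‖J (m + 1) (x t)‖ ^ 2) (b := N ^ 2) (T := T) continuous_const hcy
      (fun _ => ha0) (fun t ht => by linarith [hI t ht, hen t ht]) t ht
    refine this.trans ?_
    rw [intervalIntegral.integral_const, smul_eq_mul, sub_zero]
    gcongr
    exact ht.2
  have hTT : T ∈ Icc 0 T := ⟨hT.le, le_rfl⟩
  have h1 := hen T hTT
  have h2 : ∫ s in (0 : ℝ)..T, a * (‖J (m + 1) (x s)‖ ^ 2 + N ^ 2) ≤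
      ∫ s in (0 : ℝ)..T, a * (N ^ 2 * Real.exp (T * a)) :=
    intervalIntegral.integral_mono_on hT.le
      ((continuous_const.mul (hcy.add continuous_const)).intervalIntegrable _ _)
      (continuous_const.intervalIntegrable _ _) fun s hs =>
      mul_le_mul_of_nonneg_left (hz s hs) ha0
  rw [intervalIntegral.integral_const, smul_eq_mul, sub_zero] at h2
  rw [le_div_iff₀ hν, mul_comm]
  linarith [sq_nonneg ‖J (m + 1) (x T)‖]

/-- Bounds for the truncated equation that do not depend on the truncation. -/
theorem exists_apriori_bound (m : ℕ) {ν T : ℝ} (hν : 0 < ν) (hT : 0 < T) (N : ℝ) :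
    ∃ K : ℝ, ∀ (R : ℝ) (V x : ℝ → L2), 0 < R → BddRightCont V → (∀ s, ‖V s‖ ≤ N) →
      IsTruncated m ν T R V x → (∀ t ∈ Icc 0 T, ‖x t‖ ^ 2 ≤ K) ∧
        ∀ S : Finset ℤ, ∑ k ∈ S, ∫ s in (0 : ℝ)..T, (kap k * ‖coef (x s) k‖) ^ 2 ≤ K := by
  obtain ⟨K₀, hK₀0, hK₀⟩ := exists_integral_bound m hν hT N
  obtain ⟨b, hb⟩ : ∃ b, b = (4 * ν)⁻¹ * (8 * algConst m ^ 2) := ⟨_, rfl⟩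
  have hb0 : 0 ≤ b := by rw [hb]; positivity
  -- A bounds the integral of the Gronwall weight b (‖w‖₁² + N²), by the L² energy bound K₀.
  obtain ⟨A, hA⟩ : ∃ A, A = b * (K₀ + T * N ^ 2) := ⟨_, rfl⟩
  have hA0 : 0 ≤ A := by rw [hA]; positivity
  obtain ⟨K₁, hK₁⟩ : ∃ K, K = N ^ 2 * Real.exp A := ⟨_, rfl⟩
  have hK₁0 : 0 ≤ K₁ := by rw [hK₁]; positivity
  -- K₁ bounds the norm and A K₁ / ν the dissipation; both are nonnegative, so their sum serves for
  -- both.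
  refine ⟨K₁ + A * K₁ / ν, fun R V x hR hV hN h => ?_⟩
  have hK := hK₀ R V x hR hV hN h
  have hcx := h.cont
  have hcJ := continuous_J m
  have hcy : Continuous fun t => ‖x t‖ ^ 2 := by fun_prop
  have hcz : Continuous fun t => ‖J m (x t)‖ ^ 2 := by fun_prop
  have hen := fun t (ht : t ∈ Icc 0 T) => h.energy hν hR hV hN ht
  rw [← hb] at hen
  obtain ⟨a, ha⟩ : ∃ a : ℝ → ℝ, a = fun s => b * (‖J m (x s)‖ ^ 2 + N ^ 2) := ⟨_, rfl⟩
  have has : ∀ s, b * (‖J m (x s)‖ ^ 2 + N ^ 2) = a s := fun s => by rw [ha]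
  simp only [has] at hen
  have hac : Continuous a := by rw [ha]; exact continuous_const.mul (hcz.add continuous_const)
  have ha0 : ∀ s, 0 ≤ a s := fun s => by rw [ha]; positivity
  have hI : ∀ t ∈ Icc 0 T, ∀ k, 0 ≤ ν * ∫ s in (0 : ℝ)..t, (kap k * ‖coef (x s) k‖) ^ 2 :=
    fun t ht k => mul_nonneg hν.le
      (intervalIntegral.integral_nonneg ht.1 fun s _ => by positivity)
  have hAle : ∀ t ∈ Icc 0 T, ∫ s in (0 : ℝ)..t, a s ≤ A := by
    intro t ht
    calc ∫ s in (0 : ℝ)..t, a s ≤ ∫ s in (0 : ℝ)..T, a s :=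
          intervalIntegral.integral_mono_interval le_rfl ht.1 ht.2 (.of_forall ha0)
            (hac.intervalIntegrable _ _)
      _ = b * ((∫ s in (0 : ℝ)..T, ‖J m (x s)‖ ^ 2) + T * N ^ 2) := by
          rw [ha, intervalIntegral.integral_const_mul, intervalIntegral.integral_add
            (hcz.intervalIntegrable _ _) (continuous_const.intervalIntegrable _ _),
            intervalIntegral.integral_const, smul_eq_mul, sub_zero]
      _ ≤ A := by rw [hA]; gcongr
  have hnorm : ∀ t ∈ Icc 0 T, ‖x t‖ ^ 2 ≤ ∫ s in (0 : ℝ)..t, a s * (‖x s‖ ^ 2 + N ^ 2) := by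
    intro t ht
    refine hasSum_le_of_sum_le (hasSum_sq_coef (x t)) fun S => ?_
    exact le_trans (Finset.sum_le_sum fun k _ => by linarith [hI t ht k]) (hen t ht S)
  have hx : ∀ t ∈ Icc 0 T, ‖x t‖ ^ 2 + N ^ 2 ≤ K₁ := by
    intro t ht
    refine (add_le_mul_exp_of_le_integral hac hcy ha0 hnorm t ht).trans ?_
    rw [hK₁]
    gcongr
    exact hAle t ht
  have hpos : 0 ≤ A * K₁ / ν := by positivity
  refine ⟨fun t ht => by linarith [hx t ht, sq_nonneg N], fun S => ?_⟩
  have hTT : T ∈ Icc 0 T := ⟨hT.le, le_rfl⟩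
  have h1 : ∫ s in (0 : ℝ)..T, a s * (‖x s‖ ^ 2 + N ^ 2) ≤ A * K₁ := by
    calc _ ≤ ∫ s in (0 : ℝ)..T, a s * K₁ :=
          intervalIntegral.integral_mono_on hT.le
            ((hac.mul (hcy.add continuous_const)).intervalIntegrable _ _)
            ((hac.mul continuous_const).intervalIntegrable _ _) fun s hs =>
            mul_le_mul_of_nonneg_left (hx s hs) (ha0 s)
      _ = (∫ s in (0 : ℝ)..T, a s) * K₁ := by rw [intervalIntegral.integral_mul_const]
      _ ≤ _ := mul_le_mul_of_nonneg_right (hAle T hTT) hK₁0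
  have h3 : ν * ∑ k ∈ S, ∫ s in (0 : ℝ)..T, (kap k * ‖coef (x s) k‖) ^ 2 ≤ A * K₁ := by
    rw [Finset.mul_sum]
    refine le_trans (Finset.sum_le_sum fun k _ => ?_) ((hen T hTT S).trans h1)
    linarith [sq_nonneg ‖coef (x T) k‖]
  have h4 : ∑ k ∈ S, ∫ s in (0 : ℝ)..T, (kap k * ‖coef (x s) k‖) ^ 2 ≤ A * K₁ / ν := by
    rw [le_div_iff₀ hν, mul_comm]; exact h3
  linarith

/-- Only the open interval matters. In particular the value at time t itself is irrelevant, which is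
used at t = T. -/
theorem mode_congr {ν : ℝ} {f g : ℝ → L2} {t : ℝ} (ht : 0 ≤ t)
    (h : ∀ s ∈ Ioo 0 t, f s = g s) (k : ℤ) : mode ν f k t = mode ν g k t := by
  rw [mode, mode, duh, duh]
  congr 1
  refine intervalIntegral.integral_congr_Ioo_of_le ht fun s hs => ?_
  simp only [h s hs]

theorem sol_congr {ν : ℝ} {f g : ℝ → L2} {t : ℝ} (ht : 0 ≤ t)
    (h : ∀ s ∈ Ioo 0 t, f s = g s) : sol ν f t = sol ν g t := by
  rw [sol, sol, funext (mode_congr ht h)]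

/-- Global solvability in the coordinates of `Hⁿ`, `n = m + 1`, with bounds. -/
theorem exists_mild_solution (m : ℕ) {ν T : ℝ} (hν : 0 < ν) (hT : 0 < T) (N : ℝ) :
    ∃ K : ℝ, ∀ V : ℝ → L2, BddRightCont V → (∀ s, ‖V s‖ ≤ N) →
      ∃ x : ℝ → L2, Continuous x ∧ BddRightCont x ∧
        (∀ t ∈ Icc 0 T, x t = sol ν (sqAdd m V x) t) ∧ (∀ t ∈ Icc 0 T, ‖x t‖ ^ 2 ≤ K) ∧
        ∀ S : Finset ℤ, ∑ k ∈ S, ∫ s in (0 : ℝ)..T, (kap k * ‖coef (x s) k‖) ^ 2 ≤ K := by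
  obtain ⟨K, hK⟩ := exists_apriori_bound m hν hT N
  refine ⟨K, fun V hV hN => ?_⟩
  -- Then K ≤ (|K| + 1)², so the bound ‖x‖² ≤ K keeps x in the ball where the cutoff is 1.
  have hR : 0 < |K| + 1 := by positivity
  obtain ⟨x, hc, hb, heq⟩ := exists_truncated_solution hν hT hR m hV
  obtain ⟨h1, h2⟩ := hK _ V x hR hV hN ⟨hc, hb, heq⟩
  refine ⟨x, hc, hb, fun t ht => ?_, h1, h2⟩
  have hcut : ∀ s ∈ Icc 0 T, cutoff (|K| + 1) (x s) • x s = x s := by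
    intro s hs
    rw [cutoff_eq_one hR, one_smul]
    refine (pow_le_pow_iff_left₀ (norm_nonneg _) hR.le two_ne_zero).1 ?_
    have := h1 s hs
    nlinarith [le_abs_self K, abs_nonneg K]
  rw [heq t ht]
  refine sol_congr ht.1 fun s hs => ?_
  rw [sqAdd, sqAdd, hcut s ⟨hs.1.le, hs.2.le.trans ht.2⟩]

end Burgers

/-! ### Fourier series of test functions. -/

namespace Burgers

open ComplexConjugate

theorem intervalIntegrable_coe {F : UnitAddCircle → ℝ} (hF : Integrable F) :
    IntervalIntegrable (fun x : ℝ => F x) volume 0 1 := by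
  have h := (UnitAddCircle.measurePreserving_mk 0).integrable_comp_of_integrable hF
  rw [zero_add] at h
  rwa [intervalIntegrable_iff_integrableOn_Ioc_of_le zero_le_one]

theorem continuous_fourier_coe (k : ℤ) :
    Continuous fun x : ℝ => fourier k (x : UnitAddCircle) :=
  (fourier k).continuous.comp (AddCircle.continuous_mk' 1)

/-- The Fourier coefficients of a function of period one. -/
noncomputable def pc (ψ : ℝ → ℝ) (k : ℤ) : ℂ :=
  ∫ x in (0 : ℝ)..1, fourier (-k) (x : UnitAddCircle) * (ψ x : ℂ)

theorem norm_pc_le {ψ : ℝ → ℝ} (k : ℤ) :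
    ‖pc ψ k‖ ≤ ∫ x in (0 : ℝ)..1, |ψ x| := by
  refine (intervalIntegral.norm_integral_le_integral_norm zero_le_one).trans_eq ?_
  refine intervalIntegral.integral_congr fun x _ => ?_
  simp only [norm_mul, fourier_apply, Circle.norm_coe, one_mul, Complex.norm_real,
    Real.norm_eq_abs]

theorem pc_deriv {ψ : ℝ → ℝ} (hψ : ContDiff ℝ 1 ψ) (hp : Function.Periodic ψ 1) (k : ℤ) :
    pc (deriv ψ) k = 2 * Real.pi * Complex.I * k * pc ψ k := by
  have hd : ∀ x ∈ uIcc (0 : ℝ) 1, HasDerivAt (fun y => (ψ y : ℂ)) ((deriv ψ x : ℝ) : ℂ) x :=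
    fun x _ => ((hψ.differentiable one_ne_zero x).hasDerivAt).ofReal_comp
  have he : ∀ x ∈ uIcc (0 : ℝ) 1, HasDerivAt (fun y : ℝ => fourier (-k) (y : UnitAddCircle))
      (-2 * Real.pi * Complex.I * k / (1 : ℝ) * fourier (-k) (x : UnitAddCircle)) x := fun x _ =>
    hasDerivAt_fourier_neg 1 k x
  have hce := continuous_fourier_coe (-k)
  have hcd : Continuous (deriv ψ) := hψ.continuous_deriv le_rfl
  have h := intervalIntegral.integral_mul_deriv_eq_deriv_mul he hd
    (Continuous.intervalIntegrable (by fun_prop) _ _)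
    (Continuous.intervalIntegrable (by fun_prop) _ _)
  have h1 : ψ 1 = ψ 0 := by simpa using hp 0
  have h2 : ((1 : ℝ) : UnitAddCircle) = ((0 : ℝ) : UnitAddCircle) := by
    simp
  rw [h1, h2, sub_self, zero_sub] at h
  rw [pc, h, pc, ← intervalIntegral.integral_const_mul, ← intervalIntegral.integral_neg]
  refine intervalIntegral.integral_congr fun x _ => ?_
  simp only [Complex.ofReal_one, div_one]
  ring

theorem periodic_deriv {ψ : ℝ → ℝ} (hp : Function.Periodic ψ 1) :
    Function.Periodic (deriv ψ) 1 := fun x => by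
  rw [← deriv_comp_add_const, funext hp]

theorem pc_deriv_deriv {ψ : ℝ → ℝ} (hψ : ContDiff ℝ 2 ψ) (hp : Function.Periodic ψ 1) (k : ℤ) :
    pc (deriv (deriv ψ)) k = -((kap k ^ 2 : ℝ) : ℂ) * pc ψ k := by
  rw [pc_deriv ((contDiff_succ_iff_deriv (n := 1)).1 hψ).2.2 (periodic_deriv hp),
    pc_deriv (hψ.of_le one_le_two) hp, kap, mul_pow, sq_abs]
  push_cast
  linear_combination (4 * (Real.pi : ℂ) ^ 2 * k ^ 2 * pc ψ k) * Complex.I_sq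

/-- Two integrations by parts give decay of order k⁻². -/
theorem summable_pc {ψ : ℝ → ℝ} (hψ : ContDiff ℝ 2 ψ) (hp : Function.Periodic ψ 1) :
    Summable (pc ψ) := by
  refine Summable.of_norm_bounded_eventually (summable_inv_kap_sq.mul_left
    (∫ x in (0 : ℝ)..1, |deriv (deriv ψ) x|)) ?_
  filter_upwards [(finite_singleton (0 : ℤ)).compl_mem_cofinite] with k hk
  have h := norm_pc_le (ψ := deriv (deriv ψ)) k
  have hk' := kap_pos (show k ≠ 0 from hk)
  rw [pc_deriv_deriv hψ hp, norm_mul, norm_neg, Complex.norm_real,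
    Real.norm_of_nonneg (by positivity)] at h
  rw [inv_pow, ← div_eq_mul_inv, le_div_iff₀ (by positivity), mul_comm]
  exact h

theorem hasSum_pc {ψ : ℝ → ℝ} (hψ : ContDiff ℝ 2 ψ) (hp : Function.Periodic ψ 1) (x : ℝ) :
    HasSum (fun k => pc ψ k * fourier k (x : UnitAddCircle)) (ψ x : ℂ) := by
  have hp' : Function.Periodic (fun x => (ψ x : ℂ)) 1 := fun x => by simp [hp x]
  have hc : Continuous hp'.lift :=
    continuous_coinduced_dom.2 (Complex.continuous_ofReal.comp hψ.continuous)
  let f : C(UnitAddCircle, ℂ) := ⟨hp'.lift, hc⟩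
  have hf : ∀ k, fourierCoeff f k = pc ψ k := fun k => by
    rw [fourierCoeff_eq_intervalIntegral _ _ 0, pc]
    simp [f]
  have hs : Summable (fourierCoeff f) := by
    rw [funext hf]; exact summable_pc hψ hp
  have h := has_pointwise_sum_fourier_series_of_summable hs (x : UnitAddCircle)
  simp_rw [hf, smul_eq_mul] at h
  exact h

/-- Parseval's identity for an integrable function and a smooth one. -/
theorem hasSum_integral_mul {F : UnitAddCircle → ℝ} (hF : Integrable F) {ψ : ℝ → ℝ}
    (hψ : ContDiff ℝ 2 ψ) (hp : Function.Periodic ψ 1) :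
    HasSum (fun k => pc ψ k * conj (fourierCoeff (fun x : UnitAddCircle => (F x : ℂ)) k))
      ((∫ x in (0 : ℝ)..1, F x * ψ x : ℝ) : ℂ) := by
  have hFi := intervalIntegrable_coe hF
  have hm : AEStronglyMeasurable (fun x : ℝ => (F x : ℂ)) (volume.restrict (uIoc 0 1)) :=
    Complex.continuous_ofReal.comp_aestronglyMeasurable hFi.def'.aestronglyMeasurable
  have hs := (summable_pc hψ hp).norm
  have h := intervalIntegral.hasSum_integral_of_dominated_convergence (μ := volume) (a := 0)
    (b := 1) (F := fun (k : ℤ) (x : ℝ) => (F x : ℂ) * (pc ψ k * fourier k (x : UnitAddCircle)))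
    (f := fun x : ℝ => (F x : ℂ) * (ψ x : ℂ)) (fun k x => ‖pc ψ k‖ * ‖F x‖)
    (fun k => hm.mul (continuous_const.mul (continuous_fourier_coe k)).aestronglyMeasurable)
    (fun k => .of_forall fun x _ => by
      rw [norm_mul, norm_mul, fourier_apply, Circle.norm_coe, mul_one, Complex.norm_real,
        mul_comm])
    (.of_forall fun x _ => hs.mul_right _)
    (by simp_rw [tsum_mul_right]; exact hFi.norm.const_mul _)
    (.of_forall fun x _ => (hasSum_pc hψ hp x).mul_left _)
  simp_rw [← Complex.ofReal_mul] at h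
  rw [intervalIntegral.integral_ofReal] at h
  refine (funext fun k => ?_ : (fun k => pc ψ k * conj (fourierCoeff
    (fun x : UnitAddCircle => (F x : ℂ)) k)) = fun k => ∫ x in (0 : ℝ)..1,
      (F x : ℂ) * (pc ψ k * fourier k (x : UnitAddCircle))) ▸ h
  rw [← fourierCoeff_neg_index, fourierCoeff_eq_intervalIntegral _ _ 0, zero_add, neg_neg,
    div_one, one_smul, ← intervalIntegral.integral_const_mul]
  refine intervalIntegral.integral_congr fun x _ => ?_
  simp only [smul_eq_mul]
  ring

/-- Test functions are real, so a complex mode has to be recovered from two of them. -/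
theorem fourierCoeff_eq_cos_sub_sin {F : UnitAddCircle → ℝ} (hF : Integrable F) (k : ℤ) :
    fourierCoeff (fun x : UnitAddCircle => (F x : ℂ)) k =
      ((∫ x in (0 : ℝ)..1, F x * Real.cos (2 * Real.pi * k * x) : ℝ) : ℂ) -
        ((∫ x in (0 : ℝ)..1, F x * Real.sin (2 * Real.pi * k * x) : ℝ) : ℂ) * Complex.I := by
  have hFi := intervalIntegrable_coe hF
  have hc := hFi.mul_continuousOn (g := fun x => Real.cos (2 * Real.pi * k * x)) (by fun_prop)
  have hs := hFi.mul_continuousOn (g := fun x => Real.sin (2 * Real.pi * k * x)) (by fun_prop)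
  have hc' : IntervalIntegrable
      (fun x : ℝ => ((F x * Real.cos (2 * Real.pi * k * x) : ℝ) : ℂ)) volume 0 1 :=
    ⟨hc.1.ofReal, hc.2.ofReal⟩
  have hs' : IntervalIntegrable
      (fun x : ℝ => ((F x * Real.sin (2 * Real.pi * k * x) : ℝ) : ℂ)) volume 0 1 :=
    ⟨hs.1.ofReal, hs.2.ofReal⟩
  rw [fourierCoeff_eq_intervalIntegral _ _ 0, zero_add, div_one, one_smul,
    ← intervalIntegral.integral_ofReal, ← intervalIntegral.integral_ofReal,
    ← intervalIntegral.integral_mul_const, ← intervalIntegral.integral_sub hc'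
      (hs'.mul_const _)]
  refine intervalIntegral.integral_congr fun x _ => ?_
  have : 2 * (Real.pi : ℂ) * Complex.I * ((-k : ℤ) : ℂ) * x / (1 : ℝ) =
      ((-(2 * Real.pi * k * x) : ℝ) : ℂ) * Complex.I := by
    push_cast; ring
  simp only [fourier_coe_apply, this, Complex.exp_mul_I, ← Complex.ofReal_cos,
    ← Complex.ofReal_sin, Real.cos_neg, Real.sin_neg, smul_eq_mul]
  push_cast
  ring

end Burgers

/-! ### Sobolev norms and càdlàg curves in L² coordinates. -/

namespace Burgers

open ComplexConjugate

theorem sobolevNorm_eq (n : ℕ) (φ : L2) :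
    sobolevNorm n φ = (∑' k, ENNReal.ofReal ((kap k ^ n * ‖coef φ k‖) ^ 2)) ^ (1 / 2 : ℝ) := by
  simp only [sobolevNorm, kap, coef, mul_pow, ← pow_mul, mul_comm n 2]

theorem enorm_eq (φ : L2) :
    ‖φ‖ₑ = (∑' k, ENNReal.ofReal (‖coef φ k‖ ^ 2)) ^ (1 / 2 : ℝ) := by
  have h : ∀ k, ENNReal.ofReal (‖coef φ k‖ ^ 2) = ‖coef φ k‖ₑ ^ 2 := fun k => by
    rw [ENNReal.ofReal_pow (norm_nonneg _), ofReal_norm]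
  simp_rw [h]
  rw [tsum_enorm_coef_sq, ← ENNReal.rpow_natCast, ← ENNReal.rpow_mul]
  norm_num

theorem sobolevNorm_eq_enorm {n : ℕ} {φ ψ : L2}
    (h : ∀ k, kap k ^ n * ‖coef φ k‖ = ‖coef ψ k‖) : sobolevNorm n φ = ‖ψ‖ₑ := by
  simp_rw [sobolevNorm_eq, enorm_eq, h]

theorem sobolevNorm_J_le (n : ℕ) (x : L2) : sobolevNorm n (J n x) ≤ ‖x‖ₑ := by
  rw [sobolevNorm_eq, enorm_eq]
  refine ENNReal.rpow_le_rpow (ENNReal.tsum_le_tsum fun k => ENNReal.ofReal_le_ofReal ?_)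
    (by norm_num)
  have h0 := kap_nonneg k
  refine pow_le_pow_left₀ (by positivity) ?_ 2
  rw [norm_coef_J, ← mul_assoc, ← mul_pow]
  refine mul_le_of_le_one_left (norm_nonneg _) ?_
  exact pow_le_one₀ (mul_nonneg h0 (inv_nonneg.2 h0)) mul_inv_le_one

theorem coef_index_zero (φ : L2) : coef φ 0 = ((∫ x : UnitAddCircle, φ x : ℝ) : ℂ) := by
  rw [coef, fourierCoeff, ← volume_eq_haarAddCircle, ← integral_complex_ofReal]
  simp

theorem exists_D {n : ℕ} {φ : L2} (hφ : sobolevNorm n φ < ∞) :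
    ∃ ψ : L2, ∀ k, coef ψ k = ((kap k ^ n : ℝ) : ℂ) * coef φ k := by
  refine exists_coef_eq (summable_norm_sq_of_tsum_ne_top ?_) fun k => ?_
  · rw [sobolevNorm_eq, ENNReal.rpow_lt_top_iff_of_pos (by norm_num)] at hφ
    refine ((tsum_congr fun k => ?_).trans_lt hφ).ne
    have h0 := kap_nonneg k
    rw [← ofReal_norm, ← ENNReal.ofReal_pow (norm_nonneg _), norm_mul, Complex.norm_real,
      Real.norm_of_nonneg (by positivity)]
  · rw [kap_neg, coef_neg_index, map_mul, Complex.conj_ofReal]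

/-- The Fourier multiplier `(2π|k|)ⁿ`, which differentiates `n` times. -/
noncomputable def D (n : ℕ) (φ : L2) : L2 := synth fun k => ((kap k ^ n : ℝ) : ℂ) * coef φ k

theorem coef_D {n : ℕ} {φ : L2} (hφ : sobolevNorm n φ < ∞) (k : ℤ) :
    coef (D n φ) k = ((kap k ^ n : ℝ) : ℂ) * coef φ k :=
  coef_synth (exists_D hφ) k

/-- For k = 0 the multipliers do not cancel unless n = 0; there the vanishing mean of φ is what
makes both sides agree. -/
theorem J_D {n : ℕ} {φ : L2} (hφ : φ ∈ H n) : J n (D n φ) = φ := by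
  refine L2_ext fun k => ?_
  rw [coef_J, coef_D hφ.2]
  rcases eq_or_ne k 0 with rfl | hk
  · rw [coef_index_zero, hφ.1]; simp
  · have := (kap_pos hk).ne'
    rw [← mul_assoc, ← Complex.ofReal_mul, ← mul_pow, inv_mul_cancel₀ this]
    simp

theorem sobolevNorm_sub_eq {n : ℕ} {φ ψ : L2} (hφ : φ ∈ H n) (hψ : ψ ∈ H n) :
    sobolevNorm n (φ - ψ) = ‖D n φ - D n ψ‖ₑ := by
  refine sobolevNorm_eq_enorm fun k => ?_
  have h0 := kap_nonneg k
  rw [coef_sub, coef_sub, coef_D hφ.2, coef_D hψ.2, ← mul_sub, norm_mul, Complex.norm_real,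
    Real.norm_of_nonneg (by positivity)]

theorem sobolevNorm_eq_enorm_D {n : ℕ} {φ : L2} (hφ : φ ∈ H n) :
    sobolevNorm n φ = ‖D n φ‖ₑ := by
  refine sobolevNorm_eq_enorm fun k => ?_
  have h0 := kap_nonneg k
  rw [coef_D hφ.2, norm_mul, Complex.norm_real, Real.norm_of_nonneg (by positivity)]

theorem J_mem_H (m : ℕ) (x : L2) : J (m + 1) x ∈ H (m + 1) := by
  refine ⟨?_, (sobolevNorm_J_le _ x).trans_lt (by finiteness)⟩
  have h := coef_index_zero (J (m + 1) x)
  rw [coef_J] at h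
  simpa using h.symm

section curves

variable {n : ℕ} {T : ℝ} {u : ℝ → L2}

theorem tendsto_D {l : Filter ℝ} {φ : L2} (hφ : φ ∈ H n) (hu : ∀ᶠ s in l, u s ∈ H n)
    (h : Tendsto (fun s => sobolevNorm n (u s - φ)) l (𝓝 0)) :
    Tendsto (fun s => D n (u s)) l (𝓝 (D n φ)) := by
  rw [tendsto_iff_edist_tendsto_0]
  refine h.congr' ?_
  filter_upwards [hu] with s hs
  rw [sobolevNorm_sub_eq hs hφ, edist_eq_enorm_sub]

/-- Each time has a neighbourhood on which u is bounded: on the right by right-continuity, on the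
left by the left limit. Compactness of [0,T] does the rest. -/
theorem IsCadlag.exists_bound (hu : IsCadlag n T u) :
    ∃ M : ℝ, ∀ t ∈ Icc 0 T, ‖D n (u t)‖ ≤ M := by
  have key := isCompact_Icc.induction_on (s := Icc 0 T)
    (p := fun S => ∃ M : ℝ, ∀ t ∈ S, t ∈ Icc 0 T → ‖D n (u t)‖ ≤ M)
    ⟨0, fun t ht => absurd ht (notMem_empty t)⟩
    (fun S S' hS ⟨M, hM⟩ => ⟨M, fun t ht => hM t (hS ht)⟩)
    (fun S S' ⟨M, hM⟩ ⟨M', hM'⟩ => ⟨max M M', fun t ht htT => by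
      rcases ht with ht | ht
      · exact (hM t ht htT).trans (le_max_left _ _)
      · exact (hM' t ht htT).trans (le_max_right _ _)⟩)
    (fun t ht => by
      have hright : ∃ M : ℝ, ∀ᶠ s in 𝓝[>] t, s ∈ Icc 0 T → ‖D n (u s)‖ ≤ M := by
        rcases ht.2.eq_or_lt with rfl | htT
        · refine ⟨0, ?_⟩
          filter_upwards [self_mem_nhdsWithin] with s hs hs'
          exact absurd hs'.2 (not_le.2 hs)
        · have hmem : ∀ᶠ s in 𝓝[>] t, u s ∈ H n := by
            filter_upwards [Ioo_mem_nhdsGT htT] with s hs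
            exact hu.mem s ⟨ht.1.trans hs.1.le, hs.2.le⟩
          have := (tendsto_D (hu.mem t ht) hmem (hu.right_cont t ⟨ht.1, htT⟩)).norm
          refine ⟨‖D n (u t)‖ + 1, ?_⟩
          filter_upwards [this.eventually (gt_mem_nhds (lt_add_one _))] with s hs _
          exact hs.le
      have hleft : ∃ M : ℝ, ∀ᶠ s in 𝓝[<] t, s ∈ Icc 0 T → ‖D n (u s)‖ ≤ M := by
        rcases ht.1.eq_or_lt with rfl | ht0
        · refine ⟨0, ?_⟩
          filter_upwards [self_mem_nhdsWithin] with s hs hs'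
          exact absurd hs'.1 (not_le.2 hs)
        · obtain ⟨l, hl, hlim⟩ := hu.left_lim t ⟨ht0, ht.2⟩
          have hmem : ∀ᶠ s in 𝓝[<] t, u s ∈ H n := by
            filter_upwards [Ioo_mem_nhdsLT ht0] with s hs
            exact hu.mem s ⟨hs.1.le, hs.2.le.trans ht.2⟩
          have := (tendsto_D hl hmem hlim).norm
          refine ⟨‖D n l‖ + 1, ?_⟩
          filter_upwards [this.eventually (gt_mem_nhds (lt_add_one _))] with s hs _
          exact hs.le
      obtain ⟨M, hM⟩ := hright
      obtain ⟨M', hM'⟩ := hleft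
      refine ⟨{s | s ∈ Icc 0 T → ‖D n (u s)‖ ≤ max (max M M') ‖D n (u t)‖},
        mem_nhdsWithin_of_mem_nhds ?_, _, fun s hs hsT => hs hsT⟩
      rw [← nhdsNE_sup_pure, ← nhdsLT_sup_nhdsGT]
      refine ⟨⟨?_, ?_⟩, fun _ => le_max_right _ _⟩
      · filter_upwards [hM'] with s hs hsT
        exact (hs hsT).trans ((le_max_right _ _).trans (le_max_left _ _))
      · filter_upwards [hM] with s hs hsT
        exact (hs hsT).trans ((le_max_left _ _).trans (le_max_left _ _)))
  obtain ⟨M, hM⟩ := key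
  exact ⟨M, fun t ht => hM t ht ht⟩

theorem IsCadlag.supNorm_ne_top (hu : IsCadlag n T u) : supNorm n T u ≠ ∞ := by
  obtain ⟨M, hM⟩ := hu.exists_bound
  refine ((iSup₂_le fun t ht => ?_).trans_lt (ENNReal.ofReal_lt_top (r := M))).ne
  rw [sobolevNorm_eq_enorm_D (hu.mem t ht), ← ofReal_norm]
  exact ENNReal.ofReal_le_ofReal (hM t ht)

theorem IsCadlag.norm_D_le (hu : IsCadlag n T u) {t : ℝ} (ht : t ∈ Icc 0 T) :
    ‖D n (u t)‖ ≤ (supNorm n T u).toReal := by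
  rw [← ENNReal.ofReal_le_ofReal_iff ENNReal.toReal_nonneg, ENNReal.ofReal_toReal
    hu.supNorm_ne_top, ofReal_norm, ← sobolevNorm_eq_enorm_D (hu.mem t ht)]
  exact le_iSup₂ (f := fun t (_ : t ∈ Icc 0 T) => sobolevNorm n (u t)) t ht

open Classical in
/-- The curve `u` on `[0,T)` in the coordinates of `Hⁿ`, extended by zero. -/
noncomputable def coords (n : ℕ) (T : ℝ) (u : ℝ → L2) (t : ℝ) : L2 :=
  if t ∈ Ico 0 T then D n (u t) else 0

theorem coords_of_mem {t : ℝ} (ht : t ∈ Ico 0 T) : coords n T u t = D n (u t) := if_pos ht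

theorem J_coords (hu : IsCadlag n T u) {t : ℝ} (ht : t ∈ Ico 0 T) :
    J n (coords n T u t) = u t := by
  rw [coords_of_mem ht, J_D (hu.mem t ⟨ht.1, ht.2.le⟩)]

theorem IsCadlag.norm_coords_le (hu : IsCadlag n T u) (t : ℝ) :
    ‖coords n T u t‖ ≤ (supNorm n T u).toReal := by
  by_cases ht : t ∈ Ico 0 T
  · rw [coords_of_mem ht]; exact hu.norm_D_le ⟨ht.1, ht.2.le⟩
  · rw [coords, if_neg ht, norm_zero]; exact ENNReal.toReal_nonneg

/-- Extension by zero keeps right-continuity because T is excluded: a nonzero value kept at T would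
break it there. -/
theorem IsCadlag.bddRightCont_coords (hu : IsCadlag n T u) : BddRightCont (coords n T u) := by
  refine ⟨fun t => ?_, _, hu.norm_coords_le⟩
  rw [ContinuousWithinAt]
  by_cases ht : t ∈ Ico 0 T
  · rw [coords_of_mem ht]
    have hmem : ∀ᶠ s in 𝓝[>] t, s ∈ Ico 0 T := by
      filter_upwards [Ioo_mem_nhdsGT ht.2] with s hs
      exact ⟨ht.1.trans hs.1.le, hs.2⟩
    refine (tendsto_D (hu.mem t ⟨ht.1, ht.2.le⟩) (hmem.mono fun s hs =>
      hu.mem s ⟨hs.1, hs.2.le⟩) (hu.right_cont t ht)).congr' ?_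
    filter_upwards [hmem] with s hs
    rw [coords_of_mem hs]
  · have hev : ∀ᶠ s in 𝓝[>] t, s ∉ Ico 0 T := by
      rcases lt_or_ge t 0 with h0 | h0
      · filter_upwards [Ioo_mem_nhdsGT h0] with s hs hs'
        exact absurd hs'.1 (not_le.2 hs.2)
      · filter_upwards [self_mem_nhdsWithin] with s hs hs'
        exact ht ⟨h0, lt_trans hs hs'.2⟩
    rw [coords, if_neg ht]
    refine tendsto_const_nhds.congr' ?_
    filter_upwards [hev] with s hs
    rw [coords, if_neg hs]

theorem isCadlag_J {m : ℕ} {x : ℝ → L2} (hx : Continuous x) (T : ℝ) :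
    IsCadlag (m + 1) T fun t => J (m + 1) (x t) := by
  have h : ∀ t, Tendsto (fun s => sobolevNorm (m + 1) (J (m + 1) (x s) - J (m + 1) (x t)))
      (𝓝 t) (𝓝 0) := fun t => by
    have h1 := tendsto_iff_edist_tendsto_0.1 (hx.tendsto t)
    refine tendsto_of_tendsto_of_tendsto_of_le_of_le tendsto_const_nhds h1
      (fun _ => zero_le) fun s => ?_
    rw [edist_eq_enorm_sub]
    simp only [← J_sub]
    exact sobolevNorm_J_le _ _
  exact ⟨fun t _ => J_mem_H m _, fun t _ => (h t).mono_left nhdsWithin_le_nhds,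
    fun t _ => ⟨_, J_mem_H m (x t), (h t).mono_left nhdsWithin_le_nhds⟩⟩

end curves

end Burgers

/-! ### Mild solutions and the weak equation. -/

namespace Burgers

open ComplexConjugate

theorem coeFn_add_sq (w v : L2) :
    (fun x : UnitAddCircle => ((w + v : L2) x) * ((w + v : L2) x)) =ᵐ[volume]
      fun x => (w x + v x) ^ 2 := by
  filter_upwards [Lp.coeFn_add w v] with x hx
  rw [hx, Pi.add_apply, pow_two]

theorem fourierCoeff_add_sq (w v : L2) (k : ℤ) :
    fourierCoeff (fun x : UnitAddCircle => (((w x + v x) ^ 2 : ℝ) : ℂ)) k =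
      cv (w + v) (w + v) k := by
  rw [cv]
  refine congrFun (fourierCoeff_congr_ae ?_) k
  rw [← volume_eq_haarAddCircle]
  filter_upwards [coeFn_add_sq w v] with x hx
  rw [hx]

theorem integrable_add_sq (w v : L2) :
    Integrable fun x : UnitAddCircle => (w x + v x) ^ 2 := by
  refine Integrable.congr ?_ (coeFn_add_sq w v)
  have := (Lp.memLp (w + v)).integrable_sq
  simpa only [pow_two] using this

theorem integrable_coeFn (w : L2) : Integrable (w : UnitAddCircle → ℝ) :=
  (Lp.memLp w).integrable (by norm_num)

/-- The `k`-th Fourier mode of `ν ∂ₓₓx - ½ ∂ₓ(x + v)²` in the coordinates of `Hⁿ`, `n = m + 1`. -/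
noncomputable def rhs (m : ℕ) (ν : ℝ) (x v : L2) (k : ℤ) : ℂ :=
  -((ν * kap k ^ 2 : ℝ) : ℂ) * coef x k + forcing (B m (x + v) (x + v)) k

/-- The weak form of the right-hand side of the equation, tested with `φ`. -/
noncomputable def weakRhs (ν : ℝ) (w v : L2) (φ : ℝ → ℝ) : ℝ :=
  ν * (∫ x in (0 : ℝ)..1, w x * iteratedDeriv 2 φ x) +
    1 / 2 * ∫ x in (0 : ℝ)..1, (w x + v x) ^ 2 * deriv φ x

/-- Removes the weight (2π|k|)ⁿ, returning to the actual functions w and v. At k = 0 both sides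
vanish, so the mean lost in `B` does no harm. -/
theorem coef_J_rhs (m : ℕ) (ν : ℝ) (x v : L2) (k : ℤ) :
    (((kap k)⁻¹ ^ (m + 1) : ℝ) : ℂ) * rhs m ν x v k =
      -((ν * kap k ^ 2 : ℝ) : ℂ) * coef (J (m + 1) x) k -
        ((Real.pi * k : ℝ) : ℂ) * Complex.I *
          cv (J (m + 1) x + J (m + 1) v) (J (m + 1) x + J (m + 1) v) k := by
  rcases eq_or_ne k 0 with rfl | hk
  · simp
  · rw [← J_add, ← coef_J_B _ _ hk, rhs, forcing, coef_J, coef_J]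
    ring

/-- Parseval against φ'' and φ', after which the derivatives become factors of the coefficients of φ
itself. -/
theorem hasSum_weakRhs (m : ℕ) (ν : ℝ) (x v : L2) {φ : ℝ → ℝ}
    (hφ : ContDiff ℝ (⊤ : ℕ∞) φ) (hp : Function.Periodic φ 1) :
    HasSum (fun k => pc φ k * conj ((((kap k)⁻¹ ^ (m + 1) : ℝ) : ℂ) * rhs m ν x v k))
      (weakRhs ν (J (m + 1) x) (J (m + 1) v) φ : ℂ) := by
  have hφ1 : ContDiff ℝ (⊤ : ℕ∞) (deriv φ) := (contDiff_infty_iff_deriv.1 hφ).2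
  have hφ2 : ContDiff ℝ (⊤ : ℕ∞) (deriv (deriv φ)) := (contDiff_infty_iff_deriv.1 hφ1).2
  have hle : (2 : WithTop ℕ∞) ≤ ((⊤ : ℕ∞) : WithTop ℕ∞) :=
    WithTop.coe_le_coe.2 (le_top : (2 : ℕ∞) ≤ ⊤)
  have hd2 : iteratedDeriv 2 φ = deriv (deriv φ) := by
    rw [iteratedDeriv_succ, iteratedDeriv_one]
  have h1 := (hasSum_integral_mul (integrable_coeFn (J (m + 1) x)) (hφ2.of_le hle)
    (periodic_deriv (periodic_deriv hp))).mul_left (ν : ℂ)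
  have h2 := (hasSum_integral_mul (integrable_add_sq (J (m + 1) x) (J (m + 1) v))
    (hφ1.of_le hle) (periodic_deriv hp)).mul_left (1 / 2 : ℂ)
  have h := h1.add h2
  have hval : (weakRhs ν (J (m + 1) x) (J (m + 1) v) φ : ℂ) =
      ν * ((∫ y in (0 : ℝ)..1, (J (m + 1) x) y * deriv (deriv φ) y : ℝ) : ℂ) +
        1 / 2 * ((∫ y in (0 : ℝ)..1, ((J (m + 1) x) y + (J (m + 1) v) y) ^ 2 * deriv φ y : ℝ) : ℂ)
        := by
    rw [weakRhs, hd2]; push_cast; rfl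
  rw [hval]
  refine (funext fun k => ?_ : (fun k => pc φ k *
    conj ((((kap k)⁻¹ ^ (m + 1) : ℝ) : ℂ) * rhs m ν x v k)) = _) ▸ h
  rw [coef_J_rhs, fourierCoeff_add_sq, pc_deriv_deriv (hφ.of_le hle) hp,
    pc_deriv ((hφ.of_le hle).of_le one_le_two) hp]
  change _ = _ * (_ * conj (coef (J (m + 1) x) k)) + _
  simp only [map_sub, map_mul, map_neg, Complex.conj_ofReal, Complex.conj_I]
  push_cast
  ring

theorem weakRhs_cos_sin (m : ℕ) (ν : ℝ) (x v : L2) (k : ℤ) :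
    (((kap k)⁻¹ ^ (m + 1) : ℝ) : ℂ) * rhs m ν x v k =
      (weakRhs ν (J (m + 1) x) (J (m + 1) v) (fun y => Real.cos (2 * Real.pi * k * y)) : ℂ) -
        weakRhs ν (J (m + 1) x) (J (m + 1) v) (fun y => Real.sin (2 * Real.pi * k * y)) *
          Complex.I := by
  set c := 2 * Real.pi * k with hc
  have dlin : ∀ y : ℝ, HasDerivAt (fun y => c * y) c y := fun y => by
    simpa using (hasDerivAt_id y).const_mul c
  have dcos : deriv (fun y => Real.cos (c * y)) = fun y => -c * Real.sin (c * y) := by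
    ext y; rw [(dlin y).cos.deriv]; ring
  have dsin : deriv (fun y => Real.sin (c * y)) = fun y => c * Real.cos (c * y) := by
    ext y; rw [(dlin y).sin.deriv]; ring
  have dcos2 : iteratedDeriv 2 (fun y => Real.cos (c * y)) =
      fun y => -c ^ 2 * Real.cos (c * y) := by
    ext y
    rw [iteratedDeriv_succ, iteratedDeriv_one, dcos, ((dlin y).sin.const_mul (-c)).deriv]; ring
  have dsin2 : iteratedDeriv 2 (fun y => Real.sin (c * y)) =
      fun y => -c ^ 2 * Real.sin (c * y) := by
    ext y
    rw [iteratedDeriv_succ, iteratedDeriv_one, dsin, ((dlin y).cos.const_mul c).deriv]; ring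
  have h1 := fourierCoeff_eq_cos_sub_sin (integrable_coeFn (J (m + 1) x)) k
  have h2 := fourierCoeff_eq_cos_sub_sin (integrable_add_sq (J (m + 1) x) (J (m + 1) v)) k
  rw [fourierCoeff_add_sq] at h2
  change coef (J (m + 1) x) k = _ at h1
  rw [coef_J_rhs, h1, h2, weakRhs, weakRhs, dcos2, dsin2, dcos, dsin]
  simp only [mul_left_comm _ (-c ^ 2), mul_left_comm _ (-c), mul_left_comm _ c,
    intervalIntegral.integral_const_mul, ← hc]
  have hk : kap k ^ 2 = c ^ 2 := by rw [kap, hc, mul_pow, mul_pow, sq_abs]; ring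
  rw [hk, show Real.pi * k = c / 2 by rw [hc]; ring]
  push_cast
  linear_combination (c / 2 * ((∫ y in (0 : ℝ)..1,
    ((J (m + 1) x) y + (J (m + 1) v) y) ^ 2 * Real.sin (c * y) : ℝ) : ℂ)) * Complex.I_sq

theorem BddRightCont.rhs {V x : ℝ → L2} (hV : BddRightCont V) (hx : BddRightCont x) (m : ℕ)
    (ν : ℝ) (k : ℤ) : BddRightCont fun s => rhs m ν (x s) (V s) k :=
  ((hx.coef k).of_le ((hx.coef k).rightCont.comp (continuous_const.mul continuous_id))
    ‖-((ν * kap k ^ 2 : ℝ) : ℂ)‖ (norm_nonneg _) fun _ => (norm_mul _ _).le).add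
    ((hV.sqAdd hx m).forcing k)

/-- A mild solution satisfies the equation mode by mode. -/
theorem coef_eq_integral_rhs {m : ℕ} {ν T : ℝ} (hν : 0 < ν) {V x : ℝ → L2}
    (hV : BddRightCont V) (hx : BddRightCont x)
    (heq : ∀ t ∈ Icc 0 T, x t = sol ν (sqAdd m V x) t) {t : ℝ} (ht : t ∈ Icc 0 T) (k : ℤ) :
    coef (x t) k = ∫ s in (0 : ℝ)..t, rhs m ν (x s) (V s) k := by
  have hf := (hV.sqAdd hx m).forcing k
  have hm : ∀ s ∈ Icc 0 T, coef (x s) k = mode ν (sqAdd m V x) k s := fun s hs => by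
    rw [heq s hs, coef_sol hν (hV.sqAdd hx m) hs.1]
  rw [hm t ht, mode, duh_eq_integral hf.rightCont hf.intervalIntegrable]
  refine intervalIntegral.integral_congr fun s hs => ?_
  rw [uIcc_of_le ht.1] at hs
  simp only [Burgers.rhs, hm s ⟨hs.1, hs.2.trans ht.2⟩]
  rfl

theorem kap_mul_norm_pc {φ : ℝ → ℝ} (hφ : ContDiff ℝ 1 φ) (hp : Function.Periodic φ 1) (k : ℤ) :
    kap k * ‖pc φ k‖ = ‖pc (deriv φ) k‖ := by
  rw [pc_deriv hφ hp, norm_mul, kap]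
  congr 1
  simp only [norm_mul, Complex.norm_I, Complex.norm_real, Complex.norm_intCast]
  simp [abs_of_pos Real.pi_pos]

theorem norm_rhs_le (m : ℕ) {ν : ℝ} (hν : 0 < ν) (x v : L2) (k : ℤ) :
    ‖rhs m ν x v k‖ ≤ ν * kap k ^ 2 * ‖x‖ + kap k * ‖B m (x + v) (x + v)‖ := by
  have h0 := kap_nonneg k
  refine (norm_add_le _ _).trans (add_le_add ?_ ?_)
  · rw [norm_mul, norm_neg, Complex.norm_real, Real.norm_of_nonneg (by positivity)]
    exact mul_le_mul_of_nonneg_left (norm_coef_le x k) (by positivity)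
  · rw [norm_forcing]
    exact mul_le_mul (by linarith) (norm_coef_le _ k) (norm_nonneg _) h0

/-- A mild solution solves the equation in the sense of distributions. -/
theorem integral_mul_eq_integral_weakRhs {m : ℕ} {ν T : ℝ} (hν : 0 < ν) {V x : ℝ → L2}
    (hV : BddRightCont V) (hx : BddRightCont x)
    (heq : ∀ t ∈ Icc 0 T, x t = sol ν (sqAdd m V x) t) {φ : ℝ → ℝ}
    (hφ : ContDiff ℝ (⊤ : ℕ∞) φ) (hp : Function.Periodic φ 1) {t : ℝ} (ht : t ∈ Icc 0 T) :
    ∫ y in (0 : ℝ)..1, (J (m + 1) (x t)) y * φ y =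
      ∫ s in (0 : ℝ)..t, weakRhs ν (J (m + 1) (x s)) (J (m + 1) (V s)) φ := by
  have hφ1 : ContDiff ℝ (⊤ : ℕ∞) (deriv φ) := (contDiff_infty_iff_deriv.1 hφ).2
  have hφ2 : ContDiff ℝ (⊤ : ℕ∞) (deriv (deriv φ)) := (contDiff_infty_iff_deriv.1 hφ1).2
  have hle : (2 : WithTop ℕ∞) ≤ ((⊤ : ℕ∞) : WithTop ℕ∞) :=
    WithTop.coe_le_coe.2 (le_top : (2 : ℕ∞) ≤ ⊤)
  have hφC2 : ContDiff ℝ 2 φ := hφ.of_le hle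
  obtain ⟨M, hM⟩ := hx.bdd
  obtain ⟨M', hM'⟩ := (hV.sqAdd hx m).bdd
  have hsum : Summable fun k =>
      ν * M * ‖pc (deriv (deriv φ)) k‖ + M' * ‖pc (deriv φ) k‖ :=
    ((summable_pc (hφ2.of_le hle) (periodic_deriv (periodic_deriv hp))).norm.mul_left _).add
      ((summable_pc (hφ1.of_le hle) (periodic_deriv hp)).norm.mul_left _)
  have hr := fun k => hV.rhs hx m ν k
  have hR := intervalIntegral.hasSum_integral_of_dominated_convergence (μ := volume)
    (a := 0) (b := t)
    (F := fun k s => pc φ k * conj ((((kap k)⁻¹ ^ (m + 1) : ℝ) : ℂ) * rhs m ν (x s) (V s) k))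
    (f := fun s => (weakRhs ν (J (m + 1) (x s)) (J (m + 1) (V s)) φ : ℂ))
    (fun k _ => ν * M * ‖pc (deriv (deriv φ)) k‖ + M' * ‖pc (deriv φ) k‖)
    (fun k => ((hr k).rightCont.comp (g := fun z : ℂ =>
        pc φ k * conj ((((kap k)⁻¹ ^ (m + 1) : ℝ) : ℂ) * z)) (continuous_const.mul
          (Complex.continuous_conj.comp (continuous_const.mul continuous_id)))
        ).stronglyMeasurable.aestronglyMeasurable)
    -- The growth κ² and κ of the mode, κ = 2π|k|, is shifted onto the coefficients of φ. It yields
    -- those of φ'' and φ', which are summable, and the majorant does not depend on s.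
    (fun k => .of_forall fun s _ => by
      have h0 := kap_nonneg k
      have h1 := inv_nonneg.2 h0
      rw [norm_mul, RCLike.norm_conj, norm_mul, Complex.norm_real,
        Real.norm_of_nonneg (by positivity)]
      have e1 : (kap k)⁻¹ ^ (m + 1) * ‖rhs m ν (x s) (V s) k‖ ≤
          ν * kap k ^ 2 * M + kap k * M' := by
        refine (mul_le_of_le_one_left (norm_nonneg _) (pow_le_one₀ h1 (inv_kap_le_one k))).trans ?_
        refine (norm_rhs_le m hν (x s) (V s) k).trans ?_
        exact add_le_add (mul_le_mul_of_nonneg_left (hM s) (by positivity))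
          (mul_le_mul_of_nonneg_left (hM' s) h0)
      refine (mul_le_mul_of_nonneg_left e1 (norm_nonneg _)).trans_eq ?_
      rw [pc_deriv_deriv hφC2 hp, ← kap_mul_norm_pc (hφC2.of_le one_le_two) hp, norm_mul, norm_neg,
        Complex.norm_real, Real.norm_of_nonneg (by positivity)]
      ring)
    (.of_forall fun s _ => hsum)
    intervalIntegrable_const
    (.of_forall fun s _ => hasSum_weakRhs m ν (x s) (V s) hφ hp)
  have hL := hasSum_integral_mul (integrable_coeFn (J (m + 1) (x t))) hφC2 hp
  have hterm : ∀ k, ∫ s in (0 : ℝ)..t,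
      pc φ k * conj ((((kap k)⁻¹ ^ (m + 1) : ℝ) : ℂ) * rhs m ν (x s) (V s) k) =
      pc φ k * conj (coef (J (m + 1) (x t)) k) := fun k => by
    rw [intervalIntegral.integral_const_mul, intervalIntegral.intervalIntegral_conj,
      intervalIntegral.integral_const_mul, coef_J, coef_eq_integral_rhs hν hV hx heq ht]
  simp_rw [hterm] at hR
  have := hL.unique hR
  rw [intervalIntegral.integral_ofReal] at this
  exact_mod_cast this

end Burgers

/-! ### Uniqueness of weak solutions and the final estimate. -/

namespace Burgers

open ComplexConjugate

theorem rhs_index_zero (m : ℕ) (ν : ℝ) (x v : L2) : rhs m ν x v 0 = 0 := by simp [rhs]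

theorem contDiff_cos_mul (c : ℝ) : ContDiff ℝ (⊤ : ℕ∞) fun y : ℝ => Real.cos (c * y) :=
  Real.contDiff_cos.comp (contDiff_const.mul contDiff_id)

theorem contDiff_sin_mul (c : ℝ) : ContDiff ℝ (⊤ : ℕ∞) fun y : ℝ => Real.sin (c * y) :=
  Real.contDiff_sin.comp (contDiff_const.mul contDiff_id)

theorem periodic_cos_mul (k : ℤ) : Function.Periodic (fun y => Real.cos (2 * Real.pi * k * y)) 1 :=
  fun y => by
    simp only
    rw [mul_add, mul_one, mul_comm (2 * Real.pi) (k : ℝ), Real.cos_add_int_mul_two_pi]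

theorem periodic_sin_mul (k : ℤ) : Function.Periodic (fun y => Real.sin (2 * Real.pi * k * y)) 1 :=
  fun y => by
    simp only
    rw [mul_add, mul_one, mul_comm (2 * Real.pi) (k : ℝ), Real.sin_add_int_mul_two_pi]

section uniqueness

variable {m : ℕ} {T ν : ℝ} {v w : ℝ → L2}

/-- The weak equation, tested with trigonometric functions, mode by mode. -/
theorem IsSolution.coef_eq (h : IsSolution (m + 1) T ν v w) (hv : IsCadlag (m + 1) T v)
    {t : ℝ} (ht : t ∈ Icc 0 T) (k : ℤ) :
    coef (w t) k = (((kap k)⁻¹ ^ (m + 1) : ℝ) : ℂ) *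
      ∫ s in (0 : ℝ)..t, rhs m ν (coords (m + 1) T w s) (coords (m + 1) T v s) k := by
  set X := coords (m + 1) T w
  set V := coords (m + 1) T v
  have hE : BddRightCont fun s => rhs m ν (X s) (V s) k :=
    hv.bddRightCont_coords.rhs h.cadlag.bddRightCont_coords m ν k
  have hEi := (hE.intervalIntegrable 0 t).const_mul (((kap k)⁻¹ ^ (m + 1) : ℝ) : ℂ)
  set wc := fun s => weakRhs ν (J (m + 1) (X s)) (J (m + 1) (V s))
    fun y => Real.cos (2 * Real.pi * k * y) with hwc
  set ws := fun s => weakRhs ν (J (m + 1) (X s)) (J (m + 1) (V s))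
    fun y => Real.sin (2 * Real.pi * k * y) with hws
  have hcs : ∀ s, (((kap k)⁻¹ ^ (m + 1) : ℝ) : ℂ) * rhs m ν (X s) (V s) k =
      (wc s : ℂ) - ws s * Complex.I := fun s => weakRhs_cos_sin m ν (X s) (V s) k
  have hre : ∀ s, wc s = ((((kap k)⁻¹ ^ (m + 1) : ℝ) : ℂ) * rhs m ν (X s) (V s) k).re := fun s => by
    rw [hcs]; simp
  have him : ∀ s, ws s = -((((kap k)⁻¹ ^ (m + 1) : ℝ) : ℂ) * rhs m ν (X s) (V s) k).im := fun s => by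
    rw [hcs]; simp
  -- The two weak right-hand sides are, up to sign, the real and imaginary parts of a bounded
  -- right-continuous mode, whence their integrability.
  have hwci : IntervalIntegrable (fun s => (wc s : ℂ)) volume 0 t := by
    simp only [hre]
    exact ⟨hEi.1.re.ofReal, hEi.2.re.ofReal⟩
  have hwsi : IntervalIntegrable (fun s => (ws s : ℂ)) volume 0 t := by
    simp only [him]
    exact ⟨hEi.1.im.neg.ofReal, hEi.2.im.neg.ofReal⟩
  have hweak : ∀ φ : ℝ → ℝ, ∀ s ∈ Ioo 0 t, weakRhs ν (w s) (v s) φ =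
      weakRhs ν (J (m + 1) (X s)) (J (m + 1) (V s)) φ := fun φ s hs => by
    have hs' : s ∈ Ico 0 T := ⟨hs.1.le, hs.2.trans_le ht.2⟩
    rw [J_coords h.cadlag hs', J_coords hv hs']
  have e1 : ∫ y in (0 : ℝ)..1, w t y * Real.cos (2 * Real.pi * k * y) = ∫ s in (0 : ℝ)..t, wc s :=
    (h.equation _ (contDiff_cos_mul _) (periodic_cos_mul k) t ht).trans
      (intervalIntegral.integral_congr_Ioo_of_le ht.1 (hweak _))
  have e2 : ∫ y in (0 : ℝ)..1, w t y * Real.sin (2 * Real.pi * k * y) = ∫ s in (0 : ℝ)..t, ws s :=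
    (h.equation _ (contDiff_sin_mul _) (periodic_sin_mul k) t ht).trans
      (intervalIntegral.integral_congr_Ioo_of_le ht.1 (hweak _))
  have e3 := fourierCoeff_eq_cos_sub_sin (integrable_coeFn (w t)) k
  change coef (w t) k = _ at e3
  rw [e3, e1, e2, ← intervalIntegral.integral_const_mul]
  simp_rw [hcs]
  rw [intervalIntegral.integral_sub hwci (hwsi.mul_const _), intervalIntegral.integral_mul_const,
    intervalIntegral.integral_ofReal, intervalIntegral.integral_ofReal]

/-- A weak solution is a mild solution. -/
theorem IsSolution.D_eq_sol (h : IsSolution (m + 1) T ν v w) (hv : IsCadlag (m + 1) T v)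
    (hν : 0 < ν) {t : ℝ} (ht : t ∈ Icc 0 T) :
    D (m + 1) (w t) = sol ν (sqAdd m (coords (m + 1) T v) (coords (m + 1) T w)) t := by
  have hX := h.cadlag.bddRightCont_coords
  have hV := hv.bddRightCont_coords
  refine L2_ext fun k => ?_
  have hD : ∀ s ∈ Icc 0 T, coef (D (m + 1) (w s)) k = ∫ r in (0 : ℝ)..s,
      rhs m ν (coords (m + 1) T w r) (coords (m + 1) T v r) k := fun s hs => by
    rw [coef_D (h.cadlag.mem s hs).2, h.coef_eq hv hs]
    rcases eq_or_ne k 0 with rfl | hk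
    · simp [rhs_index_zero]
    · rw [← mul_assoc, ← Complex.ofReal_mul, ← mul_pow, mul_inv_cancel₀ (kap_pos hk).ne']
      simp
  have hf := (hV.sqAdd hX m).forcing k
  have hr := hV.rhs hX m ν k
  rw [coef_sol hν (hV.sqAdd hX m) ht.1, hD t ht, mode]
  -- The mode of the right-hand side is expressed through its own primitive, which is the
  -- coefficient of `D (m + 1) (w s)`.
  refine integral_eq_duh (T := T) hr.rightCont hr.intervalIntegrable hf.intervalIntegrable
    (fun s hs => ?_) ht
  rw [← hD s ⟨hs.1, hs.2.le⟩]
  simp only [rhs, sqAdd, coords_of_mem hs]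

/-- The squared distance is bounded by a multiple of its own primitive. The half-open interval is
forced by the curves from `coords`, which vanish at T. -/
theorem eq_of_mild {V x y : ℝ → L2} (hν : 0 < ν) (hV : BddRightCont V) (hx : BddRightCont x)
    (hy : BddRightCont y) (hxe : ∀ t ∈ Ico 0 T, x t = sol ν (sqAdd m V x) t)
    (hye : ∀ t ∈ Ico 0 T, y t = sol ν (sqAdd m V y) t) {t : ℝ} (ht : t ∈ Ico 0 T) : x t = y t := by
  obtain ⟨N, hN⟩ := hV.bdd
  obtain ⟨M, hM⟩ := hx.bdd
  obtain ⟨M', hM'⟩ := hy.bdd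
  have hd := (hx.sub hy).norm_sq
  obtain ⟨Y, hY⟩ := hd.bdd
  have hle : ∀ r ∈ Icc 0 t, ‖x r - y r‖ ^ 2 ≤
      ((4 * ν)⁻¹ * (4 * algConst m * (max M M' + N)) ^ 2) *
        ∫ s in (0 : ℝ)..r, ‖x s - y s‖ ^ 2 := fun r hr => by
    have hr' : r ∈ Ico 0 T := ⟨hr.1, hr.2.trans_lt ht.2⟩
    have e := norm_sol_sq_sub_le hν (m := m) hV hx hy hN
      (fun s => (hM s).trans (le_max_left _ _)) (fun s => (hM' s).trans (le_max_right _ _)) hr.1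
    rwa [← hxe r hr', ← hye r hr'] at e
  have h0 : ‖x t - y t‖ ^ 2 = 0 :=
    eq_zero_of_le_mul_integral (T := t)
      (L := (4 * ν)⁻¹ * (4 * algConst m * (max M M' + N)) ^ 2) (by positivity)
      (y := fun s => ‖x s - y s‖ ^ 2) (fun r _ => hd.intervalIntegrable _ _)
      (fun r _ => sq_nonneg _) (fun r _ => (le_abs_self _).trans (hY r)) hle t ⟨ht.1, le_rfl⟩
  exact sub_eq_zero.1 (norm_eq_zero.1 (pow_eq_zero_iff two_ne_zero |>.1 h0))

theorem IsSolution.eq_of_mild (h : IsSolution (m + 1) T ν v w) (hv : IsCadlag (m + 1) T v)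
    (hν : 0 < ν) {x : ℝ → L2} (hx : BddRightCont x)
    (heq : ∀ t ∈ Icc 0 T, x t = sol ν (sqAdd m (coords (m + 1) T v) x) t)
    {t : ℝ} (ht : t ∈ Icc 0 T) : w t = J (m + 1) (x t) := by
  have hXx : ∀ s ∈ Ico 0 T, coords (m + 1) T w s = x s := fun s hs =>
    Burgers.eq_of_mild hν hv.bddRightCont_coords h.cadlag.bddRightCont_coords hx
      (fun r hr => (coords_of_mem hr).trans (h.D_eq_sol hv hν ⟨hr.1, hr.2.le⟩))
      (fun r hr => heq r ⟨hr.1, hr.2.le⟩) hs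
  -- Agreement on [0,T) already determines Duhamel's integral at t = T, and this settles the
  -- endpoint.
  have hsol : sol ν (sqAdd m (coords (m + 1) T v) (coords (m + 1) T w)) t =
      sol ν (sqAdd m (coords (m + 1) T v) x) t :=
    sol_congr ht.1 fun s hs => by rw [sqAdd, sqAdd, hXx s ⟨hs.1.le, hs.2.trans_le ht.2⟩]
  rw [← J_D (h.cadlag.mem t ht), h.D_eq_sol hv hν ht, hsol, ← heq t ht]

end uniqueness

theorem isSolution_J {m : ℕ} {T ν : ℝ} (hT : 0 < T) (hν : 0 < ν) {v x : ℝ → L2}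
    (hv : IsCadlag (m + 1) T v) (hc : Continuous x) (hx : BddRightCont x)
    (heq : ∀ t ∈ Icc 0 T, x t = sol ν (sqAdd m (coords (m + 1) T v) x) t) :
    IsSolution (m + 1) T ν v fun t => J (m + 1) (x t) := by
  have hV := hv.bddRightCont_coords
  refine ⟨isCadlag_J hc T, ?_, fun φ hφ hp t ht => ?_⟩
  · have h0 : (0 : ℝ) ∈ Icc 0 T := ⟨le_rfl, hT.le⟩
    have : x 0 = 0 := L2_ext fun k => by
      rw [coef_eq_integral_rhs hν hV hx heq h0, intervalIntegral.integral_same, coef_zero]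
    simp only [this, J_zero]
  · refine (integral_mul_eq_integral_weakRhs hν hV hx heq hφ hp ht).trans ?_
    refine intervalIntegral.integral_congr_Ioo_of_le ht.1 fun s hs => ?_
    simp only [J_coords hv ⟨hs.1.le, hs.2.trans_le ht.2⟩]
    rfl

theorem sobolevNorm_succ_J_sq_le (m : ℕ) (x : L2) :
    sobolevNorm (m + 1 + 1) (J (m + 1) x) ^ 2 ≤
      ∑' k, ENNReal.ofReal ((kap k * ‖coef x k‖) ^ 2) := by
  rw [sobolevNorm_eq, ← ENNReal.rpow_natCast, ← ENNReal.rpow_mul]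
  norm_num
  refine ENNReal.tsum_le_tsum fun k => ENNReal.ofReal_le_ofReal ?_
  have h0 := kap_nonneg k
  refine pow_le_pow_left₀ (by positivity) ?_ 2
  rw [norm_coef_J, pow_succ']
  calc kap k * kap k ^ (m + 1) * ((kap k)⁻¹ ^ (m + 1) * ‖coef x k‖)
      = (kap k * (kap k)⁻¹) ^ (m + 1) * (kap k * ‖coef x k‖) := by rw [mul_pow]; ring
    _ ≤ 1 * (kap k * ‖coef x k‖) := by
        refine mul_le_mul_of_nonneg_right ?_ (by positivity)
        exact pow_le_one₀ (mul_nonneg h0 (inv_nonneg.2 h0)) mul_inv_le_one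
    _ = _ := one_mul _

/-- Tonelli exchanges the integral with the sum over modes, and a series in [0, ∞] is the supremum
of its finite partial sums. Finiteness of the integral gives w(t) ∈ Hⁿ⁺¹ for almost every t. -/
theorem lintegral_sobolevNorm_succ_le {m : ℕ} {T K : ℝ} (hT : 0 < T) {x : ℝ → L2}
    (hc : Continuous x)
    (hK : ∀ S : Finset ℤ, ∑ k ∈ S, ∫ s in (0 : ℝ)..T, (kap k * ‖coef (x s) k‖) ^ 2 ≤ K) :
    ∫⁻ t in Icc 0 T, sobolevNorm (m + 1 + 1) (J (m + 1) (x t)) ^ 2 ≤ ENNReal.ofReal K := by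
  have hck : ∀ k, Continuous fun t => (kap k * ‖coef (x t) k‖) ^ 2 := fun k => by
    have := (continuous_coef k).comp hc
    exact (continuous_const.mul this.norm).pow 2
  refine (lintegral_mono fun t => sobolevNorm_succ_J_sq_le m (x t)).trans ?_
  rw [lintegral_tsum fun k => (hck k).measurable.ennreal_ofReal.aemeasurable,
    ENNReal.tsum_eq_iSup_sum]
  refine iSup_le fun S => ?_
  have h1 : ∀ k, ∫⁻ t in Icc 0 T, ENNReal.ofReal ((kap k * ‖coef (x t) k‖) ^ 2) =
      ENNReal.ofReal (∫ s in (0 : ℝ)..T, (kap k * ‖coef (x s) k‖) ^ 2) := fun k => by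
    rw [intervalIntegral.integral_of_le hT.le, ← integral_Icc_eq_integral_Ioc,
      ofReal_integral_eq_lintegral_ofReal ((hck k).integrableOn_Icc)
        (.of_forall fun t => by positivity)]
  simp_rw [h1]
  rw [← ENNReal.ofReal_sum_of_nonneg fun k _ =>
    intervalIntegral.integral_nonneg hT.le fun s _ => by positivity]
  exact ENNReal.ofReal_le_ofReal (hK S)

theorem supNorm_J_sq_le {m : ℕ} {T K : ℝ} (hT : 0 < T) {x : ℝ → L2}
    (hK : ∀ t ∈ Icc 0 T, ‖x t‖ ^ 2 ≤ K) :
    supNorm (m + 1) T (fun t => J (m + 1) (x t)) ^ 2 ≤ ENNReal.ofReal K := by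
  have hK0 : 0 ≤ K := (sq_nonneg _).trans (hK 0 ⟨le_rfl, hT.le⟩)
  have h : supNorm (m + 1) T (fun t => J (m + 1) (x t)) ≤ ENNReal.ofReal (Real.sqrt K) := by
    refine iSup₂_le fun t ht => (sobolevNorm_J_le _ _).trans ?_
    rw [← ofReal_norm]
    exact ENNReal.ofReal_le_ofReal (Real.le_sqrt_of_sq_le (hK t ht))
  refine (pow_le_pow_left' h 2).trans_eq ?_
  rw [← ENNReal.ofReal_pow (Real.sqrt_nonneg _), Real.sq_sqrt hK0]

theorem exists_solution (m : ℕ) {T ν : ℝ} (hT : 0 < T) (hν : 0 < ν) (r : ℝ) :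
    ∃ C : ℝ, 0 < C ∧ ∀ v : ℝ → L2, IsCadlag (m + 1) T v → (supNorm (m + 1) T v).toReal = r →
      ∃ w : ℝ → L2, IsSolution (m + 1) T ν v w ∧
        (∀ w' : ℝ → L2, IsSolution (m + 1) T ν v w' → EqOn w' w (Icc 0 T)) ∧
        supNorm (m + 1) T w ^ 2 + ∫⁻ t in Icc 0 T, sobolevNorm (m + 1 + 1) (w t) ^ 2 ≤
          ENNReal.ofReal C := by
  obtain ⟨K, hK⟩ := exists_mild_solution m hν hT r
  -- One K for the supremum, one for the integral, and 1 for strict positivity. K is chosen before v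
  -- and depends on v only through r.
  refine ⟨2 * |K| + 1, by positivity, fun v hv hr => ?_⟩
  obtain ⟨x, hc, hx, heq, h1, h2⟩ := hK (coords (m + 1) T v) hv.bddRightCont_coords
    fun s => hr ▸ hv.norm_coords_le s
  refine ⟨fun t => J (m + 1) (x t), isSolution_J hT hν hv hc hx heq,
    fun w' hw' t ht => hw'.eq_of_mild hv hν hx heq ht, ?_⟩
  refine (add_le_add (supNorm_J_sq_le hT h1) (lintegral_sobolevNorm_succ_le hT hc h2)).trans ?_
  have hK0 : 0 ≤ K := (sq_nonneg _).trans (h1 0 ⟨le_rfl, hT.le⟩)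
  rw [← ENNReal.ofReal_add hK0 hK0]
  refine ENNReal.ofReal_le_ofReal ?_
  linarith [le_abs_self K]

end Burgers

theorem theorem3p1 (n : ℕ) (hn : 1 ≤ n) :
    ∃ C : ℝ → ℝ → ℝ → ℝ, (∀ T ν r : ℝ, 0 < C T ν r) ∧
      ∀ (T ν : ℝ), 0 < T → 0 < ν →
        ∀ v : ℝ → Burgers.L2, Burgers.IsCadlag n T v →
          ∃ w : ℝ → Burgers.L2, Burgers.IsSolution n T ν v w ∧
            (∀ w' : ℝ → Burgers.L2, Burgers.IsSolution n T ν v w' → EqOn w' w (Icc 0 T)) ∧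
            (Burgers.supNorm n T w) ^ 2 +
                ∫⁻ t in Icc 0 T, (Burgers.sobolevNorm (n + 1) (w t)) ^ 2 ≤
              ENNReal.ofReal (C T ν (Burgers.supNorm n T v).toReal) := by
  obtain ⟨m, rfl⟩ : ∃ m, n = m + 1 := ⟨n - 1, by omega⟩
  classical
  -- The value 1 for the remaining T and ν only keeps C positive everywhere.
  refine ⟨fun T ν r => if h : 0 < T ∧ 0 < ν then
    (Burgers.exists_solution m h.1 h.2 r).choose else 1, fun T ν r => ?_, fun T ν hT hν v hv => ?_⟩
  · beta_reduce
    split_ifs with h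
    · exact (Burgers.exists_solution m h.1 h.2 r).choose_spec.1
    · exact one_pos
  · beta_reduce
    rw [dif_pos (And.intro hT hν)]
    exact (Burgers.exists_solution m hT hν _).choose_spec.2 v hv rfl
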